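/- Let $k$ be a field and let $H=(H,\Delta,\varepsilon,\Phi,S,\alpha,\beta)$ be a finite-dimensional quasi-Hopf algebra over $k$: $H$ is an associative unital algebra, $\Delta:H\to H\otimes H$ and $\varepsilon:H\to k$ are algebra maps, $\Phi=X^1\otimes X^2\otimes X^3\in H^{\otimes 3}$ is invertible with inverse $x^1\otimes x^2\otimes x^3$, $S$ is an anti-endomorphism of the algebra $H$ and $\alpha,\beta\in H$, such that $(id\otimes\Delta)\Delta(h)=\Phi\,(\Delta\otimes id)(\Delta(h))\,\Phi^{-1}$, $(id\otimes\varepsilon)\Delta(h)=h\otimes 1$, $(\varepsilon\otimes id)\Delta(h)=1\otimes h$, $(1\otimes\Phi)(id\otimes\Delta\otimes id)(\Phi)(\Phi\otimes1)=(id\otimes id\otimes\Delta)(\Phi)(\Delta\otimes id\otimes id)(\Phi)$, $(id\otimes\varepsilon\otimes id)(\Phi)=1$, $S(h_1)\alpha h_2=\varepsilon(h)\alpha$, $h_1\beta S(h_2)=\varepsilon(h)\beta$, $X^1\beta S(X^2)\alpha X^3=1$, $S(x^1)\alpha x^2\beta S(x^3)=1$. Assume the usual normalisation $\varepsilon(\alpha)=\varepsilon(\beta)=1$.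 Let $R=R^1\otimes R^2=r^1\otimes r^2\in H\otimes H$ be an R-matrix (so that $(H,R)$ is quasi-triangular): $\Delta^{op}(h)R=R\Delta(h)$, $(\varepsilon\otimes id)(R)=(id\otimes\varepsilon)(R)=1$ and $$(\Delta\otimes id)(R)=\Phi_{312}R_{13}\Phi^{-1}_{132}R_{23}\Phi,\qquad (id\otimes\Delta)(R)=\Phi^{-1}_{231}R_{13}\Phi_{213}R_{12}\Phi^{-1},$$ where $\Phi_{312}=X^2\otimes X^3\otimes X^1$, $\Phi^{-1}_{132}=x^1\otimes x^3\otimes x^2$, $\Phi^{-1}_{231}=x^3\otimes x^1\otimes x^2$, $\Phi_{213}=X^2\otimes X^1\otimes X^3$. (Then $R$ is invertible and $S$ is bijective.) The left $H$-modules form a braided monoidal category ${}_H\mathcal M$ with tensor product over $k$ and action via $\Delta$, associativity $(u\otimes v)\otimes w\mapsto\Phi\cdot(u\otimes(v\otimes w))$ and braiding $u\otimes v\mapsto R^2\cdot v\otimes R^1\cdot u$. Further copies of $\Phi$ are denoted $Y^1\otimes Y^2\otimes Y^3$, and further copies of $\Phi^{-1}$ are denoted $y^1\otimes y^2\otimes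 y^3$; summation is understood, $\Delta(h)=h_1\otimes h_2$. Put $p_R=p^1\otimes p^2=x^1\otimes x^2\beta S(x^3)$, $q_R=q^1\otimes q^2=X^1\otimes S^{-1}(\alpha X^3)X^2$, $p_L=\tilde p^1\otimes\tilde p^2=X^2S^{-1}(X^1\beta)\otimes X^3$, $R^{-1}=\overline R^1\otimes\overline R^2$; $\gamma=S(A^2)\alpha A^3\otimes S(A^1)\alpha A^4$ with $A^1\otimes A^2\otimes A^3\otimes A^4=(\Phi\otimes1)(\Delta\otimes id\otimes id)(\Phi^{-1})$; $\delta=B^1\beta S(B^4)\otimes B^2\beta S(B^3)$ with $B^1\otimes B^2\otimes B^3\otimes B^4=(\Delta\otimes id\otimes id)(\Phi)(\Phi^{-1}\otimes1)$; $f=f^1\otimes f^2=(S\otimes S)(\Delta^{op}(x^1))\,\gamma\,\Delta(x^2\beta S(x^3))$, with inverse $f^{-1}=g^1\otimes g^2=\Delta(S(x^1)\alpha x^2)\,\delta\,(S\otimes S)(\Delta^{op}(x^3))$; $U=U^1\otimes U^2=g^1S(q^2)\otimes g^2S(q^1)$. For $\chi\in H^*$ and $h',h''\in H$ let $\langle h'\rightharpoonup\chi\leftharpoonup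 h'',h\rangle=\chi(h''hh')$. The enveloping algebra braided group $\underline H$ is the vector space $H$ with action $h\triangleright h'=h_1h'S(h_2)$, product $h\bullet h'=X^1hS(x^1X^2)\alpha x^2X^3_1h'S(x^3X^3_2)$, unit $\beta$, coproduct $$\underline\Delta(h)=x^1X^1h_1g^1S(x^2R^2y^3X^3_2)\otimes x^3R^1\triangleright\bigl(y^1X^2h_2g^2S(y^2X^3_1)\bigr),$$ counit $\varepsilon$ and antipode $\underline S(h)=X^1R^2p^2\,S\bigl(q^1(X^2R^1p^1\triangleright h)S(q^2)X^3\bigr)$. The function algebra braided group $\underline{H^*}$ is the vector space $H^*$ with action $h\blacktriangleright\chi=h_2\rightharpoonup\chi\leftharpoonup S(h_1)$, product $$\chi\,\underline\cdot\,\psi=[x^3_1Y^2r^1y^1X^2\rightharpoonup\chi\leftharpoonup S(x^1X^1)f^2R^1]\,[x^3_2Y^3y^3X^3_2\rightharpoonup\psi\leftharpoonup S(x^2Y^1r^2y^2X^3_1)f^1R^2]$$ (on the right the convolution product of $H^*$), unit $\varepsilon$, coproduct $$\chi\mapsto\chi_1\leftharpoonup S(x^1)\otimes x^3_2X^3\rightharpoonup\chi_2\leftharpoonup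 x^2X^1\beta S(x^3_1X^2),\qquad\text{where }\chi_1(g)\chi_2(h)=\chi(gh),$$ counit $\chi\mapsto\chi(\alpha)$ and antipode $\chi\mapsto q^1_2\overline R^1_2\tilde p^2\rightharpoonup(\chi\circ S)\leftharpoonup q^2\overline R^2S(q^1_1\overline R^1_1\tilde p^1)$. Then $\underline{H^*}$ and $\underline H$ are Hopf algebras in the braided category ${}_H\mathcal M$, and the map $\mathcal Q:H^*\to H$, $$\mathcal Q(\chi)=\langle\chi,\,S(X^2_2\tilde p^2)f^1R^2r^1U^1X^3\rangle\;X^1S(X^2_1\tilde p^1)f^2R^1r^2U^2,$$ is a morphism of braided Hopf algebras from $\underline{H^*}$ to $\underline H$: it is left $H$-linear, a morphism of algebras and of coalgebras, and it commutes with the antipodes. -/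

import Mathlib

open scoped TensorProduct

namespace QuasiHopf

/-! ### Sweedler-type sums

For a tensor `t = ∑ aᵢ ⊗ bᵢ` and a bilinear expression `F`, `sum2 t F` is `∑ F aᵢ bᵢ`, computed on
some decomposition of `t`; likewise `sum3` and `sum4` for (right-nested) triple and fourfold tensors.
All expressions `F` used below are multilinear, so the value does not depend on the decomposition,
see `sum2_eq`, `sum3_eq` and `sum4_eq`. -/

noncomputable def sum2 {k M N P : Type*} [CommSemiring k] [AddCommMonoid M] [Module k M]
    [AddCommMonoid N] [Module k N] [AddCommMonoid P] (t : M ⊗[k] N) (F : M → N → P) : P :=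
  ((TensorProduct.exists_multiset t).choose.map fun i => F i.1 i.2).sum

noncomputable def sum3 {k M N L P : Type*} [CommSemiring k] [AddCommMonoid M] [Module k M]
    [AddCommMonoid N] [Module k N] [AddCommMonoid L] [Module k L] [AddCommMonoid P]
    (t : M ⊗[k] (N ⊗[k] L)) (F : M → N → L → P) : P :=
  sum2 t fun a u => sum2 u (F a)

noncomputable def sum4 {k M N L K P : Type*} [CommSemiring k] [AddCommMonoid M] [Module k M]
    [AddCommMonoid N] [Module k N] [AddCommMonoid L] [Module k L] [AddCommMonoid K] [Module k K]
    [AddCommMonoid P] (t : M ⊗[k] (N ⊗[k] (L ⊗[k] K))) (F : M → N → L → K → P) : P :=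
  sum2 t fun a u => sum3 u (F a)

theorem sum2_eq {k M N P : Type*} [CommSemiring k] [AddCommMonoid M] [Module k M]
    [AddCommMonoid N] [Module k N] [AddCommMonoid P] [Module k P]
    (t : M ⊗[k] N) (G : M ⊗[k] N →ₗ[k] P) : sum2 t (fun a b => G (a ⊗ₜ[k] b)) = G t := by
  conv_rhs => rw [(TensorProduct.exists_multiset t).choose_spec]
  rw [map_multiset_sum, Multiset.map_map]
  rfl

theorem sum3_eq {k M N L P : Type*} [CommSemiring k] [AddCommMonoid M] [Module k M]
    [AddCommMonoid N] [Module k N] [AddCommMonoid L] [Module k L] [AddCommMonoid P] [Module k P]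
    (t : M ⊗[k] (N ⊗[k] L)) (G : M ⊗[k] (N ⊗[k] L) →ₗ[k] P) :
    sum3 t (fun a b c => G (a ⊗ₜ[k] (b ⊗ₜ[k] c))) = G t := by
  have h : ∀ (a : M) (u : N ⊗[k] L),
      sum2 u (fun b c => G (a ⊗ₜ[k] (b ⊗ₜ[k] c))) = G (a ⊗ₜ[k] u) := fun a u =>
    sum2_eq u (G ∘ₗ TensorProduct.mk k M (N ⊗[k] L) a)
  simp only [sum3, h, sum2_eq]

theorem sum4_eq {k M N L K P : Type*} [CommSemiring k] [AddCommMonoid M] [Module k M]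
    [AddCommMonoid N] [Module k N] [AddCommMonoid L] [Module k L] [AddCommMonoid K] [Module k K]
    [AddCommMonoid P] [Module k P] (t : M ⊗[k] (N ⊗[k] (L ⊗[k] K)))
    (G : M ⊗[k] (N ⊗[k] (L ⊗[k] K)) →ₗ[k] P) :
    sum4 t (fun a b c d => G (a ⊗ₜ[k] (b ⊗ₜ[k] (c ⊗ₜ[k] d)))) = G t := by
  have h : ∀ (a : M) (u : N ⊗[k] (L ⊗[k] K)),
      sum3 u (fun b c d => G (a ⊗ₜ[k] (b ⊗ₜ[k] (c ⊗ₜ[k] d)))) = G (a ⊗ₜ[k] u) := fun a u =>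
    sum3_eq u (G ∘ₗ TensorProduct.mk k M (N ⊗[k] (L ⊗[k] K)) a)
  simp only [sum4, h, sum2_eq]

end QuasiHopf

/-! ### Quasi-Hopf algebras -/

/-- A quasi-Hopf algebra structure on the associative unital `k`-algebra `H`: comultiplication `Δ`,
counit `ε`, (invertible) reassociator `Φ`, antipode `S` (an algebra anti-endomorphism, not assumed
bijective) and the elements `α`, `β`. Iterated tensor products are nested to the right. -/
structure QuasiHopfAlgebra (k H : Type*) [Field k] [Ring H] [Algebra k H] where
  Δ : H →ₐ[k] H ⊗[k] H
  ε : H →ₐ[k] k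
  Φ : (H ⊗[k] (H ⊗[k] H))ˣ
  S : H →ₗ[k] H
  α : H
  β : H
  /-- `(id ⊗ Δ)(Δ h) = Φ (Δ ⊗ id)(Δ h) Φ⁻¹` -/
  quasi_coassoc : ∀ h : H,
    Algebra.TensorProduct.map (AlgHom.id k H) Δ (Δ h) =
      Φ * Algebra.TensorProduct.assoc k k k H H H
        (Algebra.TensorProduct.map Δ (AlgHom.id k H) (Δ h)) * ↑Φ⁻¹
  /-- `(id ⊗ ε)(Δ h) = h ⊗ 1` -/
  counit_right : ∀ h : H, Algebra.TensorProduct.map (AlgHom.id k H) ε (Δ h) = h ⊗ₜ[k] (1 : k)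
  /-- `(ε ⊗ id)(Δ h) = 1 ⊗ h` -/
  counit_left : ∀ h : H, Algebra.TensorProduct.map ε (AlgHom.id k H) (Δ h) = (1 : k) ⊗ₜ[k] h
  /-- `(1 ⊗ Φ)(id ⊗ Δ ⊗ id)(Φ)(Φ ⊗ 1) = (id ⊗ id ⊗ Δ)(Φ)(Δ ⊗ id ⊗ id)(Φ)` -/
  cocycle :
    ((1 : H) ⊗ₜ[k] (Φ : H ⊗[k] (H ⊗[k] H)) : H ⊗[k] (H ⊗[k] (H ⊗[k] H))) *
      Algebra.TensorProduct.map (AlgHom.id k H)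
        ((Algebra.TensorProduct.assoc k k k H H H).toAlgHom.comp
          (Algebra.TensorProduct.map Δ (AlgHom.id k H))) Φ *
      Algebra.TensorProduct.map (AlgHom.id k H)
        (Algebra.TensorProduct.map (AlgHom.id k H) Algebra.TensorProduct.includeLeft) Φ =
    Algebra.TensorProduct.map (AlgHom.id k H)
        (Algebra.TensorProduct.map (AlgHom.id k H) Δ) Φ *
      Algebra.TensorProduct.assoc k k k H H (H ⊗[k] H)
        (Algebra.TensorProduct.map Δ (AlgHom.id k (H ⊗[k] H)) Φ)
  /-- `(id ⊗ ε ⊗ id)(Φ) = 1 ⊗ 1 ⊗ 1` -/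
  counit_Φ :
    Algebra.TensorProduct.map (AlgHom.id k H)
      (Algebra.TensorProduct.map ε (AlgHom.id k H)) (Φ : H ⊗[k] (H ⊗[k] H)) =
        (1 : H ⊗[k] (k ⊗[k] H))
  S_one : S 1 = 1
  S_mul : ∀ g h : H, S (g * h) = S h * S g
  /-- `S(h₁) α h₂ = ε(h) α` -/
  antipode_left : ∀ h : H, QuasiHopf.sum2 (Δ h) (fun h1 h2 => S h1 * α * h2) = ε h • α
  /-- `h₁ β S(h₂) = ε(h) β` -/
  antipode_right : ∀ h : H, QuasiHopf.sum2 (Δ h) (fun h1 h2 => h1 * β * S h2) = ε h • β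
  /-- `X¹ β S(X²) α X³ = 1` -/
  antipode_Φ : QuasiHopf.sum3 (Φ : H ⊗[k] (H ⊗[k] H))
    (fun X1 X2 X3 => X1 * β * S X2 * α * X3) = 1
  /-- `S(x¹) α x² β S(x³) = 1`, where `Φ⁻¹ = x¹ ⊗ x² ⊗ x³` -/
  antipode_Φ_inv : QuasiHopf.sum3 (↑Φ⁻¹ : H ⊗[k] (H ⊗[k] H))
    (fun x1 x2 x3 => S x1 * α * x2 * β * S x3) = 1

namespace QuasiHopfAlgebra

open QuasiHopf

section

variable {k H : Type*} [Field k] [Ring H] [Algebra k H] (A : QuasiHopfAlgebra k H)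

/-- The reassociator `Φ = X¹ ⊗ X² ⊗ X³` as an element. -/
def Phi : H ⊗[k] (H ⊗[k] H) := (A.Φ : H ⊗[k] (H ⊗[k] H))

/-- Its inverse `Φ⁻¹ = x¹ ⊗ x² ⊗ x³`. -/
def PhiInv : H ⊗[k] (H ⊗[k] H) := ((A.Φ⁻¹ : (H ⊗[k] (H ⊗[k] H))ˣ) : H ⊗[k] (H ⊗[k] H))

/-- `R` is an R-matrix, i.e. `(A, R)` is a quasi-triangular quasi-Hopf algebra. -/
structure IsRMatrix (R : H ⊗[k] H) : Prop where
  /-- `(Δ ⊗ id)(R) = Φ₃₁₂ R₁₃ Φ⁻¹₁₃₂ R₂₃ Φ` -/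
  comul_left :
    Algebra.TensorProduct.assoc k k k H H H
        (Algebra.TensorProduct.map A.Δ (AlgHom.id k H) R) =
      sum3 A.Phi (fun X1 X2 X3 => X2 ⊗ₜ[k] (X3 ⊗ₜ[k] X1)) *
      sum2 R (fun R1 R2 => R1 ⊗ₜ[k] ((1 : H) ⊗ₜ[k] R2)) *
      sum3 A.PhiInv (fun x1 x2 x3 => x1 ⊗ₜ[k] (x3 ⊗ₜ[k] x2)) *
      sum2 R (fun R1 R2 => (1 : H) ⊗ₜ[k] (R1 ⊗ₜ[k] R2)) *
      A.Phi
  /-- `(id ⊗ Δ)(R) = Φ⁻¹₂₃₁ R₁₃ Φ₂₁₃ R₁₂ Φ⁻¹` -/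
  comul_right :
    Algebra.TensorProduct.map (AlgHom.id k H) A.Δ R =
      sum3 A.PhiInv (fun x1 x2 x3 => x3 ⊗ₜ[k] (x1 ⊗ₜ[k] x2)) *
      sum2 R (fun R1 R2 => R1 ⊗ₜ[k] ((1 : H) ⊗ₜ[k] R2)) *
      sum3 A.Phi (fun X1 X2 X3 => X2 ⊗ₜ[k] (X1 ⊗ₜ[k] X3)) *
      sum2 R (fun R1 R2 => R1 ⊗ₜ[k] (R2 ⊗ₜ[k] (1 : H))) *
      A.PhiInv
  /-- `Δᵒᵖ(h) R = R Δ(h)` -/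
  comul_op : ∀ h : H, Algebra.TensorProduct.comm k H H (A.Δ h) * R = R * A.Δ h
  /-- `(ε ⊗ id)(R) = 1` -/
  counit_left : Algebra.TensorProduct.map A.ε (AlgHom.id k H) R = 1
  /-- `(id ⊗ ε)(R) = 1` -/
  counit_right : Algebra.TensorProduct.map (AlgHom.id k H) A.ε R = 1

/-! ### The canonical elements of a quasi-Hopf algebra -/

open Classical in
/-- The inverse of the antipode (and `0` if the antipode is not bijective, which does not occur for
finite-dimensional or quasi-triangular quasi-Hopf algebras). -/
noncomputable def Sinv : H →ₗ[k] H :=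
  if h : Function.Bijective A.S then ((LinearEquiv.ofBijective A.S h).symm : H →ₗ[k] H) else 0

/-- `p_R = x¹ ⊗ x² β S(x³)` -/
noncomputable def pR : H ⊗[k] H :=
  sum3 A.PhiInv fun x1 x2 x3 => x1 ⊗ₜ[k] (x2 * A.β * A.S x3)

/-- `q_R = X¹ ⊗ S⁻¹(α X³) X²` -/
noncomputable def qR : H ⊗[k] H :=
  sum3 A.Phi fun X1 X2 X3 => X1 ⊗ₜ[k] (A.Sinv (A.α * X3) * X2)

/-- `p_L = X² S⁻¹(X¹ β) ⊗ X³` -/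
noncomputable def pL : H ⊗[k] H :=
  sum3 A.Phi fun X1 X2 X3 => (X2 * A.Sinv (X1 * A.β)) ⊗ₜ[k] X3

/-- `γ = S(A²) α A³ ⊗ S(A¹) α A⁴`, where
`A¹ ⊗ A² ⊗ A³ ⊗ A⁴ = (Φ ⊗ 1)(Δ ⊗ id ⊗ id)(Φ⁻¹)` -/
noncomputable def γ : H ⊗[k] H :=
  sum4 (Algebra.TensorProduct.map (AlgHom.id k H)
          (Algebra.TensorProduct.map (AlgHom.id k H) Algebra.TensorProduct.includeLeft) A.Phi *
        Algebra.TensorProduct.assoc k k k H H (H ⊗[k] H)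
          (Algebra.TensorProduct.map A.Δ (AlgHom.id k (H ⊗[k] H)) A.PhiInv))
    fun A1 A2 A3 A4 => (A.S A2 * A.α * A3) ⊗ₜ[k] (A.S A1 * A.α * A4)

/-- `δ = B¹ β S(B⁴) ⊗ B² β S(B³)`, where
`B¹ ⊗ B² ⊗ B³ ⊗ B⁴ = (Δ ⊗ id ⊗ id)(Φ)(Φ⁻¹ ⊗ 1)` -/
noncomputable def δ : H ⊗[k] H :=
  sum4 (Algebra.TensorProduct.assoc k k k H H (H ⊗[k] H)
          (Algebra.TensorProduct.map A.Δ (AlgHom.id k (H ⊗[k] H)) A.Phi) *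
        Algebra.TensorProduct.map (AlgHom.id k H)
          (Algebra.TensorProduct.map (AlgHom.id k H) Algebra.TensorProduct.includeLeft) A.PhiInv)
    fun B1 B2 B3 B4 => (B1 * A.β * A.S B4) ⊗ₜ[k] (B2 * A.β * A.S B3)

/-- The Drinfeld twist `f = (S ⊗ S)(Δᵒᵖ(x¹)) γ Δ(x² β S(x³))`. -/
noncomputable def f : H ⊗[k] H :=
  sum3 A.PhiInv fun x1 x2 x3 =>
    TensorProduct.map A.S A.S (TensorProduct.comm k H H (A.Δ x1)) * A.γ * A.Δ (x2 * A.β * A.S x3)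

/-- The inverse of the Drinfeld twist, `f⁻¹ = Δ(S(x¹) α x²) δ (S ⊗ S)(Δᵒᵖ(x³))`. -/
noncomputable def fInv : H ⊗[k] H :=
  sum3 A.PhiInv fun x1 x2 x3 =>
    A.Δ (A.S x1 * A.α * x2) * A.δ * TensorProduct.map A.S A.S (TensorProduct.comm k H H (A.Δ x3))

/-- `U = g¹ S(q²) ⊗ g² S(q¹)`, where `f⁻¹ = g¹ ⊗ g²` and `q_R = q¹ ⊗ q²` -/
noncomputable def U : H ⊗[k] H :=
  sum2 A.fInv fun g1 g2 => sum2 A.qR fun q1 q2 => (g1 * A.S q2) ⊗ₜ[k] (g2 * A.S q1)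

/-- The map `𝒬 : H* → H`,
`𝒬(χ) = ⟨χ, S(X²₂ p̃²) f¹ R² r¹ U¹ X³⟩ X¹ S(X²₁ p̃¹) f² R¹ r² U²`,
where `p_L = p̃¹ ⊗ p̃²` and `r¹ ⊗ r²` is a second copy of `R = R¹ ⊗ R²`. -/
noncomputable def Q (R : H ⊗[k] H) : Module.Dual k H →ₗ[k] H :=
  sum3 A.Phi fun X1 X2 X3 => sum2 (A.Δ X2) fun X21 X22 => sum2 A.pL fun p1 p2 =>
  sum2 A.f fun f1 f2 => sum2 R fun R1 R2 => sum2 R fun r1 r2 => sum2 A.U fun U1 U2 =>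
    (Module.Dual.eval k H (A.S (X22 * p2) * f1 * R2 * r1 * U1 * X3)).smulRight
      (X1 * A.S (X21 * p1) * f2 * R1 * r2 * U2)

/-! ### The braided category of left `H`-modules

A left `H`-module is a `k`-vector space `V` with an algebra map `H → End V`. -/

/-- The action of `A₁ ⊗ A₂` on `V ⊗ W`, for an `A₁`-module `V` and an `A₂`-module `W`. -/
noncomputable def outerAct {A₁ A₂ V W : Type*} [Ring A₁] [Algebra k A₁] [Ring A₂] [Algebra k A₂]
    [AddCommGroup V] [Module k V] [AddCommGroup W] [Module k W]
    (ρ : A₁ →ₐ[k] Module.End k V) (σ : A₂ →ₐ[k] Module.End k W) :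
    A₁ ⊗[k] A₂ →ₐ[k] Module.End k (V ⊗[k] W) :=
  Module.endTensorEndAlgHom.comp (Algebra.TensorProduct.map ρ σ)

variable {V W X : Type*} [AddCommGroup V] [Module k V] [AddCommGroup W] [Module k W]
  [AddCommGroup X] [Module k X]

/-- The tensor product of two left `H`-modules, `h · (v ⊗ w) = h₁ · v ⊗ h₂ · w`. -/
noncomputable def tensorAct (ρ : H →ₐ[k] Module.End k V) (σ : H →ₐ[k] Module.End k W) :
    H →ₐ[k] Module.End k (V ⊗[k] W) :=
  (outerAct ρ σ).comp A.Δ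

/-- The associativity constraint `a((v ⊗ w) ⊗ x) = Φ · (v ⊗ (w ⊗ x))`. -/
noncomputable def assocMap (ρ : H →ₐ[k] Module.End k V) (σ : H →ₐ[k] Module.End k W)
    (τ : H →ₐ[k] Module.End k X) : (V ⊗[k] W) ⊗[k] X →ₗ[k] V ⊗[k] (W ⊗[k] X) :=
  (outerAct ρ (outerAct σ τ) A.Phi) ∘ₗ (TensorProduct.assoc k V W X).toLinearMap

/-- The inverse `a⁻¹` of the associativity constraint. -/
noncomputable def assocInvMap (ρ : H →ₐ[k] Module.End k V) (σ : H →ₐ[k] Module.End k W)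
    (τ : H →ₐ[k] Module.End k X) : V ⊗[k] (W ⊗[k] X) →ₗ[k] (V ⊗[k] W) ⊗[k] X :=
  (TensorProduct.assoc k V W X).symm.toLinearMap ∘ₗ (outerAct ρ (outerAct σ τ) A.PhiInv)

/-- The braiding `c(v ⊗ w) = R² · w ⊗ R¹ · v`. -/
noncomputable def braiding (R : H ⊗[k] H) (ρ : H →ₐ[k] Module.End k V)
    (σ : H →ₐ[k] Module.End k W) : V ⊗[k] W →ₗ[k] W ⊗[k] V :=
  (TensorProduct.comm k V W).toLinearMap ∘ₗ (outerAct ρ σ R)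

end

/-! ### Hopf algebras in the braided category of left `H`-modules -/

/-- The structure maps (no axioms) of a Hopf algebra in the category of left `H`-modules. -/
structure BraidedHopfData (k H B : Type*) [Field k] [Ring H] [Algebra k H]
    [AddCommGroup B] [Module k B] where
  act : H →ₐ[k] Module.End k B
  mul : B ⊗[k] B →ₗ[k] B
  one : B
  comul : B →ₗ[k] B ⊗[k] B
  counit : B →ₗ[k] k
  antipode : B →ₗ[k] B

section

variable {k H : Type*} [Field k] [Ring H] [Algebra k H] (A : QuasiHopfAlgebra k H)
  (R : H ⊗[k] H) {B C : Type*} [AddCommGroup B] [Module k B] [AddCommGroup C] [Module k C]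

/-- The multiplication of the braided tensor product algebra `B ⊗ B`:
`(B ⊗ B) ⊗ (B ⊗ B) → B ⊗ (B ⊗ (B ⊗ B)) → B ⊗ ((B ⊗ B) ⊗ B) → B ⊗ ((B ⊗ B) ⊗ B)
→ B ⊗ (B ⊗ (B ⊗ B)) → (B ⊗ B) ⊗ (B ⊗ B) → B ⊗ B`, by `a`, `id ⊗ a⁻¹`, `id ⊗ (c ⊗ id)`,
`id ⊗ a`, `a⁻¹` and `m ⊗ m`. -/
noncomputable def tensorSquareMul (D : BraidedHopfData k H B) :
    (B ⊗[k] B) ⊗[k] (B ⊗[k] B) →ₗ[k] B ⊗[k] B :=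
  TensorProduct.map D.mul D.mul ∘ₗ
  A.assocInvMap D.act D.act (A.tensorAct D.act D.act) ∘ₗ
  (A.assocMap D.act D.act D.act).lTensor B ∘ₗ
  ((braiding R D.act D.act).rTensor B).lTensor B ∘ₗ
  (A.assocInvMap D.act D.act D.act).lTensor B ∘ₗ
  A.assocMap D.act D.act (A.tensorAct D.act D.act)

/-- `D` is a Hopf algebra in the braided category of left `H`-modules (with associativity constraint
given by `Φ` and braiding given by `R`). -/
structure IsBraidedHopfAlgebra (D : BraidedHopfData k H B) : Prop where
  -- the structure maps are morphisms of left `H`-modules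
  mul_act : ∀ h : H, D.mul ∘ₗ A.tensorAct D.act D.act h = D.act h ∘ₗ D.mul
  one_act : ∀ h : H, D.act h D.one = A.ε h • D.one
  comul_act : ∀ h : H, D.comul ∘ₗ D.act h = A.tensorAct D.act D.act h ∘ₗ D.comul
  counit_act : ∀ (h : H) (b : B), D.counit (D.act h b) = A.ε h * D.counit b
  antipode_act : ∀ h : H, D.antipode ∘ₗ D.act h = D.act h ∘ₗ D.antipode
  -- algebra
  mul_assoc : D.mul ∘ₗ D.mul.lTensor B ∘ₗ A.assocMap D.act D.act D.act =
    D.mul ∘ₗ D.mul.rTensor B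
  one_mul : ∀ b : B, D.mul (D.one ⊗ₜ[k] b) = b
  mul_one : ∀ b : B, D.mul (b ⊗ₜ[k] D.one) = b
  -- coalgebra
  comul_coassoc : A.assocMap D.act D.act D.act ∘ₗ D.comul.rTensor B ∘ₗ D.comul =
    D.comul.lTensor B ∘ₗ D.comul
  counit_comul : ∀ b : B, D.counit.rTensor B (D.comul b) = (1 : k) ⊗ₜ[k] b
  comul_counit : ∀ b : B, D.counit.lTensor B (D.comul b) = b ⊗ₜ[k] (1 : k)
  -- the comultiplication and the counit are algebra morphisms
  comul_mul : D.comul ∘ₗ D.mul = tensorSquareMul A R D ∘ₗ TensorProduct.map D.comul D.comul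
  comul_one : D.comul D.one = D.one ⊗ₜ[k] D.one
  counit_mul : ∀ a b : B, D.counit (D.mul (a ⊗ₜ[k] b)) = D.counit a * D.counit b
  counit_one : D.counit D.one = 1
  -- antipode
  antipode_left : ∀ b : B, D.mul (D.antipode.rTensor B (D.comul b)) = D.counit b • D.one
  antipode_right : ∀ b : B, D.mul (D.antipode.lTensor B (D.comul b)) = D.counit b • D.one

/-- `F` is compatible with all structure maps: it is a morphism of left `H`-modules, of algebras
and of coalgebras, and it commutes with the antipodes. -/
structure IsBraidedHopfHom (D : BraidedHopfData k H B) (E : BraidedHopfData k H C)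
    (F : B →ₗ[k] C) : Prop where
  map_act : ∀ h : H, F ∘ₗ D.act h = E.act h ∘ₗ F
  map_mul : F ∘ₗ D.mul = E.mul ∘ₗ TensorProduct.map F F
  map_one : F D.one = E.one
  map_comul : E.comul ∘ₗ F = TensorProduct.map F F ∘ₗ D.comul
  map_counit : E.counit ∘ₗ F = D.counit
  map_antipode : F ∘ₗ D.antipode = E.antipode ∘ₗ F

end

section

variable {k H : Type*} [Field k] [Ring H] [Algebra k H] (A : QuasiHopfAlgebra k H)
  (R : H ⊗[k] H)

/-- `h ↦ a h b` -/
def sandwich (k : Type*) {H : Type*} [Field k] [Ring H] [Algebra k H] (a b : H) : H →ₗ[k] H :=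
  LinearMap.mulLeft k a ∘ₗ LinearMap.mulRight k b

/-- The antipode as an algebra map to the opposite algebra. -/
def SOp : H →ₐ[k] Hᵐᵒᵖ :=
  AlgHom.ofLinearMap ((MulOpposite.opLinearEquiv k).toLinearMap ∘ₗ A.S)
    (by simp [A.S_one]) (by intro g h; simp [A.S_mul])

/-! ### The enveloping algebra braided group of `H` -/

/-- The action of `H ⊗ H` on `H` by `(a ⊗ b) · h = a h S(b)`. -/
noncomputable def adAct₂ : H ⊗[k] H →ₐ[k] Module.End k H :=
  Algebra.TensorProduct.lift (Algebra.lmul k H)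
    ((Algebra.lsmul k k H : Hᵐᵒᵖ →ₐ[k] Module.End k H).comp A.SOp)
    (by intro a b; ext c; simp [SOp, mul_assoc])

theorem adAct₂_tmul (a b h : H) : A.adAct₂ (a ⊗ₜ[k] b) h = a * h * A.S b :=
  (mul_assoc a h (A.S b)).symm

/-- The left `H`-action on `H` by `h ▷ h' = h₁ h' S(h₂)`, see `adAct_apply`. -/
noncomputable def adAct : H →ₐ[k] Module.End k H :=
  A.adAct₂.comp A.Δ

theorem adAct_apply (h h' : H) :
    A.adAct h h' = sum2 (A.Δ h) fun h1 h2 => h1 * h' * A.S h2 := by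
  simp only [← adAct₂_tmul]
  exact (sum2_eq (A.Δ h) (LinearMap.applyₗ h' ∘ₗ A.adAct₂.toLinearMap)).symm

/-- The enveloping algebra braided group of `H`, on the vector space `H`: the action is
`h ▷ h' = h₁ h' S(h₂)`, the multiplication is
`h • h' = X¹ h S(x¹ X²) α x² X³₁ h' S(x³ X³₂)` with unit `β`, the comultiplication is
`Δ̲(h) = x¹ X¹ h₁ g¹ S(x² R² y³ X³₂) ⊗ x³ R¹ ▷ (y¹ X² h₂ g² S(y² X³₁))` with counit `ε`, and the
antipode is `S̲(h) = X¹ R² p² S(q¹ (X² R¹ p¹ ▷ h) S(q²) X³)`. -/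
noncomputable def envelopingBraidedGroup : BraidedHopfData k H H where
  act := A.adAct
  mul :=
    sum3 A.Phi fun X1 X2 X3 => sum3 A.PhiInv fun x1 x2 x3 => sum2 (A.Δ X3) fun X31 X32 =>
      LinearMap.mul' k H ∘ₗ TensorProduct.map
        (sandwich k X1 (A.S (x1 * X2) * A.α * x2 * X31)) (sandwich k 1 (A.S (x3 * X32)))
  one := A.β
  comul :=
    sum3 A.PhiInv fun x1 x2 x3 => sum3 A.Phi fun X1 X2 X3 => sum2 (A.Δ X3) fun X31 X32 =>
    sum2 A.fInv fun g1 g2 => sum2 R fun R1 R2 => sum3 A.PhiInv fun y1 y2 y3 =>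
      TensorProduct.map
        (sandwich k (x1 * X1) (g1 * A.S (x2 * R2 * y3 * X32)))
        (A.adAct (x3 * R1) ∘ₗ sandwich k (y1 * X2) (g2 * A.S (y2 * X31))) ∘ₗ A.Δ.toLinearMap
  counit := A.ε.toLinearMap
  antipode :=
    sum3 A.Phi fun X1 X2 X3 => sum2 R fun R1 R2 => sum2 A.pR fun p1 p2 =>
    sum2 A.qR fun q1 q2 =>
      sandwich k (X1 * R2 * p2) 1 ∘ₗ A.S ∘ₗ sandwich k q1 (A.S q2 * X3) ∘ₗ
        A.adAct (X2 * R1 * p1)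

/-! ### The function algebra braided group of `H*` -/

/-- `h' ⇀ χ ↼ h''`, the functional `h ↦ χ(h'' h h')`, as a linear map in `χ`. -/
def dualBiact (k : Type*) {H : Type*} [Field k] [Ring H] [Algebra k H] (h' h'' : H) :
    Module.Dual k H →ₗ[k] Module.Dual k H :=
  (sandwich k h'' h').dualMap

/-- The action of `H ⊗ H` on `H*` by `(a ⊗ b) · χ = b ⇀ χ ↼ S(a)`. -/
noncomputable def coadAct₂ : H ⊗[k] H →ₐ[k] Module.End k (Module.Dual k H) :=
  Algebra.TensorProduct.lift
    (AlgHom.ofLinearMap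
      (Module.Dual.transpose (R := k) (M := H) (M' := H) ∘ₗ LinearMap.mul k H ∘ₗ A.S)
      (by ext χ g; simp [A.S_one, Module.Dual.transpose_apply])
      (by intro a b; ext χ g; simp [A.S_mul, mul_assoc, Module.Dual.transpose_apply]))
    (AlgHom.ofLinearMap
      (Module.Dual.transpose (R := k) (M := H) (M' := H) ∘ₗ (LinearMap.mul k H).flip)
      (by ext χ g; simp [Module.Dual.transpose_apply])
      (by intro a b; ext χ g; simp [mul_assoc, Module.Dual.transpose_apply]))
    (by intro a b; ext χ g; simp [mul_assoc, Module.Dual.transpose_apply])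

theorem coadAct₂_tmul (a b : H) (χ : Module.Dual k H) :
    A.coadAct₂ (a ⊗ₜ[k] b) χ = dualBiact k b (A.S a) χ := by
  ext g
  exact congrArg χ (mul_assoc (A.S a) g b)

/-- The left `H`-action `h ▶ χ = h₂ ⇀ χ ↼ S(h₁)` on `H*`, see `coadAct_apply`. -/
noncomputable def coadAct : H →ₐ[k] Module.End k (Module.Dual k H) :=
  A.coadAct₂.comp A.Δ

theorem coadAct_apply (h : H) (χ : Module.Dual k H) :
    A.coadAct h χ = sum2 (A.Δ h) fun h1 h2 => dualBiact k h2 (A.S h1) χ := by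
  simp only [← coadAct₂_tmul]
  exact (sum2_eq (A.Δ h) (LinearMap.applyₗ χ ∘ₗ A.coadAct₂.toLinearMap)).symm

/-- The convolution product `χ ⊗ ψ ↦ (h ↦ χ(h₁) ψ(h₂))` on `H*`. -/
noncomputable def dualMul : Module.Dual k H ⊗[k] Module.Dual k H →ₗ[k] Module.Dual k H :=
  A.Δ.toLinearMap.dualMap ∘ₗ TensorProduct.dualDistrib k H H

/-- The comultiplication `χ ↦ χ₁ ⊗ χ₂` of `H*`, where `χ₁(g) χ₂(h) = χ(g h)`. -/
noncomputable def dualComul (k H : Type*) [Field k] [Ring H] [Algebra k H]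
    [FiniteDimensional k H] : Module.Dual k H →ₗ[k] Module.Dual k H ⊗[k] Module.Dual k H :=
  (TensorProduct.dualDistribEquiv k H H).symm.toLinearMap ∘ₗ (LinearMap.mul' k H).dualMap

/-- The function algebra braided group of the dual quasi-Hopf algebra `H*`, in the category
of left `H`-modules, on the vector space `H*`: the action is `h ▶ χ = h₂ ⇀ χ ↼ S(h₁)`, the
multiplication is
`χ · ψ = [x³₁ Y² r¹ y¹ X² ⇀ χ ↼ S(x¹ X¹) f² R¹] [x³₂ Y³ y³ X³₂ ⇀ ψ ↼ S(x² Y¹ r² y² X³₁) f¹ R²]`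
with unit `ε`, the comultiplication is
`χ ↦ χ₁ ↼ S(x¹) ⊗ x³₂ X³ ⇀ χ₂ ↼ x² X¹ β S(x³₁ X²)` with counit `χ ↦ χ(α)`, and the antipode is
`χ ↦ q¹₂ R̄¹₂ p̃² ⇀ χ S ↼ q² R̄² S(q¹₁ R̄¹₁ p̃¹)`, where `R⁻¹ = R̄¹ ⊗ R̄²`, `q_R = q¹ ⊗ q²` and
`p_L = p̃¹ ⊗ p̃²`. -/
noncomputable def functionBraidedGroup [FiniteDimensional k H] :
    BraidedHopfData k H (Module.Dual k H) where
  act := A.coadAct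
  mul :=
    sum3 A.PhiInv fun x1 x2 x3 => sum2 (A.Δ x3) fun x31 x32 =>
    sum3 A.Phi fun X1 X2 X3 => sum2 (A.Δ X3) fun X31 X32 =>
    sum3 A.Phi fun Y1 Y2 Y3 => sum3 A.PhiInv fun y1 y2 y3 =>
    sum2 A.f fun f1 f2 => sum2 R fun R1 R2 => sum2 R fun r1 r2 =>
      A.dualMul ∘ₗ TensorProduct.map
        (dualBiact k (x31 * Y2 * r1 * y1 * X2) (A.S (x1 * X1) * f2 * R1))
        (dualBiact k (x32 * Y3 * y3 * X32) (A.S (x2 * Y1 * r2 * y2 * X31) * f1 * R2))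
  one := A.ε.toLinearMap
  comul :=
    sum3 A.PhiInv fun x1 x2 x3 => sum2 (A.Δ x3) fun x31 x32 => sum3 A.Phi fun X1 X2 X3 =>
      TensorProduct.map
        (dualBiact k 1 (A.S x1))
        (dualBiact k (x32 * X3) (x2 * X1 * A.β * A.S (x31 * X2))) ∘ₗ dualComul k H
  counit := Module.Dual.eval k H A.α
  antipode :=
    sum2 A.qR fun q1 q2 => sum2 (A.Δ q1) fun q11 q12 =>
    sum2 (Ring.inverse R) fun R1 R2 => sum2 (A.Δ R1) fun R11 R12 => sum2 A.pL fun p1 p2 =>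
      dualBiact k (q12 * R12 * p2) (q2 * R2 * A.S (q11 * R11 * p1)) ∘ₗ A.S.dualMap

end

end QuasiHopfAlgebra

-- Finite-dimensional left `H`-modules form a braided monoidal category in which every `V` has a
-- dual `V*`, with evaluation through `α` and coevaluation through `β`. In this category `H` with
-- the adjoint action plays the part of the end of `V ⊗ V*`, and `H*` with the coadjoint action that
-- of the coend of `V* ⊗ V`. The object `E = H` thus acts naturally on every module by `E ⊗ V ⟶ V`,
-- and every module has a natural coaction `V ⟶ V ⊗ F` of `F = H*`.
--
-- Of the universal properties only uniqueness is needed: morphisms into `E ⊗ Y` are determined by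
-- the resulting actions, and morphisms out of `Y ⊗ F` by the resulting coactions. One module
-- suffices for this, because the regular module embeds `H` into `End(H)` and its matrix
-- coefficients exhaust `H*` (`endFamily_faithful`, `coendFamily_faithful`). The structure maps of
-- `E` are those for which products act by successive action, the coproduct acts on `V ⊗ W`, the
-- counit describes the action on the unit object and the antipode acts through `V*`; dually for
-- `F`. Each Hopf algebra axiom then becomes an identity between natural actions or coactions, which
-- follows from naturality, the hexagons and the zigzag identities (`NaturalAction.Induces.isHopf`,
-- `NaturalCoaction.Induces.isHopf`).
--
-- The map `𝒬 : F ⟶ E` is characterised by the property that `V ⊗ W ⟶ V ⊗ F ⊗ W ⟶ V ⊗ E ⊗ W ⟶ V ⊗ W`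
-- is the double braiding. It is multiplicative by the hexagon in `V`, comultiplicative by the
-- hexagon in `W`, and it respects the antipodes because convolution inverses are unique
-- (`HopfMaps.isHom_of_double_braiding`).
--
-- It remains to recognise the explicit formulas. Elements of `W ⊗ V*` are read as linear maps `V →
-- W`, and each categorical composite is computed on arbitrary modules (`toEnd_mul`, `toEnd_comul`,
-- `toEnd_antipode`, `coeff_mul`, `coeff_comul`, `coeff_antipode`, `toEnd_Q_coeff`). The twist `f`
-- and the element `fInv` are the two comparison maps between `W* ⊗ V*` and `(V ⊗ W)*`; only their
-- compatibility with evaluations and coevaluations is used, not that they are mutually inverse. The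
-- elements `p` and `q` record the reassociations around a coevaluation or an evaluation. The
-- `H`-linearity of the explicit maps is not computed: it follows from that of their composites with
-- an injective or surjective module map.
--
-- Invertibility of `R` and bijectivity of `S` come from the duals as well (`isIso_of_hexagon`,
-- `isUnit_R`, `S_bijective`).

universe u v

section

open CategoryTheory MonoidalCategory

/-! ### Duals -/

section ChosenDuals

universe v₁ u₁

/-- A choice of a dual `lDual V` of every object `V`, with evaluation `lDual V ⊗ V ⟶ 𝟙_ C`. -/
class HasDuals (C : Type u₁) [Category.{v₁} C] [MonoidalCategory C] where
  lDual : C → C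
  pairing : ∀ V : C, ExactPairing V (lDual V)

export HasDuals (lDual)

attribute [instance] HasDuals.pairing

variable {C : Type u₁} [Category.{v₁} C] [MonoidalCategory C] [HasDuals C]

/-- The dual of a morphism. -/
def dualHom {V W : C} (f : V ⟶ W) : lDual W ⟶ lDual V :=
  (ρ_ _).inv ≫ lDual W ◁ η_ V (lDual V) ≫ lDual W ◁ f ▷ lDual V ≫ (α_ _ _ _).inv ≫
    ε_ W (lDual W) ▷ lDual V ≫ (λ_ _).hom

/-- Exchanging the two evaluations brings the coevaluation of `V` next to its own evaluation, where
a zigzag removes both. -/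
theorem dualHom_evaluation {V W : C} (f : V ⟶ W) :
    dualHom f ▷ V ≫ ε_ V (lDual V) = lDual W ◁ f ≫ ε_ W (lDual W) := by
  calc
    _ = 𝟙 _ ⊗≫ lDual W ◁ η_ V (lDual V) ▷ V ⊗≫ lDual W ◁ f ▷ lDual V ▷ V ⊗≫
        (ε_ W (lDual W) ▷ (lDual V ⊗ V) ≫ 𝟙_ C ◁ ε_ V (lDual V)) ⊗≫ 𝟙 _ := by
      rw [dualHom]; monoidal
    _ = 𝟙 _ ⊗≫ lDual W ◁ η_ V (lDual V) ▷ V ⊗≫ lDual W ◁ (f ▷ (lDual V ⊗ V) ≫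
        W ◁ ε_ V (lDual V)) ⊗≫ ε_ W (lDual W) ⊗≫ 𝟙 _ := by
      rw [← whisker_exchange]; monoidal
    _ = 𝟙 _ ⊗≫ lDual W ◁ (η_ V (lDual V) ▷ V ⊗≫ V ◁ ε_ V (lDual V)) ⊗≫ lDual W ◁ f ⊗≫
        ε_ W (lDual W) ⊗≫ 𝟙 _ := by
      rw [← whisker_exchange]; monoidal
    _ = _ := by rw [ExactPairing.evaluation_coevaluation'']; monoidal

theorem coevaluation_dualHom {V W : C} (f : V ⟶ W) :
    η_ W (lDual W) ≫ W ◁ dualHom f = η_ V (lDual V) ≫ f ▷ lDual V := by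
  calc
    _ = 𝟙 _ ⊗≫ (η_ W (lDual W) ▷ 𝟙_ C ≫ (W ⊗ lDual W) ◁ (η_ V (lDual V) ≫ f ▷ lDual V)) ⊗≫
        W ◁ ε_ W (lDual W) ▷ lDual V ⊗≫ 𝟙 _ := by
      rw [dualHom]; monoidal
    _ = 𝟙 _ ⊗≫ (η_ V (lDual V) ≫ f ▷ lDual V) ⊗≫
        (η_ W (lDual W) ▷ W ⊗≫ W ◁ ε_ W (lDual W)) ▷ lDual V ⊗≫ 𝟙 _ := by
      rw [← whisker_exchange]; monoidal
    _ = _ := by rw [ExactPairing.evaluation_coevaluation'']; monoidal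

end ChosenDuals

/-! ### Objects acting naturally on a braided category -/

section Universal

universe v₁ u₁

set_option linter.unusedSectionVars false

variable {C : Type u₁} [Category.{v₁} C] [MonoidalCategory C] [BraidedCategory C]

/-- A natural action of an object `E` on all objects. -/
structure NaturalAction (E : C) where
  act : ∀ V : C, E ⊗ V ⟶ V
  natural : ∀ {V W : C} (f : V ⟶ W), E ◁ f ≫ act W = act V ≫ f

/-- A natural coaction of an object `F` on all objects. -/
structure NaturalCoaction (F : C) where
  coact : ∀ V : C, V ⟶ V ⊗ F
  natural : ∀ {V W : C} (f : V ⟶ W), f ≫ coact W = coact V ≫ f ▷ F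

/-- The structure maps of a Hopf algebra on the object `B`. -/
structure HopfMaps (B : C) where
  mul : B ⊗ B ⟶ B
  one : 𝟙_ C ⟶ B
  comul : B ⟶ B ⊗ B
  counit : B ⟶ 𝟙_ C
  antipode : B ⟶ B

/-- The axioms of a Hopf algebra in a braided category. -/
structure HopfMaps.IsHopf {B : C} (D : HopfMaps B) : Prop where
  mul_assoc : D.mul ▷ B ≫ D.mul = (α_ B B B).hom ≫ B ◁ D.mul ≫ D.mul
  one_mul : D.one ▷ B ≫ D.mul = (λ_ B).hom
  mul_one : B ◁ D.one ≫ D.mul = (ρ_ B).hom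
  comul_assoc : D.comul ≫ D.comul ▷ B ≫ (α_ B B B).hom = D.comul ≫ B ◁ D.comul
  counit_comul : D.comul ≫ D.counit ▷ B = (λ_ B).inv
  comul_counit : D.comul ≫ B ◁ D.counit = (ρ_ B).inv
  mul_comul : D.mul ≫ D.comul =
    (D.comul ⊗ₘ D.comul) ≫ tensorμ B B B B ≫ (D.mul ⊗ₘ D.mul)
  one_comul : D.one ≫ D.comul = (λ_ (𝟙_ C)).inv ≫ (D.one ⊗ₘ D.one)
  mul_counit : D.mul ≫ D.counit = (D.counit ⊗ₘ D.counit) ≫ (λ_ (𝟙_ C)).hom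
  one_counit : D.one ≫ D.counit = 𝟙 _
  antipode_left : D.comul ≫ D.antipode ▷ B ≫ D.mul = D.counit ≫ D.one
  antipode_right : D.comul ≫ B ◁ D.antipode ≫ D.mul = D.counit ≫ D.one

namespace NaturalAction

variable {E : C} (U : NaturalAction E)

/-- The action of `E` through a morphism `φ : X ⟶ E ⊗ Y`. -/
def probe {X Y : C} (φ : X ⟶ E ⊗ Y) (V : C) : X ⊗ V ⟶ V ⊗ Y :=
  φ ▷ V ≫ (α_ E Y V).hom ≫ E ◁ (β_ Y V).hom ≫ (α_ E V Y).inv ≫ U.act V ▷ Y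

/-- Morphisms into `E ⊗ Y` are detected by the actions. -/
def Faithful : Prop :=
  ∀ ⦃X Y : C⦄ (φ ψ : X ⟶ E ⊗ Y), (∀ V, U.probe φ V = U.probe ψ V) → φ = ψ

/-- The action of `E ⊗ E` on `V ⊗ W`. -/
def act₂ (V W : C) : (E ⊗ E) ⊗ (V ⊗ W) ⟶ V ⊗ W :=
  tensorμ E E V W ≫ (U.act V ⊗ₘ U.act W)

/-- The action of `E ⊗ (E ⊗ E)` on `V ⊗ (W ⊗ X)`. -/
def act₃ (V W X : C) : (E ⊗ (E ⊗ E)) ⊗ (V ⊗ (W ⊗ X)) ⟶ V ⊗ (W ⊗ X) :=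
  tensorμ E (E ⊗ E) V (W ⊗ X) ≫ (U.act V ⊗ₘ U.act₂ W X)

variable {U}


/-- Morphisms into `V ⊗ Y` are detected by the family `S`. -/
def Detects {ι : Type*} {Y : C} (W T : ι → C) (S : ∀ i, Y ⊗ W i ⟶ T i) : Prop :=
  ∀ ⦃Z V : C⦄ (p q : Z ⟶ V ⊗ Y), (∀ i, p ▷ W i ≫ (α_ V Y (W i)).hom ≫ V ◁ S i =
    q ▷ W i ≫ (α_ V Y (W i)).hom ≫ V ◁ S i) → p = q

/-- The case in which the bystander `V` is the unit object. -/
theorem Detects.ext {ι : Type*} {Y : C} {W T : ι → C} {S : ∀ i, Y ⊗ W i ⟶ T i}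
    (h : Detects W T S) {X : C} {φ ψ : X ⟶ Y} (H : ∀ i, φ ▷ W i ≫ S i = ψ ▷ W i ≫ S i) :
    φ = ψ := by
  have key : ∀ (χ : X ⟶ Y) (i : ι), (χ ≫ (λ_ Y).inv) ▷ W i ≫ (α_ (𝟙_ C) Y (W i)).hom ≫
      𝟙_ C ◁ S i = χ ▷ W i ≫ S i ≫ (λ_ _).inv := by
    intro χ i
    monoidal
  have := h (φ ≫ (λ_ Y).inv) (ψ ≫ (λ_ Y).inv) (by
    intro i
    rw [key, key, reassoc_of% (H i)])
  simpa using this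

/-- The probes keep the bystander on the right of `E`, detection keeps it on the left. Composing
with the invertible braiding of `V` past `E` translates one into the other, by a hexagon and
naturality. -/
theorem Faithful.detects_act (h : U.Faithful) : Detects (fun V : C => V) (fun V => V) U.act := by
  have key : ∀ {Z V : C} (p : Z ⟶ V ⊗ E) (W : C), U.probe (p ≫ (β_ V E).hom) W =
      (p ▷ W ≫ (α_ V E W).hom ≫ V ◁ U.act W) ≫ (β_ V W).hom := by
    intro Z V p W
    simp only [Category.assoc, BraidedCategory.braiding_naturality_right,
      BraidedCategory.braiding_tensor_right_hom, probe]
    monoidal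
  intro Z V p q H
  rw [← cancel_mono (β_ V E).hom]
  exact h _ _ fun W => by rw [key, key, H]

/-- Induction step for the detection of morphisms into iterated tensor powers of `E`. The bystander
`V` is braided past `E`, so that `E` is detected first; the remaining morphism ends in `(X ⊗ V) ⊗ Y`
and is detected by `S` with bystander `X ⊗ V`. This is why a bystander is built into `Detects`. -/
theorem Faithful.detects_tensor (h : U.Faithful) {ι : Type*} {Y : C} {W T : ι → C}
    {S : ∀ i, Y ⊗ W i ⟶ T i} (hS : Detects W T S) :
    Detects (fun i : C × ι => i.1 ⊗ W i.2) (fun i => i.1 ⊗ T i.2)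
      (fun i => tensorμ E Y i.1 (W i.2) ≫ (U.act i.1 ⊗ₘ S i.2)) := by
  have key : ∀ {Z V : C} (p : Z ⟶ V ⊗ (E ⊗ Y)) (X : C) (i : ι),
      (α_ Z X (W i)).inv ≫
      (U.probe (p ≫ (α_ V E Y).inv ≫ (β_ V E).hom ▷ Y ≫ (α_ E V Y).hom) X ≫ (α_ X V Y).inv) ▷ W i ≫
        (α_ (X ⊗ V) Y (W i)).hom ≫ (X ⊗ V) ◁ S i =
      (p ▷ (X ⊗ W i) ≫ (α_ V (E ⊗ Y) (X ⊗ W i)).hom ≫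
        V ◁ (tensorμ E Y X (W i) ≫ (U.act X ⊗ₘ S i))) ≫
          (α_ V X (T i)).inv ≫ (β_ V X).hom ▷ T i := by
    intro Z V p X i
    calc
      _ = 𝟙 _ ⊗≫ p ▷ (X ⊗ W i) ⊗≫ V ◁ E ◁ (β_ Y X).hom ▷ W i ⊗≫
          (((β_ V E).hom ▷ X ⊗≫ E ◁ (β_ V X).hom ⊗≫ U.act X ▷ V) ▷ (Y ⊗ W i) ≫
            (X ⊗ V) ◁ S i) := by
        simp only [probe, BraidedCategory.braiding_tensor_left_hom]
        calc
          _ = 𝟙 _ ⊗≫ p ▷ (X ⊗ W i) ⊗≫ ((β_ V E).hom ▷ (Y ⊗ X) ≫ (E ⊗ V) ◁ (β_ Y X).hom) ▷ W i ⊗≫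
            ((E ◁ (β_ V X).hom ⊗≫ U.act X ▷ V) ▷ (Y ⊗ W i) ≫
            (X ⊗ V) ◁ S i) := by monoidal
          _ = _ := by rw [← whisker_exchange]; monoidal
      _ = 𝟙 _ ⊗≫ p ▷ (X ⊗ W i) ⊗≫ V ◁ E ◁ (β_ Y X).hom ▷ W i ⊗≫
          (((β_ V (E ⊗ X)).hom ≫ U.act X ▷ V) ▷ (Y ⊗ W i) ≫ (X ⊗ V) ◁ S i) := by
        simp only [BraidedCategory.braiding_tensor_right_hom]
        monoidal
      _ = 𝟙 _ ⊗≫ p ▷ (X ⊗ W i) ⊗≫ V ◁ E ◁ (β_ Y X).hom ▷ W i ⊗≫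
          (V ◁ U.act X) ▷ (Y ⊗ W i) ⊗≫ ((β_ V X).hom ▷ (Y ⊗ W i) ≫ (X ⊗ V) ◁ S i) := by
        rw [← BraidedCategory.braiding_naturality_right]
        monoidal
      _ = _ := by
        rw [← whisker_exchange]
        simp only [tensorμ, MonoidalCategory.tensorHom_def]
        monoidal
  intro Z V p q H
  rw [← cancel_mono ((α_ V E Y).inv ≫ (β_ V E).hom ▷ Y ≫ (α_ E V Y).hom)]
  refine h _ _ fun X => ?_
  rw [← cancel_mono (α_ X V Y).inv]
  refine hS _ _ fun i => ?_
  rw [← cancel_epi (α_ Z X (W i)).inv, key, key, H (X, i)]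

theorem Faithful.ext (h : U.Faithful) {X : C} {φ ψ : X ⟶ E}
    (H : ∀ V, φ ▷ V ≫ U.act V = ψ ▷ V ≫ U.act V) : φ = ψ :=
  h.detects_act.ext H

theorem Faithful.ext₂ (h : U.Faithful) {X : C} {φ ψ : X ⟶ E ⊗ E}
    (H : ∀ V W, φ ▷ (V ⊗ W) ≫ U.act₂ V W = ψ ▷ (V ⊗ W) ≫ U.act₂ V W) : φ = ψ :=
  (h.detects_tensor h.detects_act).ext fun i => H i.1 i.2

theorem Faithful.ext₃ (h : U.Faithful) {X : C} {φ ψ : X ⟶ E ⊗ (E ⊗ E)}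
    (H : ∀ V W Y, φ ▷ (V ⊗ (W ⊗ Y)) ≫ U.act₃ V W Y = ψ ▷ (V ⊗ (W ⊗ Y)) ≫ U.act₃ V W Y) : φ = ψ :=
  (h.detects_tensor (h.detects_tensor h.detects_act)).ext fun i => H i.1 i.2.1 i.2.2

variable (U)

/-- The structure maps `D` are those induced by the natural action `U`. -/
structure Induces [HasDuals C] (D : HopfMaps E) : Prop where
  mul_act : ∀ V, D.mul ▷ V ≫ U.act V = (α_ E E V).hom ≫ E ◁ U.act V ≫ U.act V
  one_act : ∀ V, D.one ▷ V ≫ U.act V = (λ_ V).hom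
  comul_act : ∀ V W, D.comul ▷ (V ⊗ W) ≫ U.act₂ V W = U.act (V ⊗ W)
  counit_act : U.act (𝟙_ C) = (ρ_ E).hom ≫ D.counit
  antipode_act : ∀ V, D.antipode ▷ V ≫ U.act V =
    𝟙 _ ⊗≫ E ◁ η_ V (lDual V) ▷ V ⊗≫ (β_ E V).hom ▷ (lDual V ⊗ V) ⊗≫ V ◁ U.act (lDual V) ▷ V ⊗≫ V ◁ ε_ V (lDual V) ⊗≫ 𝟙 _

variable {U} [HasDuals C] {D : HopfMaps E}

namespace Induces

/-- `E ⊗ E` with the product twisted by the braiding acts on `V ⊗ W` as an algebra. This is the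
coherence of `tensorμ` with associators, and it is what makes the bialgebra axiom `mul_comul` come
out. -/
theorem mul_act₂ (hD : U.Induces D) (V W : C) :
    (tensorμ E E E E ≫ (D.mul ⊗ₘ D.mul)) ▷ (V ⊗ W) ≫ U.act₂ V W =
      (α_ (E ⊗ E) (E ⊗ E) (V ⊗ W)).hom ≫ (E ⊗ E) ◁ U.act₂ V W ≫ U.act₂ V W := by
  have h1 : (D.mul ⊗ₘ D.mul) ▷ (V ⊗ W) ≫ U.act₂ V W =
      tensorμ (E ⊗ E) (E ⊗ E) V W ≫ ((α_ E E V).hom ⊗ₘ (α_ E E W).hom) ≫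
        (E ◁ U.act V ⊗ₘ E ◁ U.act W) ≫ (U.act V ⊗ₘ U.act W) := by
    simp only [act₂, tensorμ_natural_left_assoc, tensorHom_comp_tensorHom, hD.mul_act]
  rw [comp_whiskerRight, Category.assoc, h1]
  have h2 := tensor_associativity_assoc E E E E V W
    ((E ◁ U.act V ⊗ₘ E ◁ U.act W) ≫ (U.act V ⊗ₘ U.act W))
  rw [h2, ← tensorμ_natural_right_assoc]
  simp only [act₂, whiskerLeft_comp, Category.assoc]

/-- By faithfulness every axiom may be tested by acting on one, two or three objects. Associativity
and `mul_comul` express successive actions; coassociativity and the counit axioms are naturality of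
the action with respect to the associator and the unitors; the antipode axioms are its naturality
with respect to evaluation and coevaluation. -/
theorem isHopf (hD : U.Induces D) (hU : U.Faithful) : D.IsHopf where
  mul_assoc := hU.ext fun V => by
    have h1 := hD.mul_act V
    calc
      _ = D.mul ▷ E ▷ V ≫ (D.mul ▷ V ≫ U.act V) := by monoidal
      _ = 𝟙 _ ⊗≫ (D.mul ▷ (E ⊗ V) ≫ E ◁ U.act V) ≫ U.act V := by rw [h1]; monoidal
      _ = 𝟙 _ ⊗≫ (E ⊗ E) ◁ U.act V ⊗≫ (D.mul ▷ V ≫ U.act V) := by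
        rw [← whisker_exchange]; monoidal
      _ = 𝟙 _ ⊗≫ E ◁ ((α_ E E V).hom ≫ E ◁ U.act V ≫ U.act V) ≫ U.act V := by rw [h1]; monoidal
      _ = 𝟙 _ ⊗≫ E ◁ (D.mul ▷ V ≫ U.act V) ≫ U.act V := by rw [h1]
      _ = 𝟙 _ ⊗≫ E ◁ D.mul ▷ V ⊗≫ ((α_ E E V).hom ≫ E ◁ U.act V ≫ U.act V) := by monoidal
      _ = _ := by rw [← h1]; monoidal
  one_mul := hU.ext fun V => by
    rw [comp_whiskerRight, Category.assoc, hD.mul_act]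
    calc
      _ = 𝟙 _ ⊗≫ (D.one ▷ (E ⊗ V) ≫ E ◁ U.act V) ≫ U.act V := by monoidal
      _ = 𝟙 _ ⊗≫ 𝟙_ C ◁ U.act V ≫ D.one ▷ V ≫ U.act V := by rw [← whisker_exchange]; monoidal
      _ = _ := by rw [hD.one_act]; monoidal
  mul_one := hU.ext fun V => by
    rw [comp_whiskerRight, Category.assoc, hD.mul_act]
    calc
      _ = 𝟙 _ ⊗≫ E ◁ (D.one ▷ V ≫ U.act V) ≫ U.act V := by monoidal
      _ = _ := by rw [hD.one_act]; monoidal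
  comul_assoc := hU.ext₃ fun V W X => by
    have h1 : (E ◁ D.comul) ▷ (V ⊗ (W ⊗ X)) ≫ U.act₃ V W X = U.act₂ V (W ⊗ X) := by
      rw [← id_tensorHom]
      simp only [act₃, act₂, tensorμ_natural_left_assoc, tensorHom_comp_tensorHom,
        id_whiskerRight, Category.id_comp]
      rw [← hD.comul_act]
      rfl
    -- The other iterated coproduct acts on `(V ⊗ W) ⊗ X`; the two bracketings differ by an
    -- associator, which naturality of the action lets pass.
    have h2 : (D.comul ▷ E ≫ (α_ E E E).hom) ▷ (V ⊗ (W ⊗ X)) ≫ U.act₃ V W X =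
        (E ⊗ E) ◁ (α_ V W X).inv ≫ U.act₂ (V ⊗ W) X ≫ (α_ V W X).hom := by
      have h3 := associator_monoidal E E E V W X
      have h4 : (α_ E E E).hom ▷ (V ⊗ (W ⊗ X)) ≫ U.act₃ V W X =
        ((E ⊗ E) ⊗ E) ◁ (α_ V W X).inv ≫ tensorμ (E ⊗ E) E (V ⊗ W) X ≫
          (tensorμ E E V W ≫ (U.act V ⊗ₘ U.act W)) ▷ (E ⊗ X) ≫
          (V ⊗ W) ◁ U.act X ≫ (α_ V W X).hom := by
        have h5 : U.act₃ V W X = (tensorμ E (E ⊗ E) V (W ⊗ X) ≫ (E ⊗ V) ◁ tensorμ E E W X) ≫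
            (U.act V ⊗ₘ (U.act W ⊗ₘ U.act X)) := by
          simp only [act₃, act₂, Category.assoc, ← id_tensorHom, tensorHom_comp_tensorHom,
            Category.id_comp]
        have h6 : (α_ E E E).hom ▷ (V ⊗ (W ⊗ X)) = ((E ⊗ E) ⊗ E) ◁ (α_ V W X).inv ≫
            ((α_ E E E).hom ⊗ₘ (α_ V W X).hom) := by
          rw [MonoidalCategory.tensorHom_def, whisker_exchange_assoc]
          simp
        rw [h5, h6, Category.assoc, Category.assoc, ← reassoc_of% h3]
        simp only [MonoidalCategory.tensorHom_def]
        monoidal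
      rw [comp_whiskerRight, Category.assoc, h4, ← whisker_exchange_assoc]
      simp only [act₂, MonoidalCategory.tensorHom_def]
      have h7 := tensorμ_natural_left D.comul (𝟙 E) (V ⊗ W) X
      simp only [tensorHom_id, id_whiskerRight, ] at h7
      rw [reassoc_of% h7]
      have h8 := hD.comul_act V W
      simp only [act₂, MonoidalCategory.tensorHom_def] at h8
      simp only [← comp_whiskerRight_assoc, ← h8, Category.assoc]
    calc
      _ = D.comul ▷ (V ⊗ (W ⊗ X)) ≫ (D.comul ▷ E ≫ (α_ E E E).hom) ▷ (V ⊗ (W ⊗ X)) ≫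
          U.act₃ V W X := by monoidal
      _ = E ◁ (α_ V W X).inv ≫ D.comul ▷ ((V ⊗ W) ⊗ X) ≫ U.act₂ (V ⊗ W) X ≫ (α_ V W X).hom := by
        rw [h2, whisker_exchange_assoc]
      _ = U.act (V ⊗ (W ⊗ X)) := by
        rw [← Category.assoc (D.comul ▷ _), hD.comul_act, ← U.natural, ← whiskerLeft_comp_assoc]
        simp
      _ = _ := by rw [comp_whiskerRight, Category.assoc, h1, hD.comul_act]
  counit_comul := by
    rw [← cancel_mono (λ_ E).hom, Iso.inv_hom_id]
    refine hU.ext fun V => ?_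
    have h1 := hD.comul_act (𝟙_ C) V
    rw [act₂, hD.counit_act] at h1
    have h2 := U.natural (λ_ V).hom
    calc
      _ = E ◁ (λ_ V).inv ≫ (D.comul ▷ (𝟙_ C ⊗ V) ≫ tensorμ E E (𝟙_ C) V ≫
          ((ρ_ E).hom ≫ D.counit ⊗ₘ U.act V)) ≫ (λ_ V).hom := by
        simp only [tensorμ, braiding_tensorUnit_right]
        calc
          _ = 𝟙 _ ⊗≫ D.comul ▷ V ⊗≫ (D.counit ▷ (E ⊗ V) ≫ 𝟙_ C ◁ U.act V) ⊗≫ 𝟙 _ := by monoidal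
          _ = _ := by rw [← whisker_exchange, MonoidalCategory.tensorHom_def']; monoidal
      _ = _ := by
        rw [h1, ← h2]
        monoidal
  comul_counit := by
    rw [← cancel_mono (ρ_ E).hom, Iso.inv_hom_id]
    refine hU.ext fun V => ?_
    have h1 := hD.comul_act V (𝟙_ C)
    rw [act₂, hD.counit_act] at h1
    have h2 := U.natural (ρ_ V).hom
    calc
      _ = E ◁ (ρ_ V).inv ≫ (D.comul ▷ (V ⊗ 𝟙_ C) ≫ tensorμ E E V (𝟙_ C) ≫
          (U.act V ⊗ₘ (ρ_ E).hom ≫ D.counit)) ≫ (ρ_ V).hom := by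
        simp only [tensorμ]
        have h3 := BraidedCategory.braiding_naturality_left D.counit V
        calc
          _ = 𝟙 _ ⊗≫ D.comul ▷ V ⊗≫ E ◁ D.counit ▷ V ⊗≫ U.act V ⊗≫ 𝟙 _ := by monoidal
          _ = 𝟙 _ ⊗≫ D.comul ▷ V ⊗≫ E ◁ (D.counit ▷ V ≫ (β_ (𝟙_ C) V).hom) ⊗≫ U.act V ⊗≫ 𝟙 _ := by
            rw [braiding_tensorUnit_left]; monoidal
          _ = 𝟙 _ ⊗≫ D.comul ▷ V ⊗≫ E ◁ (β_ E V).hom ⊗≫ ((E ⊗ V) ◁ D.counit ≫ U.act V ▷ 𝟙_ C)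
              ⊗≫ 𝟙 _ := by
            rw [h3]; monoidal
          _ = _ := by rw [whisker_exchange, MonoidalCategory.tensorHom_def]; monoidal
      _ = _ := by
        rw [h1, ← h2]
        monoidal
  mul_comul := hU.ext₂ fun V W => by
    rw [comp_whiskerRight, Category.assoc, hD.comul_act, hD.mul_act, comp_whiskerRight,
      Category.assoc, hD.mul_act₂]
    calc
      _ = (α_ E E (V ⊗ W)).hom ≫ (D.comul ▷ (E ⊗ V ⊗ W) ≫ (E ⊗ E) ◁ U.act (V ⊗ W)) ≫
          U.act₂ V W := by
        rw [← whisker_exchange, Category.assoc, hD.comul_act]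
      _ = _ := by
        rw [← hD.comul_act]
        simp only [MonoidalCategory.tensorHom_def]
        monoidal
  one_comul := hU.ext₂ fun V W => by
    rw [comp_whiskerRight, Category.assoc, hD.comul_act, hD.one_act, comp_whiskerRight,
      Category.assoc, act₂, tensorμ_natural_left_assoc, tensorHom_comp_tensorHom, hD.one_act,
      hD.one_act, ← tensor_left_unitality]
  mul_counit := by
    have h1 := hD.mul_act (𝟙_ C)
    rw [hD.counit_act] at h1
    rw [← cancel_epi (ρ_ (E ⊗ E)).hom]
    calc
      _ = D.mul ▷ 𝟙_ C ≫ (ρ_ E).hom ≫ D.counit := by monoidal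
      _ = _ := by
        rw [h1, MonoidalCategory.tensorHom_def']
        monoidal
  one_counit := by
    have h1 := hD.one_act (𝟙_ C)
    rw [hD.counit_act] at h1
    rw [← cancel_epi (ρ_ (𝟙_ C)).hom]
    calc
      _ = D.one ▷ 𝟙_ C ≫ (ρ_ E).hom ≫ D.counit := by monoidal
      _ = _ := by rw [h1]; monoidal
  antipode_left := hU.ext fun V => by
    have h1 := BraidedCategory.braiding_naturality_left D.comul V
    have h2 := BraidedCategory.braiding_naturality_right E (η_ V (lDual V))
    rw [braiding_tensorUnit_right, BraidedCategory.braiding_tensor_right_hom] at h2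
    have h3 := hD.comul_act (lDual V) V
    have h4 := U.natural (ε_ V (lDual V))
    rw [hD.counit_act] at h4
    have h5 := BraidedCategory.braiding_naturality_left D.counit V
    rw [braiding_tensorUnit_left] at h5
    -- After the second leg of the coproduct has acted on `V`, the antipode creates `V ⊗ V*` and
    -- lets the first leg act on `V*`. Braiding both legs together past the new `V` turns this into
    -- the action of `E` on `V* ⊗ V`, which the evaluation reduces to the counit.
    calc
      _ = D.comul ▷ V ⊗≫ D.antipode ▷ E ▷ V ≫ (D.mul ▷ V ≫ U.act V) := by monoidal
      _ = D.comul ▷ V ⊗≫ (D.antipode ▷ (E ⊗ V) ≫ E ◁ U.act V) ≫ U.act V := by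
        rw [hD.mul_act]; monoidal
      _ = D.comul ▷ V ⊗≫ E ◁ U.act V ≫ (D.antipode ▷ V ≫ U.act V) := by
        rw [← whisker_exchange]; monoidal
      _ = D.comul ▷ V ⊗≫ E ◁ (𝟙_ C ◁ U.act V ≫ η_ V (lDual V) ▷ V) ⊗≫ (β_ E V).hom ▷ (lDual V ⊗ V) ⊗≫
          V ◁ U.act (lDual V) ▷ V ⊗≫ V ◁ ε_ V (lDual V) ⊗≫ 𝟙 _ := by
        rw [hD.antipode_act]; monoidal
      _ = D.comul ▷ V ⊗≫ E ◁ η_ V (lDual V) ▷ (E ⊗ V) ⊗≫ ((E ⊗ V) ◁ lDual V ◁ U.act V ≫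
          (β_ E V).hom ▷ (lDual V ⊗ V)) ⊗≫ V ◁ U.act (lDual V) ▷ V ⊗≫ V ◁ ε_ V (lDual V) ⊗≫ 𝟙 _ := by
        rw [whisker_exchange]; monoidal
      _ = D.comul ▷ V ⊗≫ E ◁ η_ V (lDual V) ▷ (E ⊗ V) ⊗≫ (β_ E V).hom ▷ (lDual V ⊗ E ⊗ V) ⊗≫
          V ◁ ((E ⊗ lDual V) ◁ U.act V ≫ U.act (lDual V) ▷ V) ⊗≫ V ◁ ε_ V (lDual V) ⊗≫ 𝟙 _ := by
        rw [whisker_exchange]; monoidal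
      _ = 𝟙 _ ⊗≫ D.comul ▷ V ⊗≫ E ◁ ((ρ_ E).hom ≫ (λ_ E).inv ≫ η_ V (lDual V) ▷ E) ▷ V ⊗≫
          (β_ E V).hom ▷ (lDual V ⊗ E ⊗ V) ⊗≫
          V ◁ (U.act (lDual V) ⊗ₘ U.act V) ⊗≫ V ◁ ε_ V (lDual V) ⊗≫ 𝟙 _ := by
        rw [MonoidalCategory.tensorHom_def']; monoidal
      _ = 𝟙 _ ⊗≫ D.comul ▷ V ⊗≫ (E ⊗ E) ◁ η_ V (lDual V) ▷ V ⊗≫ E ◁ (β_ E V).hom ▷ lDual V ▷ V ⊗≫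
          ((E ⊗ V) ◁ (β_ E (lDual V)).hom ≫ (β_ E V).hom ▷ (lDual V ⊗ E)) ▷ V ⊗≫
          V ◁ (U.act (lDual V) ⊗ₘ U.act V) ⊗≫ V ◁ ε_ V (lDual V) ⊗≫ 𝟙 _ := by
        rw [← Category.assoc (ρ_ E).hom, ← h2]; monoidal
      _ = 𝟙 _ ⊗≫ (D.comul ▷ (𝟙_ C) ≫ (E ⊗ E) ◁ η_ V (lDual V)) ▷ V ⊗≫ E ◁ (β_ E V).hom ▷ lDual V ▷ V ⊗≫
          (β_ E V).hom ▷ (E ⊗ lDual V ⊗ V) ⊗≫ V ◁ tensorμ E E (lDual V) V ⊗≫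
          V ◁ (U.act (lDual V) ⊗ₘ U.act V) ⊗≫ V ◁ ε_ V (lDual V) ⊗≫ 𝟙 _ := by
        rw [whisker_exchange, tensorμ]; monoidal
      _ = 𝟙 _ ⊗≫ E ◁ η_ V (lDual V) ▷ V ⊗≫ (D.comul ▷ V ≫ (β_ (E ⊗ E) V).hom) ▷ (lDual V ⊗ V) ⊗≫
          V ◁ U.act₂ (lDual V) V ⊗≫ V ◁ ε_ V (lDual V) ⊗≫ 𝟙 _ := by
        rw [← whisker_exchange, BraidedCategory.braiding_tensor_left_hom, act₂]; monoidal
      _ = 𝟙 _ ⊗≫ E ◁ η_ V (lDual V) ▷ V ⊗≫ (β_ E V).hom ▷ (lDual V ⊗ V) ⊗≫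
          V ◁ (U.act (lDual V ⊗ V) ≫ ε_ V (lDual V)) ⊗≫ 𝟙 _ := by
        rw [h1, ← h3]; monoidal
      _ = 𝟙 _ ⊗≫ E ◁ η_ V (lDual V) ▷ V ⊗≫ ((β_ E V).hom ▷ (lDual V ⊗ V) ≫ (V ⊗ E) ◁ ε_ V (lDual V)) ⊗≫
          V ◁ D.counit ⊗≫ 𝟙 _ := by
        rw [← h4]; monoidal
      _ = 𝟙 _ ⊗≫ E ◁ (η_ V (lDual V) ▷ V ⊗≫ V ◁ ε_ V (lDual V)) ⊗≫ ((β_ E V).hom ≫ V ◁ D.counit) ⊗≫ 𝟙 _ := by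
        rw [← whisker_exchange]; monoidal
      _ = 𝟙 _ ⊗≫ D.counit ▷ V ≫ (λ_ V).hom := by
        rw [ExactPairing.evaluation_coevaluation'', ← h5]; monoidal
      _ = _ := by rw [← hD.one_act]; monoidal
  antipode_right := hU.ext fun V => by
    have h3 := hD.comul_act V (lDual V)
    have h4 := U.natural (η_ V (lDual V))
    rw [hD.counit_act] at h4
    -- Here no braiding past `V` intervenes: the two legs act on the pair `V ⊗ V*` produced by the
    -- coevaluation, and naturality with respect to the latter yields the counit.
    calc
      _ = D.comul ▷ V ⊗≫ E ◁ D.antipode ▷ V ⊗≫ (D.mul ▷ V ≫ U.act V) := by monoidal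
      _ = D.comul ▷ V ⊗≫ E ◁ (D.antipode ▷ V ≫ U.act V) ≫ U.act V := by
        rw [hD.mul_act]; monoidal
      _ = D.comul ▷ V ⊗≫ (E ⊗ E) ◁ η_ V (lDual V) ▷ V ⊗≫ E ◁ (β_ E V).hom ▷ (lDual V ⊗ V) ⊗≫
          E ◁ V ◁ U.act (lDual V) ▷ V ⊗≫ ((E ⊗ V) ◁ ε_ V (lDual V) ≫ U.act V ▷ 𝟙_ C) ⊗≫ 𝟙 _ := by
        rw [hD.antipode_act]; monoidal
      _ = D.comul ▷ V ⊗≫ (E ⊗ E) ◁ η_ V (lDual V) ▷ V ⊗≫ E ◁ (β_ E V).hom ▷ (lDual V ⊗ V) ⊗≫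
          ((E ⊗ V) ◁ U.act (lDual V) ≫ U.act V ▷ lDual V) ▷ V ⊗≫ V ◁ ε_ V (lDual V) ⊗≫ 𝟙 _ := by
        rw [whisker_exchange]; monoidal
      _ = 𝟙 _ ⊗≫ (D.comul ▷ 𝟙_ C ≫ (E ⊗ E) ◁ η_ V (lDual V)) ▷ V ⊗≫ (U.act₂ V (lDual V)) ▷ V ⊗≫
          V ◁ ε_ V (lDual V) ⊗≫ 𝟙 _ := by
        rw [act₂, MonoidalCategory.tensorHom_def', tensorμ]; monoidal
      _ = 𝟙 _ ⊗≫ (E ◁ η_ V (lDual V) ≫ U.act (V ⊗ lDual V)) ▷ V ⊗≫ V ◁ ε_ V (lDual V) ⊗≫ 𝟙 _ := by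
        rw [← whisker_exchange, ← h3]; monoidal
      _ = 𝟙 _ ⊗≫ D.counit ▷ V ⊗≫ (η_ V (lDual V) ▷ V ⊗≫ V ◁ ε_ V (lDual V)) ⊗≫ 𝟙 _ := by
        rw [h4]; monoidal
      _ = 𝟙 _ ⊗≫ D.counit ▷ V ≫ (λ_ V).hom := by
        rw [ExactPairing.evaluation_coevaluation'']; monoidal
      _ = _ := by rw [← hD.one_act]; monoidal

end Induces

end NaturalAction

end Universal

end

section

open CategoryTheory MonoidalCategory

/-! ### Objects coacting naturally on a braided category -/

section Couniversal

universe v₁ u₁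

set_option linter.unusedSectionVars false

variable {C : Type u₁} [Category.{v₁} C] [MonoidalCategory C] [BraidedCategory C]

theorem tensorμ_comp_whiskerLeft_tensorHom (V W : C) {X₁ X₂ Y₁ Y₂ : C} (f : X₁ ⟶ Y₁)
    (g : X₂ ⟶ Y₂) : tensorμ V X₁ W X₂ ≫ (V ⊗ W) ◁ (f ⊗ₘ g) =
      (V ◁ f ⊗ₘ W ◁ g) ≫ tensorμ V Y₁ W Y₂ := by
  simpa using (tensorμ_natural (𝟙 V) f (𝟙 W) g).symm

theorem tensorμ_comp_tensorHom_whiskerRight (V W : C) {X₁ X₂ Y₁ Y₂ : C} (f : X₁ ⟶ Y₁)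
    (g : X₂ ⟶ Y₂) : (f ▷ V ⊗ₘ g ▷ W) ≫ tensorμ Y₁ V Y₂ W =
      tensorμ X₁ V X₂ W ≫ (f ⊗ₘ g) ▷ (V ⊗ W) := by
  simpa using tensorμ_natural f (𝟙 V) g (𝟙 W)

namespace NaturalCoaction

variable {F : C} (U : NaturalCoaction F)

/-- The coaction of `F` pushed through a morphism `φ : Y ⊗ F ⟶ X`. -/
def probe {X Y : C} (φ : Y ⊗ F ⟶ X) (V : C) : Y ⊗ V ⟶ V ⊗ X :=
  Y ◁ U.coact V ≫ (α_ Y V F).inv ≫ (β_ Y V).hom ▷ F ≫ (α_ V Y F).hom ≫ V ◁ φ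

/-- Morphisms out of `Y ⊗ F` are detected by the coactions. -/
def Faithful : Prop :=
  ∀ ⦃X Y : C⦄ (φ ψ : Y ⊗ F ⟶ X), (∀ V, U.probe φ V = U.probe ψ V) → φ = ψ

/-- The coaction of `F ⊗ F` on `V ⊗ W`. -/
def coact₂ (V W : C) : V ⊗ W ⟶ (V ⊗ W) ⊗ (F ⊗ F) :=
  (U.coact V ⊗ₘ U.coact W) ≫ tensorμ V F W F

/-- The coaction of `(F ⊗ F) ⊗ F` on `(V ⊗ W) ⊗ X`. -/
def coact₃ (V W X : C) : (V ⊗ W) ⊗ X ⟶ ((V ⊗ W) ⊗ X) ⊗ ((F ⊗ F) ⊗ F) :=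
  (U.coact₂ V W ⊗ₘ U.coact X) ≫ tensorμ (V ⊗ W) (F ⊗ F) X F

variable {U}

/-- Morphisms out of `Y ⊗ V` are detected by the family `S`. -/
def Detects {ι : Type*} {Y : C} (W T : ι → C) (S : ∀ i, T i ⟶ W i ⊗ Y) : Prop :=
  ∀ ⦃Z V : C⦄ (p q : Y ⊗ V ⟶ Z), (∀ i, S i ▷ V ≫ (α_ (W i) Y V).hom ≫ W i ◁ p =
    S i ▷ V ≫ (α_ (W i) Y V).hom ≫ W i ◁ q) → p = q

theorem Detects.ext {ι : Type*} {Y : C} {W T : ι → C} {S : ∀ i, T i ⟶ W i ⊗ Y}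
    (h : Detects W T S) {X : C} {φ ψ : Y ⟶ X} (H : ∀ i, S i ≫ W i ◁ φ = S i ≫ W i ◁ ψ) :
    φ = ψ := by
  have key : ∀ (χ : Y ⟶ X) (i : ι), S i ▷ 𝟙_ C ≫ (α_ (W i) Y (𝟙_ C)).hom ≫
      W i ◁ ((ρ_ Y).hom ≫ χ) = (ρ_ _).hom ≫ S i ≫ W i ◁ χ := by
    intro χ i
    monoidal
  have := h ((ρ_ Y).hom ≫ φ) ((ρ_ Y).hom ≫ ψ) (by
    intro i
    rw [key, key, H i])
  simpa using this

/-- Again the bystander is moved to the other side by the braiding, this time before the morphism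
that is to be detected. -/
theorem Faithful.detects_coact (h : U.Faithful) :
    Detects (fun V : C => V) (fun V => V) U.coact := by
  have key : ∀ {Z V : C} (p : F ⊗ V ⟶ Z) (W : C), U.probe ((β_ V F).hom ≫ p) W =
      (β_ V W).hom ≫ U.coact W ▷ V ≫ (α_ W F V).hom ≫ W ◁ p := by
    intro Z V p W
    rw [← BraidedCategory.braiding_naturality_right_assoc,
      BraidedCategory.braiding_tensor_right_hom, probe]
    monoidal
  intro Z V p q H
  rw [← cancel_epi (β_ V F).hom]
  exact h _ _ fun W => by rw [key, key, H]

/-- Induction step for morphisms out of iterated tensor powers of `F`: the last factor is detected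
by the coaction, after which the first factor is detected by `S` with the enlarged bystander. -/
theorem Faithful.detects_tensor (h : U.Faithful) {ι : Type*} {Y : C} {W T : ι → C}
    {S : ∀ i, T i ⟶ W i ⊗ Y} (hS : Detects W T S) :
    Detects (fun i : ι × C => W i.1 ⊗ i.2) (fun i => T i.1 ⊗ i.2)
      (fun i => (S i.1 ⊗ₘ U.coact i.2) ≫ tensorμ (W i.1) Y i.2 F) := by
  have key : ∀ {Z V : C} (p : (Y ⊗ F) ⊗ V ⟶ Z) (X : C) (i : ι),
      (S i ▷ (V ⊗ X) ≫ (α_ (W i) Y (V ⊗ X)).hom ≫ W i ◁ ((α_ Y V X).inv ≫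
        U.probe ((α_ Y V F).hom ≫ Y ◁ (β_ V F).hom ≫ (α_ Y F V).inv ≫ p) X)) ≫
          (α_ (W i) X Z).inv =
      T i ◁ (β_ V X).hom ≫ (α_ (T i) X V).inv ≫
        ((S i ⊗ₘ U.coact X) ≫ tensorμ (W i) Y X F) ▷ V ≫ (α_ (W i ⊗ X) (Y ⊗ F) V).hom ≫
          (W i ⊗ X) ◁ p := by
    intro Z V p X i
    calc
      _ = (S i ▷ (V ⊗ X) ≫ (W i ⊗ Y) ◁ (V ◁ U.coact X ⊗≫ (β_ V X).hom ▷ F ⊗≫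
          X ◁ (β_ V F).hom)) ⊗≫ W i ◁ (β_ Y X).hom ▷ (F ⊗ V) ⊗≫ (W i ⊗ X) ◁ p ⊗≫ 𝟙 _ := by
        simp only [probe, BraidedCategory.braiding_tensor_left_hom]
        calc
          _ = (S i ▷ (V ⊗ X) ≫ (W i ⊗ Y) ◁ (V ◁ U.coact X ⊗≫ (β_ V X).hom ▷ F)) ⊗≫
              W i ◁ ((β_ Y X).hom ▷ (V ⊗ F) ≫ (X ⊗ Y) ◁ (β_ V F).hom) ⊗≫ (W i ⊗ X) ◁ p
              ⊗≫ 𝟙 _ := by monoidal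
          _ = _ := by rw [← whisker_exchange (β_ Y X).hom (β_ V F).hom]; monoidal
      _ = (S i ▷ (V ⊗ X) ≫ (W i ⊗ Y) ◁ (V ◁ U.coact X ≫ (β_ V (X ⊗ F)).hom)) ⊗≫
          W i ◁ (β_ Y X).hom ▷ (F ⊗ V) ⊗≫ (W i ⊗ X) ◁ p ⊗≫ 𝟙 _ := by
        simp only [BraidedCategory.braiding_tensor_right_hom]
        monoidal
      _ = (S i ▷ (V ⊗ X) ≫ (W i ⊗ Y) ◁ (β_ V X).hom) ⊗≫ (W i ⊗ Y) ◁ U.coact X ▷ V ⊗≫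
          W i ◁ (β_ Y X).hom ▷ (F ⊗ V) ⊗≫ (W i ⊗ X) ◁ p ⊗≫ 𝟙 _ := by
        rw [BraidedCategory.braiding_naturality_right]
        monoidal
      _ = _ := by
        rw [← whisker_exchange]
        simp only [tensorμ, MonoidalCategory.tensorHom_def]
        monoidal
  intro Z V p q H
  rw [← cancel_epi ((α_ Y V F).hom ≫ Y ◁ (β_ V F).hom ≫ (α_ Y F V).inv)]
  simp only [Category.assoc]
  refine h _ _ fun X => ?_
  rw [← cancel_epi (α_ Y V X).inv]
  refine hS _ _ fun i => ?_
  rw [← cancel_mono (α_ (W i) X Z).inv, key, key, H (i, X)]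

theorem Faithful.ext (h : U.Faithful) {X : C} {φ ψ : F ⟶ X}
    (H : ∀ V, U.coact V ≫ V ◁ φ = U.coact V ≫ V ◁ ψ) : φ = ψ :=
  h.detects_coact.ext H

theorem Faithful.ext₂ (h : U.Faithful) {X : C} {φ ψ : F ⊗ F ⟶ X}
    (H : ∀ V W, U.coact₂ V W ≫ (V ⊗ W) ◁ φ = U.coact₂ V W ≫ (V ⊗ W) ◁ ψ) : φ = ψ :=
  (h.detects_tensor h.detects_coact).ext fun i => H i.1 i.2

theorem Faithful.ext₃ (h : U.Faithful) {X : C} {φ ψ : (F ⊗ F) ⊗ F ⟶ X}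
    (H : ∀ V W Y, U.coact₃ V W Y ≫ ((V ⊗ W) ⊗ Y) ◁ φ = U.coact₃ V W Y ≫ ((V ⊗ W) ⊗ Y) ◁ ψ) :
    φ = ψ :=
  (h.detects_tensor (h.detects_tensor h.detects_coact)).ext fun i => H i.1.1 i.1.2 i.2

variable (U)

/-- The structure maps `D` are those induced by the natural coaction `U`. -/
structure Induces [HasDuals C] (D : HopfMaps F) : Prop where
  coact_mul : ∀ V W, U.coact₂ V W ≫ (V ⊗ W) ◁ D.mul = U.coact (V ⊗ W)
  coact_one : U.coact (𝟙_ C) = D.one ≫ (λ_ F).inv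
  coact_comul : ∀ V, U.coact V ≫ V ◁ D.comul =
    U.coact V ≫ U.coact V ▷ F ≫ (α_ V F F).hom
  coact_counit : ∀ V, U.coact V ≫ V ◁ D.counit = (ρ_ V).inv
  coact_antipode : ∀ V, U.coact V ≫ V ◁ D.antipode =
    𝟙 _ ⊗≫ η_ V (lDual V) ▷ V ⊗≫ V ◁ U.coact (lDual V) ▷ V ⊗≫ (V ⊗ lDual V) ◁ (β_ F V).hom ⊗≫ V ◁ ε_ V (lDual V) ▷ F ⊗≫ 𝟙 _

variable {U} [HasDuals C] {D : HopfMaps F}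

namespace Induces

/-- Coacting twice on `V ⊗ W` amounts to the coproduct of the braided tensor product coalgebra `F ⊗
F`, again by coherence of `tensorμ` with associators. -/
theorem coact₂_comul (hD : U.Induces D) (V W : C) :
    U.coact₂ V W ≫ (V ⊗ W) ◁ ((D.comul ⊗ₘ D.comul) ≫ tensorμ F F F F) =
      U.coact₂ V W ≫ U.coact₂ V W ▷ (F ⊗ F) ≫ (α_ (V ⊗ W) (F ⊗ F) (F ⊗ F)).hom := by
  have h1 : U.coact₂ V W ≫ (V ⊗ W) ◁ (D.comul ⊗ₘ D.comul) =
      (U.coact V ⊗ₘ U.coact W) ≫ (U.coact V ▷ F ⊗ₘ U.coact W ▷ F) ≫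
        ((α_ V F F).hom ⊗ₘ (α_ W F F).hom) ≫ tensorμ V (F ⊗ F) W (F ⊗ F) := by
    simp only [coact₂, Category.assoc, tensorμ_comp_whiskerLeft_tensorHom]
    simp only [tensorHom_comp_tensorHom_assoc, hD.coact_comul]
  rw [whiskerLeft_comp, reassoc_of% h1, ← associator_monoidal,
    reassoc_of% (tensorμ_comp_tensorHom_whiskerRight F F (U.coact V) (U.coact W))]
  simp only [coact₂, comp_whiskerRight, Category.assoc]

/-- The mirror image of the argument for actions. Associativity of the product now comes from
naturality of the coaction with respect to the associator, and coassociativity from successive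
coactions. -/
theorem isHopf (hD : U.Induces D) (hU : U.Faithful) : D.IsHopf where
  mul_assoc := hU.ext₃ fun V W X => by
    have h1 : U.coact₃ V W X ≫ ((V ⊗ W) ⊗ X) ◁ (D.mul ▷ F) = U.coact₂ (V ⊗ W) X := by
      rw [← tensorHom_id]
      simp only [coact₃, Category.assoc, tensorμ_comp_whiskerLeft_tensorHom,
        tensorHom_comp_tensorHom_assoc, whiskerLeft_id, Category.comp_id, hD.coact_mul]
      rfl
    have h2 : U.coact₃ V W X ≫ ((V ⊗ W) ⊗ X) ◁ ((α_ F F F).hom ≫ F ◁ D.mul) =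
        (α_ V W X).hom ≫ U.coact₂ V (W ⊗ X) ≫ (α_ V W X).inv ▷ (F ⊗ F) := by
      have h3 := tensor_associativity V F W F X F
      have h4 : U.coact₃ V W X ≫ ((V ⊗ W) ⊗ X) ◁ (α_ F F F).hom =
          (α_ V W X).hom ≫ (U.coact V ⊗ₘ U.coact₂ W X) ≫ tensorμ V F (W ⊗ X) (F ⊗ F) ≫
            (α_ V W X).inv ▷ (F ⊗ (F ⊗ F)) := by
        rw [← cancel_mono ((α_ V W X).hom ▷ (F ⊗ (F ⊗ F)))]
        have h5 : U.coact₃ V W X = ((U.coact V ⊗ₘ U.coact W) ⊗ₘ U.coact X) ≫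
            tensorμ V F W F ▷ (X ⊗ F) ≫ tensorμ (V ⊗ W) (F ⊗ F) X F := by
          simp only [coact₃, coact₂, ← tensorHom_id, tensorHom_comp_tensorHom_assoc,
            Category.comp_id]
        have h6 : ((V ⊗ W) ⊗ X) ◁ (α_ F F F).hom ≫ (α_ V W X).hom ▷ (F ⊗ (F ⊗ F)) =
            ((α_ V W X).hom ⊗ₘ (α_ F F F).hom) := by
          rw [MonoidalCategory.tensorHom_def']
        simp only [Category.assoc, h6]
        rw [h5, Category.assoc, Category.assoc, h3, associator_naturality_assoc]
        simp only [coact₂, ← id_tensorHom, tensorHom_comp_tensorHom_assoc, Category.comp_id]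
        simp
      rw [whiskerLeft_comp, reassoc_of% h4, ← whisker_exchange]
      have h7 := tensorμ_comp_whiskerLeft_tensorHom V (W ⊗ X) (𝟙 F) D.mul
      simp only [id_tensorHom, whiskerLeft_id] at h7
      rw [reassoc_of% h7]
      have h8 := hD.coact_mul W X
      have h9 : (U.coact V ⊗ₘ U.coact₂ W X) ≫ (V ⊗ F) ◁ (W ⊗ X) ◁ D.mul =
          (U.coact V ⊗ₘ U.coact (W ⊗ X)) := by
        rw [← h8, ← id_tensorHom, tensorHom_comp_tensorHom, Category.comp_id]
      rw [reassoc_of% h9]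
      simp only [coact₂, Category.assoc]
    have h10 := U.natural (α_ V W X).hom
    calc
      _ = U.coact (((V ⊗ W) ⊗ X)) := by
        rw [whiskerLeft_comp, reassoc_of% h1, hD.coact_mul]
      _ = U.coact₃ V W X ≫ ((V ⊗ W) ⊗ X) ◁ ((α_ F F F).hom ≫ F ◁ D.mul) ≫
          ((V ⊗ W) ⊗ X) ◁ D.mul := by
        rw [reassoc_of% h2, ← whisker_exchange, ← Category.assoc (U.coact₂ _ _), hD.coact_mul,
          reassoc_of% h10]
        simp
      _ = _ := by simp
  one_mul := by
    rw [← cancel_epi (λ_ F).inv, Iso.inv_hom_id]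
    refine hU.ext fun V => ?_
    have h1 := hD.coact_mul (𝟙_ C) V
    rw [coact₂, hD.coact_one, Category.assoc] at h1
    have h2 := U.natural (λ_ V).inv
    have h3 := BraidedCategory.braiding_naturality_left D.one V
    rw [braiding_tensorUnit_left] at h3
    calc
      _ = (λ_ V).inv ≫ (((D.one ≫ (λ_ F).inv) ⊗ₘ U.coact V) ≫ tensorμ (𝟙_ C) F V F) ≫
          (𝟙_ C ⊗ V) ◁ D.mul ≫ (λ_ V).hom ▷ F := by
        rw [Category.assoc]
        symm
        simp only [tensorμ]
        calc
          _ = 𝟙 _ ⊗≫ U.coact V ⊗≫ (D.one ▷ V ≫ (β_ F V).hom) ▷ F ⊗≫ V ◁ D.mul := by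
            rw [MonoidalCategory.tensorHom_def']; monoidal
          _ = _ := by rw [h3]; monoidal
      _ = _ := by
        rw [Category.assoc, reassoc_of% h1, reassoc_of% h2]
        monoidal
  mul_one := by
    rw [← cancel_epi (ρ_ F).inv, Iso.inv_hom_id]
    refine hU.ext fun V => ?_
    have h1 := hD.coact_mul V (𝟙_ C)
    rw [coact₂, hD.coact_one, Category.assoc] at h1
    have h2 := U.natural (ρ_ V).inv
    calc
      _ = (ρ_ V).inv ≫ ((U.coact V ⊗ₘ (D.one ≫ (λ_ F).inv)) ≫ tensorμ V F (𝟙_ C) F) ≫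
          (V ⊗ 𝟙_ C) ◁ D.mul ≫ (ρ_ V).hom ▷ F := by
        simp only [tensorμ, braiding_tensorUnit_right]
        rw [MonoidalCategory.tensorHom_def]
        monoidal
      _ = _ := by
        rw [Category.assoc, reassoc_of% h1, reassoc_of% h2]
        monoidal
  comul_assoc := hU.ext fun V => by
    have h1 := hD.coact_comul V
    calc
      _ = (U.coact V ≫ V ◁ D.comul) ⊗≫ V ◁ D.comul ▷ F ⊗≫ 𝟙 _ := by monoidal
      _ = (U.coact V ≫ U.coact V ▷ F ≫ (α_ V F F).hom) ⊗≫ V ◁ D.comul ▷ F ⊗≫ 𝟙 _ := by rw [h1]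
      _ = U.coact V ≫ (U.coact V ≫ V ◁ D.comul) ▷ F ⊗≫ 𝟙 _ := by monoidal
      _ = (U.coact V ≫ U.coact V ▷ F ≫ (α_ V F F).hom) ≫ U.coact V ▷ (F ⊗ F) ⊗≫ 𝟙 _ := by
        rw [h1]; monoidal
      _ = U.coact V ≫ (V ◁ D.comul ≫ U.coact V ▷ (F ⊗ F)) ⊗≫ 𝟙 _ := by rw [← h1]; monoidal
      _ = (U.coact V ≫ U.coact V ▷ F ≫ (α_ V F F).hom) ≫ V ◁ F ◁ D.comul := by
        rw [whisker_exchange]; monoidal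
      _ = _ := by rw [← h1]; monoidal
  counit_comul := hU.ext fun V => by
    rw [whiskerLeft_comp, reassoc_of% (hD.coact_comul V)]
    calc
      _ = U.coact V ≫ (U.coact V ≫ V ◁ D.counit) ▷ F ⊗≫ 𝟙 _ := by monoidal
      _ = _ := by rw [hD.coact_counit]; monoidal
  comul_counit := hU.ext fun V => by
    rw [whiskerLeft_comp, reassoc_of% (hD.coact_comul V)]
    calc
      _ = U.coact V ≫ (U.coact V ▷ F ≫ (V ⊗ F) ◁ D.counit) ⊗≫ 𝟙 _ := by monoidal
      _ = (U.coact V ≫ V ◁ D.counit) ≫ U.coact V ▷ 𝟙_ C ⊗≫ 𝟙 _ := by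
        rw [← whisker_exchange]; monoidal
      _ = _ := by rw [hD.coact_counit]; monoidal
  mul_comul := hU.ext₂ fun V W => by
    rw [whiskerLeft_comp, reassoc_of% (hD.coact_mul V W), hD.coact_comul,
      ← Category.assoc (D.comul ⊗ₘ D.comul), whiskerLeft_comp, reassoc_of% (hD.coact₂_comul V W)]
    calc
      _ = (U.coact₂ V W ≫ (V ⊗ W) ◁ D.mul) ≫ U.coact (V ⊗ W) ▷ F ≫ (α_ (V ⊗ W) F F).hom := by
        rw [hD.coact_mul]
      _ = U.coact₂ V W ≫ (U.coact₂ V W ≫ (V ⊗ W) ◁ D.mul) ▷ (F ⊗ F) ≫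
          ((V ⊗ W) ⊗ F) ◁ D.mul ≫ (α_ (V ⊗ W) F F).hom := by
        rw [Category.assoc, whisker_exchange_assoc, hD.coact_mul]
      _ = _ := by
        simp only [MonoidalCategory.tensorHom_def]
        monoidal
  one_comul := by
    have h1 := hD.coact_comul (𝟙_ C)
    rw [hD.coact_one] at h1
    rw [← cancel_mono (λ_ (F ⊗ F)).inv]
    calc
      _ = (D.one ≫ (λ_ F).inv) ≫ 𝟙_ C ◁ D.comul := by monoidal
      _ = _ := by
        rw [h1, MonoidalCategory.tensorHom_def']
        monoidal
  mul_counit := hU.ext₂ fun V W => by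
    rw [whiskerLeft_comp, reassoc_of% (hD.coact_mul V W), hD.coact_counit, coact₂, whiskerLeft_comp,
      Category.assoc, reassoc_of% (tensorμ_comp_whiskerLeft_tensorHom V W D.counit D.counit),
      tensorHom_comp_tensorHom_assoc, hD.coact_counit, hD.coact_counit]
    have h1 := rightUnitor_monoidal V W
    rw [← cancel_mono (ρ_ (V ⊗ W)).hom]
    simp only [Category.assoc, ← h1, tensorHom_comp_tensorHom, Iso.inv_hom_id]
    simp
  one_counit := by
    have h1 := hD.coact_counit (𝟙_ C)
    rw [hD.coact_one] at h1
    rw [← cancel_mono (ρ_ (𝟙_ C)).inv]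
    calc
      _ = (D.one ≫ (λ_ F).inv) ≫ 𝟙_ C ◁ D.counit := by monoidal
      _ = _ := by rw [h1]; monoidal
  antipode_left := hU.ext fun V => by
    have h3 := hD.coact_mul (lDual V) V
    have h4 := U.natural (ε_ V (lDual V))
    rw [hD.coact_one] at h4
    calc
      _ = (U.coact V ≫ V ◁ D.comul) ⊗≫ V ◁ D.antipode ▷ F ⊗≫ V ◁ D.mul := by monoidal
      _ = U.coact V ≫ (U.coact V ≫ V ◁ D.antipode) ▷ F ⊗≫ V ◁ D.mul := by
        rw [hD.coact_comul]; monoidal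
      _ = 𝟙 _ ⊗≫ (𝟙_ C ◁ U.coact V ≫ η_ V (lDual V) ▷ (V ⊗ F)) ⊗≫ V ◁ U.coact (lDual V) ▷ V ▷ F ⊗≫
          (V ⊗ lDual V) ◁ (β_ F V).hom ▷ F ⊗≫ V ◁ (ε_ V (lDual V) ▷ (F ⊗ F) ≫ 𝟙_ C ◁ D.mul) ⊗≫ 𝟙 _ := by
        rw [hD.coact_antipode]; monoidal
      _ = 𝟙 _ ⊗≫ η_ V (lDual V) ▷ V ⊗≫ V ◁ (lDual V ◁ U.coact V ≫ U.coact (lDual V) ▷ (V ⊗ F)) ⊗≫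
          (V ⊗ lDual V) ◁ (β_ F V).hom ▷ F ⊗≫ V ◁ ((lDual V ⊗ V) ◁ D.mul ≫ ε_ V (lDual V) ▷ F) ⊗≫ 𝟙 _ := by
        rw [whisker_exchange (η_ V (lDual V)), ← whisker_exchange (ε_ V (lDual V))]; monoidal
      _ = 𝟙 _ ⊗≫ η_ V (lDual V) ▷ V ⊗≫ V ◁ ((U.coact₂ (lDual V) V ≫ (lDual V ⊗ V) ◁ D.mul) ≫ ε_ V (lDual V) ▷ F)
          ⊗≫ 𝟙 _ := by
        rw [coact₂, MonoidalCategory.tensorHom_def', tensorμ]; monoidal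
      _ = 𝟙 _ ⊗≫ (η_ V (lDual V) ▷ V ⊗≫ V ◁ ε_ V (lDual V)) ⊗≫ V ◁ D.one := by
        rw [h3, ← h4]; monoidal
      _ = (ρ_ V).inv ≫ V ◁ D.one := by
        rw [ExactPairing.evaluation_coevaluation'']; monoidal
      _ = _ := by rw [← hD.coact_counit]; monoidal
  antipode_right := hU.ext fun V => by
    have h1 := BraidedCategory.braiding_naturality_left D.mul V
    have h2 := BraidedCategory.braiding_naturality_right F (ε_ V (lDual V))
    rw [braiding_tensorUnit_right, BraidedCategory.braiding_tensor_right_hom] at h2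
    have h3 := hD.coact_mul V (lDual V)
    have h4 := U.natural (η_ V (lDual V))
    rw [hD.coact_one] at h4
    have h5 := BraidedCategory.braiding_naturality_left D.one V
    rw [braiding_tensorUnit_left] at h5
    -- The coaction of `V*` is produced first. Passing the coaction of `V` across the evaluation
    -- gathers both copies of `F` behind `V ⊗ V*`, where the product is the coaction of that tensor
    -- product; naturality with respect to the coevaluation turns it into the unit.
    calc
      _ = (U.coact V ≫ V ◁ D.comul) ⊗≫ V ◁ F ◁ D.antipode ⊗≫ V ◁ D.mul := by monoidal
      _ = U.coact V ≫ (U.coact V ▷ F ≫ (V ⊗ F) ◁ D.antipode) ⊗≫ V ◁ D.mul := by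
        rw [hD.coact_comul]; monoidal
      _ = (U.coact V ≫ V ◁ D.antipode) ⊗≫ U.coact V ▷ F ⊗≫ V ◁ D.mul := by
        rw [← whisker_exchange]; monoidal
      _ = 𝟙 _ ⊗≫ η_ V (lDual V) ▷ V ⊗≫ V ◁ U.coact (lDual V) ▷ V ⊗≫ (V ⊗ lDual V) ◁ (β_ F V).hom ⊗≫
          (V ◁ ε_ V (lDual V) ≫ U.coact V ▷ 𝟙_ C) ▷ F ⊗≫ V ◁ D.mul := by
        rw [hD.coact_antipode]; monoidal
      _ = 𝟙 _ ⊗≫ η_ V (lDual V) ▷ V ⊗≫ V ◁ U.coact (lDual V) ▷ V ⊗≫ (V ◁ lDual V ◁ (β_ F V).hom ≫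
          U.coact V ▷ (lDual V ⊗ V ⊗ F)) ⊗≫ V ◁ F ◁ ε_ V (lDual V) ▷ F ⊗≫ V ◁ D.mul := by
        rw [whisker_exchange]; monoidal
      _ = 𝟙 _ ⊗≫ η_ V (lDual V) ▷ V ⊗≫ (V ◁ U.coact (lDual V) ≫ U.coact V ▷ (lDual V ⊗ F)) ▷ V ⊗≫
          (V ⊗ F ⊗ lDual V) ◁ (β_ F V).hom ⊗≫
          V ◁ (F ◁ ε_ V (lDual V) ≫ (ρ_ F).hom ≫ (λ_ F).inv) ▷ F ⊗≫ V ◁ D.mul := by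
        rw [whisker_exchange]; monoidal
      _ = 𝟙 _ ⊗≫ η_ V (lDual V) ▷ V ⊗≫ (U.coact V ⊗ₘ U.coact (lDual V)) ▷ V ⊗≫
          V ◁ ((F ⊗ lDual V) ◁ (β_ F V).hom ≫ (β_ F (lDual V)).hom ▷ (V ⊗ F)) ⊗≫
          V ◁ lDual V ◁ (β_ F V).hom ▷ F ⊗≫ V ◁ (ε_ V (lDual V) ▷ (F ⊗ F) ≫ 𝟙_ C ◁ D.mul) ⊗≫ 𝟙 _ := by
        rw [h2, MonoidalCategory.tensorHom_def']; monoidal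
      _ = 𝟙 _ ⊗≫ η_ V (lDual V) ▷ V ⊗≫ U.coact₂ V (lDual V) ▷ V ⊗≫
          (V ⊗ lDual V) ◁ ((β_ (F ⊗ F) V).hom ≫ V ◁ D.mul) ⊗≫ V ◁ ε_ V (lDual V) ▷ F ⊗≫ 𝟙 _ := by
        rw [whisker_exchange, ← whisker_exchange (ε_ V (lDual V)), coact₂, tensorμ,
          BraidedCategory.braiding_tensor_left_hom]; monoidal
      _ = 𝟙 _ ⊗≫ (η_ V (lDual V) ≫ U.coact₂ V (lDual V) ≫ (V ⊗ lDual V) ◁ D.mul) ▷ V ⊗≫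
          (V ⊗ lDual V) ◁ (β_ F V).hom ⊗≫ V ◁ ε_ V (lDual V) ▷ F ⊗≫ 𝟙 _ := by
        rw [← h1]; monoidal
      _ = 𝟙 _ ⊗≫ D.one ▷ V ⊗≫ (η_ V (lDual V) ▷ (F ⊗ V) ≫ (V ⊗ lDual V) ◁ (β_ F V).hom) ⊗≫
          V ◁ ε_ V (lDual V) ▷ F ⊗≫ 𝟙 _ := by
        rw [h3, h4]; monoidal
      _ = 𝟙 _ ⊗≫ (D.one ▷ V ≫ (β_ F V).hom) ⊗≫ (η_ V (lDual V) ▷ V ⊗≫ V ◁ ε_ V (lDual V)) ▷ F ⊗≫ 𝟙 _ := by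
        rw [← whisker_exchange]; monoidal
      _ = (ρ_ V).inv ≫ V ◁ D.one := by
        rw [ExactPairing.evaluation_coevaluation'', h5]; monoidal
      _ = _ := by rw [← hD.coact_counit]; monoidal

end Induces

end NaturalCoaction

end Couniversal

end

/-! ### From coactions to actions through the double braiding -/

section

open CategoryTheory MonoidalCategory

section Transmutation

universe v₁ u₁

variable {C : Type u₁} [Category.{v₁} C] [MonoidalCategory C] [BraidedCategory C]

/-- `Q` commutes with all structure maps. -/
structure HopfMaps.IsHom {F E : C} (D : HopfMaps F) (D' : HopfMaps E) (Q : F ⟶ E) : Prop where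
  map_mul : D.mul ≫ Q = (Q ⊗ₘ Q) ≫ D'.mul
  map_one : D.one ≫ Q = D'.one
  map_comul : Q ≫ D'.comul = D.comul ≫ (Q ⊗ₘ Q)
  map_counit : Q ≫ D'.counit = D.counit
  map_antipode : D.antipode ≫ Q = Q ≫ D'.antipode

/-- A morphism of bialgebras between Hopf algebras commutes with the antipodes. -/
theorem HopfMaps.antipode_comp {F E : C} {D : HopfMaps F} {D' : HopfMaps E} (hD : D.IsHopf)
    (hD' : D'.IsHopf) {Q : F ⟶ E} (map_mul : D.mul ≫ Q = (Q ⊗ₘ Q) ≫ D'.mul)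
    (map_one : D.one ≫ Q = D'.one) (map_comul : Q ≫ D'.comul = D.comul ≫ (Q ⊗ₘ Q))
    (map_counit : Q ≫ D'.counit = D.counit) : D.antipode ≫ Q = Q ≫ D'.antipode := by
  have h1 : D.comul ≫ ((D.antipode ≫ Q) ⊗ₘ Q) ≫ D'.mul = D.counit ≫ D'.one := by
    rw [← map_one, ← reassoc_of% hD.antipode_left, map_mul, ← tensorHom_id,
      tensorHom_comp_tensorHom_assoc, Category.id_comp]
  have h2 : D.comul ≫ (Q ⊗ₘ (Q ≫ D'.antipode)) ≫ D'.mul = D.counit ≫ D'.one := by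
    rw [← map_counit, Category.assoc, ← hD'.antipode_right, reassoc_of% map_comul, ← id_tensorHom,
      tensorHom_comp_tensorHom_assoc, Category.comp_id]
  set x := D.antipode ≫ Q with hx
  set y := Q ≫ D'.antipode with hy
  -- By `h1` and `h2`, `x` is a left and `y` a right convolution inverse of `Q`, so `x = x * (Q * y)
  -- = (x * Q) * y = y`.
  calc
    x = (ρ_ F).inv ≫ x ▷ 𝟙_ C ≫ E ◁ D'.one ≫ D'.mul := by rw [hD'.mul_one]; monoidal
    _ = D.comul ≫ F ◁ (D.counit ≫ D'.one) ≫ x ▷ E ≫ D'.mul := by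
      rw [whiskerLeft_comp, Category.assoc, reassoc_of% hD.comul_counit, whisker_exchange_assoc]
    _ = (D.comul ≫ F ◁ D.comul) ≫ (x ⊗ₘ (Q ⊗ₘ y)) ≫ E ◁ D'.mul ≫ D'.mul := by
      rw [← h2]
      simp only [MonoidalCategory.tensorHom_def']
      calc
        _ = D.comul ≫ F ◁ D.comul ≫ F ◁ F ◁ y ≫ F ◁ Q ▷ E ≫ (F ◁ D'.mul ≫ x ▷ E) ≫ D'.mul := by
          monoidal
        _ = _ := by rw [whisker_exchange]; monoidal
    _ = D.comul ≫ D.comul ▷ F ≫ ((x ⊗ₘ Q) ⊗ₘ y) ≫ D'.mul ▷ E ≫ D'.mul := by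
      rw [← hD.comul_assoc, hD'.mul_assoc, associator_naturality_assoc]
      simp only [Category.assoc]
    _ = D.comul ≫ (D.counit ≫ D'.one) ▷ F ≫ E ◁ y ≫ D'.mul := by
      rw [← h1]
      simp only [MonoidalCategory.tensorHom_def]
      calc
        _ = D.comul ≫ D.comul ▷ F ≫ x ▷ F ▷ F ≫ (E ◁ Q) ▷ F ≫ ((E ⊗ E) ◁ y ≫ D'.mul ▷ E) ≫
          D'.mul := by monoidal
        _ = _ := by rw [whisker_exchange]; monoidal
    _ = (λ_ F).inv ≫ 𝟙_ C ◁ y ≫ D'.one ▷ E ≫ D'.mul := by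
      rw [comp_whiskerRight, Category.assoc, reassoc_of% hD.counit_comul, whisker_exchange_assoc]
    _ = y := by rw [hD'.one_mul]; monoidal

variable [HasDuals C]

/-- The morphism from a universal coaction to a universal action which is given by the double
braiding is a morphism of Hopf algebras. -/
theorem HopfMaps.isHom_of_double_braiding {F E : C} {U : NaturalCoaction F} {U' : NaturalAction E}
    {D : HopfMaps F} {D' : HopfMaps E} (hD : U.Induces D) (hD' : U'.Induces D')
    (hU : U.Faithful) (hU' : U'.Faithful) {Q : F ⟶ E}
    (hQ : ∀ V W, U.coact V ▷ W ≫ (α_ V F W).hom ≫ V ◁ (Q ▷ W ≫ U'.act W) =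
      (β_ V W).hom ≫ (β_ W V).hom) : D.IsHom D' Q := by
  -- Tested against coactions of `V`, `V'` and the action on `W`: the left side gives the double
  -- braiding of `V ⊗ V'` with `W`. The hexagons wrap the double braiding of `V` with `W` inside the
  -- two braidings of `V'` with `W`, and naturality of the braiding lets them be replaced
  -- successively by `T`.
  have map_mul : D.mul ≫ Q = (Q ⊗ₘ Q) ≫ D'.mul := by
    refine hU'.ext fun W => (hU.detects_tensor hU.detects_coact) _ _ fun i => ?_
    obtain ⟨V, V'⟩ := i
    change U.coact₂ V V' ▷ W ≫ (α_ (V ⊗ V') (F ⊗ F) W).hom ≫ (V ⊗ V') ◁ _ =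
      U.coact₂ V V' ▷ W ≫ (α_ (V ⊗ V') (F ⊗ F) W).hom ≫ (V ⊗ V') ◁ _
    have hT := hQ V W
    have hT' := hQ V' W
    have h1 : ((Q ⊗ₘ Q) ≫ D'.mul) ▷ W ≫ U'.act W =
        (α_ F F W).hom ≫ F ◁ (Q ▷ W ≫ U'.act W) ≫ (Q ▷ W ≫ U'.act W) := by
      rw [comp_whiskerRight, Category.assoc, hD'.mul_act, MonoidalCategory.tensorHom_def']
      calc
        _ = 𝟙 _ ⊗≫ F ◁ Q ▷ W ⊗≫ (Q ▷ (E ⊗ W) ≫ E ◁ U'.act W) ≫ U'.act W := by monoidal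
        _ = _ := by rw [← whisker_exchange]; monoidal
    rw [h1]
    set T := Q ▷ W ≫ U'.act W with T_def
    have h3 := BraidedCategory.braiding_naturality_left T V'
    rw [BraidedCategory.braiding_tensor_left_hom] at h3
    calc
      _ = U.coact (V ⊗ V') ▷ W ≫ (α_ (V ⊗ V') F W).hom ≫ (V ⊗ V') ◁ (Q ▷ W ≫ U'.act W) := by
        rw [← hD.coact_mul]; monoidal
      _ = (β_ (V ⊗ V') W).hom ≫ (β_ W (V ⊗ V')).hom := hQ _ _
      _ = 𝟙 _ ⊗≫ V ◁ (β_ V' W).hom ⊗≫ ((β_ V W).hom ≫ (β_ W V).hom) ▷ V' ⊗≫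
          V ◁ (β_ W V').hom ⊗≫ 𝟙 _ := by
        rw [BraidedCategory.braiding_tensor_left_hom, BraidedCategory.braiding_tensor_right_hom]
        monoidal
      _ = 𝟙 _ ⊗≫ V ◁ (β_ V' W).hom ⊗≫ U.coact V ▷ (W ⊗ V') ⊗≫
          V ◁ (T ▷ V' ≫ (β_ W V').hom) ⊗≫ 𝟙 _ := by
        rw [← hT]; monoidal
      _ = 𝟙 _ ⊗≫ V ◁ (β_ V' W).hom ⊗≫ (U.coact V ▷ (W ⊗ V') ≫ (V ⊗ F) ◁ (β_ W V').hom) ⊗≫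
          V ◁ (β_ F V').hom ▷ W ⊗≫ (V ⊗ V') ◁ T ⊗≫ 𝟙 _ := by
        rw [h3]; monoidal
      _ = 𝟙 _ ⊗≫ V ◁ ((β_ V' W).hom ≫ (β_ W V').hom) ⊗≫ U.coact V ▷ (V' ⊗ W) ⊗≫
          V ◁ (β_ F V').hom ▷ W ⊗≫ (V ⊗ V') ◁ T ⊗≫ 𝟙 _ := by
        rw [← whisker_exchange]; monoidal
      _ = 𝟙 _ ⊗≫ V ◁ U.coact V' ▷ W ⊗≫ (V ◁ V' ◁ T ≫ U.coact V ▷ (V' ⊗ W)) ⊗≫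
          V ◁ (β_ F V').hom ▷ W ⊗≫ (V ⊗ V') ◁ T ⊗≫ 𝟙 _ := by
        rw [← hT']; monoidal
      _ = 𝟙 _ ⊗≫ (V ◁ U.coact V' ≫ U.coact V ▷ (V' ⊗ F)) ▷ W ⊗≫ V ◁ ((F ⊗ V') ◁ T ≫
          (β_ F V').hom ▷ W) ⊗≫ (V ⊗ V') ◁ T ⊗≫ 𝟙 _ := by
        rw [whisker_exchange (U.coact V)]; monoidal
      _ = _ := by
        rw [whisker_exchange (β_ F V').hom T, NaturalCoaction.coact₂, MonoidalCategory.tensorHom_def', tensorμ]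
        monoidal
  have map_one : D.one ≫ Q = D'.one := by
    refine hU'.ext fun W => ?_
    have h1 := hQ (𝟙_ C) W
    rw [hD.coact_one, braiding_tensorUnit_left, braiding_tensorUnit_right] at h1
    rw [hD'.one_act]
    calc
      _ = (λ_ W).hom ≫ (λ_ W).inv ≫ ((D.one ≫ (λ_ F).inv) ▷ W ≫ (α_ (𝟙_ C) F W).hom ≫
        𝟙_ C ◁ (Q ▷ W ≫ U'.act W)) ≫ (λ_ W).hom := by monoidal
      _ = _ := by rw [h1]; simp
  -- Tested against the coaction of `V` and the actions on `W`, `W'`: the action on `W ⊗ W'` gives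
  -- the double braiding of `V` with `W ⊗ W'`, now split by the hexagons in the second variable.
  have map_comul : Q ≫ D'.comul = D.comul ≫ (Q ⊗ₘ Q) := by
    refine hU'.ext₂ fun W W' => hU.detects_coact _ _ fun V => ?_
    have hT := hQ V W
    have hT' := hQ V W'
    have h1 : (Q ⊗ₘ Q) ▷ (W ⊗ W') ≫ U'.act₂ W W' = tensorμ F F W W' ≫
        ((Q ▷ W ≫ U'.act W) ⊗ₘ (Q ▷ W' ≫ U'.act W')) := by
      rw [NaturalAction.act₂, tensorμ_natural_left_assoc, tensorHom_comp_tensorHom]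
    rw [comp_whiskerRight, Category.assoc, hD'.comul_act, hQ, comp_whiskerRight, Category.assoc, h1]
    set T := Q ▷ W ≫ U'.act W with T_def
    set T' := Q ▷ W' ≫ U'.act W' with T_def'
    have h3 := BraidedCategory.braiding_naturality_left (U.coact V) W
    rw [BraidedCategory.braiding_tensor_left_hom] at h3
    symm
    calc
      _ = (U.coact V ≫ V ◁ D.comul) ▷ (W ⊗ W') ⊗≫ V ◁ tensorμ F F W W' ⊗≫
          V ◁ (T ⊗ₘ T') := by monoidal
      _ = 𝟙 _ ⊗≫ U.coact V ▷ W ▷ W' ⊗≫ (U.coact V ▷ (F ⊗ W) ≫ (V ⊗ F) ◁ (β_ F W).hom) ▷ W' ⊗≫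
          V ◁ T ▷ (F ⊗ W') ⊗≫ (V ⊗ W) ◁ T' ⊗≫ 𝟙 _ := by
        rw [hD.coact_comul, MonoidalCategory.tensorHom_def, tensorμ]; monoidal
      _ = 𝟙 _ ⊗≫ U.coact V ▷ W ▷ W' ⊗≫ V ◁ (β_ F W).hom ▷ W' ⊗≫
          (U.coact V ▷ W ≫ (α_ V F W).hom ≫ V ◁ T) ▷ (F ⊗ W') ⊗≫ (V ⊗ W) ◁ T' ⊗≫ 𝟙 _ := by
        rw [← whisker_exchange]; monoidal
      _ = 𝟙 _ ⊗≫ (U.coact V ▷ W ≫ (α_ V F W).hom ≫ V ◁ (β_ F W).hom ≫ (α_ V W F).inv ≫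
          (β_ V W).hom ▷ F ≫ (α_ W V F).hom) ▷ W' ⊗≫ ((β_ W V).hom ▷ (F ⊗ W') ≫
          (V ⊗ W) ◁ T') ⊗≫ 𝟙 _ := by
        rw [hT]; monoidal
      _ = 𝟙 _ ⊗≫ (β_ V W).hom ▷ W' ⊗≫ W ◁ (U.coact V ▷ W' ≫ (α_ V F W').hom ≫ V ◁ T') ⊗≫
          (β_ W V).hom ▷ W' ⊗≫ 𝟙 _ := by
        rw [h3, ← whisker_exchange]; monoidal
      _ = _ := by
        rw [hT', BraidedCategory.braiding_tensor_left_hom,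
          BraidedCategory.braiding_tensor_right_hom]
        monoidal
  -- The double braiding with the unit object is trivial.
  have map_counit : Q ≫ D'.counit = D.counit := by
    refine hU.ext fun V => ?_
    have h1 := hQ V (𝟙_ C)
    rw [hD'.counit_act, braiding_tensorUnit_left, braiding_tensorUnit_right] at h1
    rw [hD.coact_counit]
    calc
      _ = (ρ_ V).inv ≫ (U.coact V ▷ 𝟙_ C ≫ (α_ V F (𝟙_ C)).hom ≫
        V ◁ (Q ▷ 𝟙_ C ≫ (ρ_ E).hom ≫ D'.counit)) := by monoidal
      _ = _ := by rw [h1]; simp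
  exact ⟨map_mul, map_one, map_comul, map_counit, HopfMaps.antipode_comp (hD.isHopf hU)
    (hD'.isHopf hU') map_mul map_one map_comul map_counit⟩

end Transmutation

end

section

open CategoryTheory MonoidalCategory

/-! ### Actions and coactions in terms of duals -/

section Duals

universe v₁ u₁

set_option linter.unusedSectionVars false

variable {C : Type u₁} [Category.{v₁} C] [MonoidalCategory C] [HasDuals C]

/-- The canonical morphism from the tensor product of the duals to the dual of the tensor product. -/
def dualTensor (V W : C) : lDual W ⊗ lDual V ⟶ (lDual (V ⊗ W)) :=
  (ρ_ _).inv ≫ (lDual W ⊗ lDual V) ◁ η_ (V ⊗ W) (lDual (V ⊗ W)) ≫ (α_ _ _ _).inv ≫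
    ε_ (V ⊗ W) (lDual W ⊗ lDual V) ▷ (lDual (V ⊗ W)) ≫ (λ_ _).hom

/-- The canonical morphism from the dual of the tensor product to the tensor product of the duals. -/
def dualTensorInv (V W : C) : (lDual (V ⊗ W)) ⟶ lDual W ⊗ lDual V :=
  (ρ_ _).inv ≫ (lDual (V ⊗ W)) ◁ η_ (V ⊗ W) (lDual W ⊗ lDual V) ≫ (α_ _ _ _).inv ≫
    ε_ (V ⊗ W) (lDual (V ⊗ W)) ▷ (lDual W ⊗ lDual V) ≫ (λ_ _).hom

/-- Transport of evaluations along the comparison of two duals. -/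
theorem comparison_evaluation (X Y Z : C) [ExactPairing X Y] [ExactPairing X Z] :
    ((ρ_ Z).inv ≫ Z ◁ η_ X Y ≫ (α_ _ _ _).inv ≫ ε_ X Z ▷ Y ≫ (λ_ _).hom) ▷ X ≫ ε_ X Y =
      ε_ X Z := by
  calc
    _ = 𝟙 _ ⊗≫ Z ◁ η_ X Y ▷ X ⊗≫ (ε_ X Z ▷ (Y ⊗ X) ≫ 𝟙_ C ◁ ε_ X Y) ⊗≫ 𝟙 _ := by monoidal
    _ = 𝟙 _ ⊗≫ Z ◁ (η_ X Y ▷ X ⊗≫ X ◁ ε_ X Y) ⊗≫ ε_ X Z ⊗≫ 𝟙 _ := by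
      rw [← whisker_exchange]; monoidal
    _ = _ := by rw [ExactPairing.evaluation_coevaluation'']; monoidal

/-- Transport of coevaluations along the comparison of two duals. -/
theorem coevaluation_comparison (X Y Z : C) [ExactPairing X Y] [ExactPairing X Z] :
    η_ X Z ≫ X ◁ ((ρ_ Z).inv ≫ Z ◁ η_ X Y ≫ (α_ _ _ _).inv ≫ ε_ X Z ▷ Y ≫ (λ_ _).hom) =
      η_ X Y := by
  calc
    _ = 𝟙 _ ⊗≫ (η_ X Z ▷ 𝟙_ C ≫ (X ⊗ Z) ◁ η_ X Y) ⊗≫ X ◁ ε_ X Z ▷ Y ⊗≫ 𝟙 _ := by monoidal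
    _ = 𝟙 _ ⊗≫ η_ X Y ⊗≫ (η_ X Z ▷ X ⊗≫ X ◁ ε_ X Z) ▷ Y ⊗≫ 𝟙 _ := by
      rw [← whisker_exchange]; monoidal
    _ = _ := by rw [ExactPairing.evaluation_coevaluation'']; monoidal

theorem dualTensor_evaluation (V W : C) :
    dualTensor V W ▷ (V ⊗ W) ≫ ε_ (V ⊗ W) (lDual (V ⊗ W)) = ε_ (V ⊗ W) (lDual W ⊗ lDual V) :=
  comparison_evaluation _ _ _

theorem dualTensorInv_evaluation (V W : C) :
    dualTensorInv V W ▷ (V ⊗ W) ≫ ε_ (V ⊗ W) (lDual W ⊗ lDual V) = ε_ (V ⊗ W) (lDual (V ⊗ W)) :=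
  comparison_evaluation _ _ _

theorem coevaluation_dualTensor (V W : C) :
    η_ (V ⊗ W) (lDual W ⊗ lDual V) ≫ (V ⊗ W) ◁ dualTensor V W = η_ (V ⊗ W) (lDual (V ⊗ W)) :=
  coevaluation_comparison _ _ _

/-- The dual of a morphism is characterised by the evaluations. -/
theorem dualHom_unique {V W : C} {f : V ⟶ W} {g : lDual W ⟶ (lDual V)}
    (h : g ▷ V ≫ ε_ V (lDual V) = lDual W ◁ f ≫ ε_ W (lDual W)) : dualHom f = g := by
  have key : ∀ g : lDual W ⟶ (lDual V), g = 𝟙 _ ⊗≫ lDual W ◁ η_ V (lDual V) ⊗≫ (g ▷ V ≫ ε_ V (lDual V)) ▷ lDual V ⊗≫ 𝟙 _ := by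
    intro g
    symm
    calc
      _ = 𝟙 _ ⊗≫ (lDual W ◁ η_ V (lDual V) ≫ g ▷ (V ⊗ lDual V)) ⊗≫ ε_ V (lDual V) ▷ lDual V ⊗≫ 𝟙 _ := by monoidal
      _ = 𝟙 _ ⊗≫ g ⊗≫ (lDual V ◁ η_ V (lDual V) ⊗≫ ε_ V (lDual V) ▷ lDual V) ⊗≫ 𝟙 _ := by
        rw [whisker_exchange]; monoidal
      _ = _ := by rw [ExactPairing.coevaluation_evaluation'']; monoidal
  rw [key (dualHom f), key g, h, dualHom_evaluation]

/-- The evaluation `(V ⊗ lDual V) ⊗ V ⟶ V`. -/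
def evalRight (V : C) : (V ⊗ lDual V) ⊗ V ⟶ V :=
  (α_ _ _ _).hom ≫ V ◁ ε_ V (lDual V) ≫ (ρ_ V).hom

/-- An extranatural family of morphisms `E ⟶ V ⊗ lDual V`. -/
structure EndFamily (E : C) where
  map : ∀ V : C, E ⟶ V ⊗ lDual V
  extranatural : ∀ {V W : C} (f : V ⟶ W), map V ≫ f ▷ lDual V = map W ≫ W ◁ dualHom f

/-- The natural action given by an extranatural family. -/
def EndFamily.action {E : C} (r : EndFamily E) : NaturalAction E where
  act V := r.map V ▷ V ≫ evalRight V
  natural {V W} f := by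
    calc
      _ = 𝟙 _ ⊗≫ r.map W ▷ V ⊗≫ W ◁ (lDual W ◁ f ≫ ε_ W (lDual W)) ⊗≫ 𝟙 _ := by
        rw [evalRight]
        calc
          _ = 𝟙 _ ⊗≫ (E ◁ f ≫ r.map W ▷ W) ⊗≫ W ◁ ε_ W (lDual W) ⊗≫ 𝟙 _ := by monoidal
          _ = _ := by rw [whisker_exchange]; monoidal
      _ = 𝟙 _ ⊗≫ (r.map W ≫ W ◁ dualHom f) ▷ V ⊗≫ W ◁ ε_ V (lDual V) ⊗≫ 𝟙 _ := by
        rw [← dualHom_evaluation]; monoidal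
      _ = 𝟙 _ ⊗≫ r.map V ▷ V ⊗≫ (f ▷ (lDual V ⊗ V) ≫ W ◁ ε_ V (lDual V)) ⊗≫ 𝟙 _ := by
        rw [← r.extranatural]; monoidal
      _ = _ := by rw [← whisker_exchange, evalRight]; monoidal

/-- A dinatural family of morphisms `lDual V ⊗ V ⟶ F`. -/
structure CoendFamily (F : C) where
  map : ∀ V : C, lDual V ⊗ V ⟶ F
  dinatural : ∀ {V W : C} (f : V ⟶ W), dualHom f ▷ V ≫ map V = lDual W ◁ f ≫ map W

/-- The coevaluation `V ⟶ V ⊗ (lDual V ⊗ V)`. -/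
def coevalRight (V : C) : V ⟶ V ⊗ (lDual V ⊗ V) :=
  (λ_ V).inv ≫ η_ V (lDual V) ▷ V ≫ (α_ _ _ _).hom

/-- The natural coaction given by a dinatural family. -/
def CoendFamily.coaction {F : C} (i : CoendFamily F) : NaturalCoaction F where
  coact V := coevalRight V ≫ V ◁ i.map V
  natural {V W} f := by
    calc
      _ = 𝟙 _ ⊗≫ (𝟙_ C ◁ f ≫ η_ W (lDual W) ▷ W) ⊗≫ W ◁ i.map W ⊗≫ 𝟙 _ := by
        rw [coevalRight]; monoidal
      _ = 𝟙 _ ⊗≫ η_ W (lDual W) ▷ V ⊗≫ W ◁ (lDual W ◁ f ≫ i.map W) ⊗≫ 𝟙 _ := by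
        rw [whisker_exchange]; monoidal
      _ = 𝟙 _ ⊗≫ (η_ W (lDual W) ≫ W ◁ dualHom f) ▷ V ⊗≫ W ◁ i.map V ⊗≫ 𝟙 _ := by
        rw [← i.dinatural]; monoidal
      _ = 𝟙 _ ⊗≫ η_ V (lDual V) ▷ V ⊗≫ (f ▷ (lDual V ⊗ V) ≫ W ◁ i.map V) ⊗≫ 𝟙 _ := by
        rw [coevaluation_dualHom]; monoidal
      _ = _ := by rw [← whisker_exchange, coevalRight]; monoidal

variable [BraidedCategory C]

namespace EndFamily

variable {E : C} (r : EndFamily E)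

/-- A member of the family and its action are mates under the duality between `V` and `V*`, so
either determines the other. -/
theorem map_eq (V : C) :
    r.map V = (ρ_ E).inv ≫ E ◁ η_ V (lDual V) ≫ (α_ _ _ _).inv ≫ r.action.act V ▷ lDual V := by
  symm
  calc
    _ = 𝟙 _ ⊗≫ (E ◁ η_ V (lDual V) ≫ r.map V ▷ (V ⊗ lDual V)) ⊗≫ V ◁ ε_ V (lDual V) ▷ lDual V ⊗≫ 𝟙 _ := by
      simp only [action, evalRight]; monoidal
    _ = 𝟙 _ ⊗≫ r.map V ⊗≫ V ◁ (lDual V ◁ η_ V (lDual V) ⊗≫ ε_ V (lDual V) ▷ lDual V) ⊗≫ 𝟙 _ := by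
      rw [whisker_exchange]; monoidal
    _ = _ := by rw [ExactPairing.coevaluation_evaluation'']; monoidal

/-- The family is recovered from the probe by bending `V` back with a coevaluation; naturality of
the braiding of `Y` past `V ⊗ V*` disposes of the braiding in the probe. -/
theorem comp_map_eq_probe {X Y : C} (φ : X ⟶ E ⊗ Y) (V : C) :
    φ ≫ r.map V ▷ Y = 𝟙 _ ⊗≫ X ◁ η_ V (lDual V) ⊗≫ r.action.probe φ V ▷ lDual V ⊗≫
      V ◁ (β_ Y (lDual V)).hom ⊗≫ 𝟙 _ := by
  have h1 := BraidedCategory.braiding_naturality_right Y (η_ V (lDual V))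
  rw [BraidedCategory.braiding_tensor_right_hom, braiding_tensorUnit_right] at h1
  symm
  calc
    _ = 𝟙 _ ⊗≫ (X ◁ η_ V (lDual V) ≫ φ ▷ (V ⊗ lDual V)) ⊗≫ E ◁ (β_ Y V).hom ▷ lDual V ⊗≫
        (r.action.act V ▷ (Y ⊗ lDual V) ≫ V ◁ (β_ Y (lDual V)).hom) ⊗≫ 𝟙 _ := by
      rw [NaturalAction.probe]; monoidal
    _ = 𝟙 _ ⊗≫ φ ⊗≫ E ◁ (Y ◁ η_ V (lDual V) ≫ ((α_ Y V (lDual V)).inv ≫ (β_ Y V).hom ▷ lDual V ≫ (α_ V Y (lDual V)).hom ≫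
        V ◁ (β_ Y (lDual V)).hom ≫ (α_ V (lDual V) Y).inv)) ⊗≫ r.action.act V ▷ (lDual V ⊗ Y) ⊗≫ 𝟙 _ := by
      rw [whisker_exchange, ← whisker_exchange (r.action.act V)]; monoidal
    _ = _ := by rw [h1, map_eq]; monoidal

/-- A single object whose family member stays monic after tensoring already detects everything. -/
theorem faithful (V : C) [∀ Y : C, Mono (r.map V ▷ Y)] : r.action.Faithful := by
  intro X Y φ ψ h
  rw [← cancel_mono (r.map V ▷ Y), comp_map_eq_probe, comp_map_eq_probe, h]

/-- The composition `(V ⊗ lDual V) ⊗ (V ⊗ lDual V) ⟶ V ⊗ lDual V`. -/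
def compMap (V : C) : (V ⊗ lDual V) ⊗ (V ⊗ lDual V) ⟶ V ⊗ lDual V :=
  (α_ _ _ _).hom ≫ V ◁ (α_ _ _ _).inv ≫ V ◁ (ε_ V (lDual V) ▷ lDual V) ≫ V ◁ (λ_ _).hom

/-- The rearrangement `(V ⊗ W) ⊗ (lDual W ⊗ lDual V) ⟶ (V ⊗ lDual V) ⊗ (W ⊗ lDual W)`. -/
def shuffle (V W : C) : (V ⊗ W) ⊗ (lDual W ⊗ lDual V) ⟶ (V ⊗ lDual V) ⊗ (W ⊗ lDual W) :=
  (α_ _ _ _).hom ≫ V ◁ (α_ _ _ _).inv ≫ V ◁ (β_ (W ⊗ lDual W) (lDual V)).hom ≫ (α_ _ _ _).inv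

/-- The shuffle carries `W ⊗ W*` past `V*`; the evaluation of `V` then absorbs the further braiding
past `V` that comes from `tensorμ`, so that only the nested evaluation of `V ⊗ W` remains. -/
theorem shuffle_eval (V W : C) :
    shuffle V W ▷ (V ⊗ W) ≫ tensorμ (V ⊗ lDual V) (W ⊗ lDual W) V W ≫ (evalRight V ⊗ₘ evalRight W) =
      (α_ _ _ _).hom ≫ (V ⊗ W) ◁ ε_ (V ⊗ W) (lDual W ⊗ lDual V) ≫ (ρ_ _).hom := by
  have h1 := BraidedCategory.braiding_naturality_right (W ⊗ lDual W) (ε_ V (lDual V))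
  rw [BraidedCategory.braiding_tensor_right_hom, braiding_tensorUnit_right] at h1
  rw [ExactPairing.tensor_evaluation]
  symm
  calc
    _ = 𝟙 _ ⊗≫ V ◁ ((W ⊗ lDual W) ◁ ε_ V (lDual V) ≫ (ρ_ _).hom ≫ (λ_ _).inv) ▷ W ⊗≫
        (V ⊗ W) ◁ ε_ W (lDual W) ⊗≫ 𝟙 _ := by monoidal
    _ = 𝟙 _ ⊗≫ V ◁ (β_ (W ⊗ lDual W) (lDual V)).hom ▷ (V ⊗ W) ⊗≫ (V ⊗ lDual V) ◁ (β_ (W ⊗ lDual W) V).hom ▷ W ⊗≫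
        (V ◁ ε_ V (lDual V) ≫ (ρ_ _).hom) ▷ ((W ⊗ lDual W) ⊗ W) ⊗≫ V ◁ W ◁ ε_ W (lDual W) ⊗≫ 𝟙 _ := by
      rw [h1]; monoidal
    _ = _ := by
      rw [shuffle, tensorμ, evalRight, evalRight, MonoidalCategory.tensorHom_def]
      monoidal

/-- Structure maps on `E` which are compatible with the family of morphisms `E ⟶ V ⊗ lDual V`. -/
structure Compatible (D : HopfMaps E) : Prop where
  mul_map : ∀ V, D.mul ≫ r.map V = (r.map V ⊗ₘ r.map V) ≫ compMap V
  one_map : ∀ V, D.one ≫ r.map V = η_ V (lDual V)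
  comul_map : ∀ V W, D.comul ≫ (r.map V ⊗ₘ r.map W) =
    r.map (V ⊗ W) ≫ (V ⊗ W) ◁ dualTensorInv V W ≫ shuffle V W
  map_unit : r.map (𝟙_ C) = D.counit ≫ η_ (𝟙_ C) (lDual (𝟙_ C))
  antipode_map : ∀ V, D.antipode ≫ r.map V = (ρ_ E).inv ≫ E ◁ η_ V (lDual V) ≫ (α_ _ _ _).inv ≫
    (β_ E V).hom ▷ lDual V ≫ (α_ _ _ _).hom ≫ V ◁ r.action.act (lDual V)

variable {r}

/-- Bending `V*` to the right turns each compatibility with the family `E ⟶ V ⊗ V*` into the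
corresponding statement on actions. The former are the conditions accessible to computation with
elements. -/
theorem Compatible.induces {D : HopfMaps E} (h : r.Compatible D) : r.action.Induces D where
  mul_act V := by
    calc
      _ = (D.mul ≫ r.map V) ▷ V ≫ evalRight V := by simp only [action]; monoidal
      _ = 𝟙 _ ⊗≫ r.map V ▷ (E ⊗ V) ⊗≫ (V ⊗ lDual V) ◁ r.map V ▷ V ⊗≫ V ◁ (ε_ V (lDual V) ▷ (lDual V ⊗ V) ≫
          𝟙_ C ◁ ε_ V (lDual V)) ⊗≫ 𝟙 _ := by
        rw [h.mul_map, compMap, MonoidalCategory.tensorHom_def, evalRight]; monoidal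
      _ = 𝟙 _ ⊗≫ (r.map V ▷ (E ⊗ V) ≫ (V ⊗ lDual V) ◁ (r.map V ▷ V ≫ evalRight V)) ⊗≫
          evalRight V ⊗≫ 𝟙 _ := by
        rw [← whisker_exchange, evalRight]; monoidal
      _ = _ := by rw [← whisker_exchange, action]; monoidal
  one_act V := by
    calc
      _ = (D.one ≫ r.map V) ▷ V ≫ evalRight V := by simp only [action]; monoidal
      _ = η_ V (lDual V) ▷ V ⊗≫ V ◁ ε_ V (lDual V) ⊗≫ 𝟙 _ := by rw [h.one_map, evalRight]; monoidal
      _ = 𝟙 _ ⊗≫ (η_ V (lDual V) ▷ V ⊗≫ V ◁ ε_ V (lDual V)) ⊗≫ 𝟙 _ := by monoidal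
      _ = _ := by rw [ExactPairing.evaluation_coevaluation'']; monoidal
  comul_act V W := by
    calc
      _ = (D.comul ≫ (r.map V ⊗ₘ r.map W)) ▷ (V ⊗ W) ≫ tensorμ (V ⊗ lDual V) (W ⊗ lDual W) V W ≫
          (evalRight V ⊗ₘ evalRight W) := by
        rw [NaturalAction.act₂, comp_whiskerRight, Category.assoc, tensorμ_natural_left_assoc]
        simp only [action, tensorHom_comp_tensorHom]
      _ = r.map (V ⊗ W) ▷ (V ⊗ W) ⊗≫ (V ⊗ W) ◁ (dualTensorInv V W ▷ (V ⊗ W) ≫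
          ε_ (V ⊗ W) (lDual W ⊗ lDual V)) ⊗≫ 𝟙 _ := by
        rw [h.comul_map, comp_whiskerRight, comp_whiskerRight, Category.assoc, Category.assoc,
          shuffle_eval]
        monoidal
      _ = _ := by rw [dualTensorInv_evaluation]; simp only [action, evalRight]; monoidal
  counit_act := by
    simp only [action, h.map_unit, evalRight]
    calc
      _ = 𝟙 _ ⊗≫ D.counit ⊗≫ (η_ (𝟙_ C) (lDual (𝟙_ C)) ▷ 𝟙_ C ≫ (α_ _ _ _).hom ≫ 𝟙_ C ◁ ε_ (𝟙_ C) (lDual (𝟙_ C))) ⊗≫ 𝟙 _ := by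
        monoidal
      _ = _ := by rw [ExactPairing.evaluation_coevaluation]; monoidal
  antipode_act V := by
    calc
      _ = (D.antipode ≫ r.map V) ▷ V ≫ evalRight V := by simp only [action]; monoidal
      _ = _ := by rw [h.antipode_map, evalRight]; monoidal

end EndFamily

namespace CoendFamily

variable {F : C} (i : CoendFamily F)

theorem map_eq (V : C) :
    i.map V = lDual V ◁ i.coaction.coact V ≫ (α_ _ _ _).inv ≫ ε_ V (lDual V) ▷ F ≫ (λ_ F).hom := by
  symm
  calc
    _ = 𝟙 _ ⊗≫ lDual V ◁ η_ V (lDual V) ▷ V ⊗≫ ((lDual V ⊗ V) ◁ i.map V ≫ ε_ V (lDual V) ▷ F) ⊗≫ 𝟙 _ := by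
      simp only [coaction, coevalRight]; monoidal
    _ = 𝟙 _ ⊗≫ (lDual V ◁ η_ V (lDual V) ⊗≫ ε_ V (lDual V) ▷ lDual V) ▷ V ⊗≫ i.map V ⊗≫ 𝟙 _ := by
      rw [whisker_exchange]; monoidal
    _ = _ := by rw [ExactPairing.coevaluation_evaluation'']; monoidal

/-- Dual to `EndFamily.comp_map_eq_probe`: the matrix coefficients are recovered from the coaction
by an evaluation. -/
theorem map_comp_eq_probe {X Y : C} (φ : Y ⊗ F ⟶ X) (V : C) :
    Y ◁ i.map V ≫ φ = 𝟙 _ ⊗≫ (β_ Y (lDual V)).hom ▷ V ⊗≫ lDual V ◁ i.coaction.probe φ V ⊗≫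
      ε_ V (lDual V) ▷ X ⊗≫ 𝟙 _ := by
  have h1 := BraidedCategory.braiding_naturality_right Y (ε_ V (lDual V))
  rw [BraidedCategory.braiding_tensor_right_hom, braiding_tensorUnit_right] at h1
  symm
  calc
    _ = 𝟙 _ ⊗≫ ((β_ Y (lDual V)).hom ▷ V ≫ (lDual V ⊗ Y) ◁ i.coaction.coact V) ⊗≫
        lDual V ◁ (β_ Y V).hom ▷ F ⊗≫ ((lDual V ⊗ V) ◁ φ ≫ ε_ V (lDual V) ▷ X) ⊗≫ 𝟙 _ := by
      rw [NaturalCoaction.probe]; monoidal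
    _ = 𝟙 _ ⊗≫ Y ◁ lDual V ◁ i.coaction.coact V ⊗≫ (((α_ Y (lDual V) V).inv ≫ (β_ Y (lDual V)).hom ▷ V ≫
        (α_ (lDual V) Y V).hom ≫ lDual V ◁ (β_ Y V).hom ≫ (α_ (lDual V) V Y).inv) ≫ ε_ V (lDual V) ▷ Y) ▷ F ⊗≫ φ := by
      rw [whisker_exchange, ← whisker_exchange (β_ Y (lDual V)).hom]; monoidal
    _ = _ := by rw [← h1, map_eq]; monoidal

theorem faithful (V : C) [∀ Y : C, Epi (Y ◁ i.map V)] : i.coaction.Faithful := by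
  intro X Y φ ψ h
  rw [← cancel_epi (Y ◁ i.map V), map_comp_eq_probe, map_comp_eq_probe, h]

/-- The rearrangement `(lDual V ⊗ V) ⊗ (lDual W ⊗ W) ⟶ (lDual V ⊗ lDual W) ⊗ (V ⊗ W)`. -/
def shuffle (V W : C) : (lDual V ⊗ V) ⊗ (lDual W ⊗ W) ⟶ (lDual V ⊗ lDual W) ⊗ (V ⊗ W) :=
  (α_ _ _ _).hom ≫ lDual V ◁ (α_ _ _ _).inv ≫ lDual V ◁ (β_ V (lDual W)).hom ▷ W ≫ lDual V ◁ (α_ _ _ _).hom ≫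
    (α_ _ _ _).inv

/-- The cocomposition `lDual V ⊗ V ⟶ (lDual V ⊗ V) ⊗ (lDual V ⊗ V)`. -/
def cocompMap (V : C) : lDual V ⊗ V ⟶ (lDual V ⊗ V) ⊗ (lDual V ⊗ V) :=
  lDual V ◁ coevalRight V ≫ (α_ _ _ _).inv

/-- Structure maps on `F` which are compatible with the family of morphisms `lDual V ⊗ V ⟶ F`. -/
structure Compatible (D : HopfMaps F) : Prop where
  map_mul : ∀ V W, (i.map V ⊗ₘ i.map W) ≫ D.mul =
    shuffle V W ≫ (dualTensor W V ≫ dualHom (β_ V W).hom) ▷ (V ⊗ W) ≫ i.map (V ⊗ W)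
  map_unit : i.map (𝟙_ C) = ε_ (𝟙_ C) (lDual (𝟙_ C)) ≫ D.one
  map_comul : ∀ V, i.map V ≫ D.comul = cocompMap V ≫ (i.map V ⊗ₘ i.map V)
  map_counit : ∀ V, i.map V ≫ D.counit = ε_ V (lDual V)
  map_antipode : ∀ V, i.map V ≫ D.antipode = i.coaction.coact (lDual V) ▷ V ≫ (β_ F (lDual V)).inv ▷ V ≫
    (α_ _ _ _).hom ≫ F ◁ ε_ V (lDual V) ≫ (ρ_ F).hom

variable {i}

theorem Compatible.induces {D : HopfMaps F} (h : i.Compatible D) : i.coaction.Induces D where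
  coact_mul V W := by
    -- The compatibility for products involves the dual of a braiding, that is, the coaction of `W ⊗
    -- V`. Composing with the invertible braiding and using naturality of the coaction makes that
    -- coaction appear on both sides.
    have h1 := i.coaction.natural (β_ V W).hom
    have h2 := BraidedCategory.braiding_naturality_right V (coevalRight W)
    have h3 := BraidedCategory.braiding_naturality_left (η_ V (lDual V)) W
    rw [braiding_tensorUnit_left] at h3
    rw [← cancel_mono ((β_ V W).hom ▷ F), ← h1]
    calc
      _ = ((coevalRight V ⊗ₘ coevalRight W) ≫ tensorμ V (lDual V ⊗ V) W (lDual W ⊗ W) ≫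
          (V ⊗ W) ◁ ((i.map V ⊗ₘ i.map W) ≫ D.mul)) ≫ (β_ V W).hom ▷ F := by
        rw [whiskerLeft_comp, reassoc_of% (tensorμ_comp_whiskerLeft_tensorHom V W (i.map V)),
          tensorHom_comp_tensorHom_assoc, NaturalCoaction.coact₂]
        simp only [coaction, Category.assoc]
      _ = (coevalRight V ⊗ₘ coevalRight W) ≫ tensorμ V (lDual V ⊗ V) W (lDual W ⊗ W) ⊗≫
          (V ⊗ W) ◁ (shuffle V W ⊗≫ lDual V ◁ lDual W ◁ (β_ V W).hom ⊗≫
            dualTensor W V ▷ (W ⊗ V)) ⊗≫ ((V ⊗ W) ◁ i.map (W ⊗ V) ≫ (β_ V W).hom ▷ F) := by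
        rw [h.map_mul, comp_whiskerRight, Category.assoc (dualTensor W V ▷ _), i.dinatural,
          ← whisker_exchange_assoc (dualTensor W V)]
        monoidal
      _ = (coevalRight V ⊗ₘ coevalRight W) ≫ tensorμ V (lDual V ⊗ V) W (lDual W ⊗ W) ⊗≫
          ((V ⊗ W) ◁ (shuffle V W ⊗≫ lDual V ◁ lDual W ◁ (β_ V W).hom ⊗≫
            dualTensor W V ▷ (W ⊗ V)) ≫ (β_ V W).hom ▷ (lDual (W ⊗ V) ⊗ (W ⊗ V))) ⊗≫
            (W ⊗ V) ◁ i.map (W ⊗ V) := by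
        rw [whisker_exchange (β_ V W).hom (i.map (W ⊗ V))]; monoidal
      _ = 𝟙 _ ⊗≫ (coevalRight V ▷ W ≫ (V ⊗ (lDual V ⊗ V)) ◁ coevalRight W) ⊗≫
          (V ⊗ lDual V) ◁ (β_ V W).hom ▷ (lDual W ⊗ W) ⊗≫
          V ◁ (β_ (lDual V) W).hom ▷ (V ⊗ (lDual W ⊗ W)) ⊗≫
          ((β_ V W).hom ▷ (lDual V ⊗ (V ⊗ (lDual W ⊗ W))) ≫
          (W ⊗ V) ◁ (lDual V ◁ (β_ V (lDual W ⊗ W)).hom)) ⊗≫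
          (W ⊗ V) ◁ dualTensor W V ▷ (W ⊗ V) ⊗≫ (W ⊗ V) ◁ i.map (W ⊗ V) := by
        rw [whisker_exchange, MonoidalCategory.tensorHom_def, tensorμ, shuffle,
          BraidedCategory.braiding_tensor_left_hom, BraidedCategory.braiding_tensor_right_hom]
        monoidal
      _ = 𝟙 _ ⊗≫ (coevalRight V ▷ W ≫ (V ⊗ (lDual V ⊗ V)) ◁ coevalRight W) ⊗≫
          (V ⊗ lDual V) ◁ (β_ V W).hom ▷ (lDual W ⊗ W) ⊗≫
          (β_ (V ⊗ lDual V) W).hom ▷ (V ⊗ (lDual W ⊗ W)) ⊗≫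
          (W ⊗ V) ◁ (lDual V ◁ (β_ V (lDual W ⊗ W)).hom) ⊗≫
          (W ⊗ V) ◁ dualTensor W V ▷ (W ⊗ V) ⊗≫ (W ⊗ V) ◁ i.map (W ⊗ V) := by
        rw [BraidedCategory.braiding_tensor_left_hom V (lDual V)]
        monoidal
      _ = 𝟙 _ ⊗≫ (coevalRight V ▷ W ≫ (V ⊗ (lDual V ⊗ V)) ◁ coevalRight W) ⊗≫
          (V ⊗ lDual V) ◁ (β_ V W).hom ▷ (lDual W ⊗ W) ⊗≫
          ((V ⊗ lDual V) ◁ W ◁ (β_ V (lDual W ⊗ W)).hom ≫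
            (α_ _ _ _).inv ≫ (β_ (V ⊗ lDual V) W).hom ▷ ((lDual W ⊗ W) ⊗ V)) ⊗≫
          (W ⊗ V) ◁ dualTensor W V ▷ (W ⊗ V) ⊗≫ (W ⊗ V) ◁ i.map (W ⊗ V) := by
        rw [associator_inv_naturality_right_assoc,
          whisker_exchange (β_ (V ⊗ lDual V) W).hom (β_ V (lDual W ⊗ W)).hom]
        monoidal
      _ = 𝟙 _ ⊗≫ η_ V (lDual V) ▷ (V ⊗ W) ⊗≫
          (V ⊗ lDual V) ◁ (V ◁ coevalRight W ≫ (β_ V (W ⊗ (lDual W ⊗ W))).hom) ⊗≫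
          (β_ (V ⊗ lDual V) W).hom ▷ ((lDual W ⊗ W) ⊗ V) ⊗≫
          (W ⊗ V) ◁ dualTensor W V ▷ (W ⊗ V) ⊗≫ (W ⊗ V) ◁ i.map (W ⊗ V) := by
        rw [BraidedCategory.braiding_tensor_right_hom V W, coevalRight]
        monoidal
      _ = 𝟙 _ ⊗≫ (η_ V (lDual V) ▷ (V ⊗ W) ≫
          (V ⊗ lDual V) ◁ ((β_ V W).hom ≫ coevalRight W ▷ V)) ⊗≫
          (β_ (V ⊗ lDual V) W).hom ▷ ((lDual W ⊗ W) ⊗ V) ⊗≫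
          (W ⊗ V) ◁ dualTensor W V ▷ (W ⊗ V) ⊗≫ (W ⊗ V) ◁ i.map (W ⊗ V) := by
        rw [h2]; monoidal
      _ = 𝟙 _ ⊗≫ (β_ V W).hom ⊗≫ coevalRight W ▷ V ⊗≫
          (η_ V (lDual V) ▷ W ≫ (β_ (V ⊗ lDual V) W).hom) ▷ ((lDual W ⊗ W) ⊗ V) ⊗≫
          (W ⊗ V) ◁ dualTensor W V ▷ (W ⊗ V) ⊗≫ (W ⊗ V) ◁ i.map (W ⊗ V) := by
        rw [← whisker_exchange]; monoidal
      _ = (β_ V W).hom ⊗≫ (η_ (W ⊗ V) (lDual V ⊗ lDual W) ≫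
          (W ⊗ V) ◁ dualTensor W V) ▷ (W ⊗ V) ⊗≫ (W ⊗ V) ◁ i.map (W ⊗ V) := by
        rw [h3, ExactPairing.tensor_coevaluation, coevalRight]; monoidal
      _ = _ := by rw [coevaluation_dualTensor]; simp only [coaction, coevalRight]; monoidal
  coact_one := by
    calc
      _ = 𝟙 _ ⊗≫ (η_ (𝟙_ C) (lDual (𝟙_ C)) ▷ 𝟙_ C ≫ (α_ _ _ _).hom ≫ 𝟙_ C ◁ ε_ (𝟙_ C) (lDual (𝟙_ C))) ⊗≫ D.one ⊗≫ 𝟙 _ := by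
        simp only [coaction, h.map_unit, coevalRight]; monoidal
      _ = _ := by rw [ExactPairing.evaluation_coevaluation]; monoidal
  coact_comul V := by
    calc
      _ = coevalRight V ≫ V ◁ (i.map V ≫ D.comul) := by simp only [coaction]; monoidal
      _ = 𝟙 _ ⊗≫ (η_ V (lDual V) ▷ V ≫ (V ⊗ lDual V) ◁ coevalRight V) ⊗≫ V ◁ (i.map V ⊗ₘ i.map V) := by
        rw [h.map_comul, cocompMap, coevalRight]; monoidal
      _ = coevalRight V ⊗≫ coevalRight V ▷ (lDual V ⊗ V) ⊗≫ V ◁ (i.map V ⊗ₘ i.map V) := by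
        rw [← whisker_exchange, coevalRight]; monoidal
      _ = coevalRight V ⊗≫ (coevalRight V ▷ (lDual V ⊗ V) ≫ (V ⊗ (lDual V ⊗ V)) ◁ i.map V) ⊗≫
          V ◁ i.map V ▷ F ⊗≫ 𝟙 _ := by
        rw [MonoidalCategory.tensorHom_def']; monoidal
      _ = _ := by
        rw [← whisker_exchange]; simp only [coaction]; monoidal
  coact_counit V := by
    calc
      _ = coevalRight V ≫ V ◁ (i.map V ≫ D.counit) := by simp only [coaction]; monoidal
      _ = 𝟙 _ ⊗≫ (η_ V (lDual V) ▷ V ⊗≫ V ◁ ε_ V (lDual V)) ⊗≫ 𝟙 _ := by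
        rw [h.map_counit, coevalRight]; monoidal
      _ = _ := by rw [ExactPairing.evaluation_coevaluation'']; monoidal
  coact_antipode V := by
    -- Moving `F` across the evaluation of `V` braids it past `V*` and then past `V`; the first
    -- braiding cancels the inverse braiding in `map_antipode`.
    have h1 := BraidedCategory.braiding_naturality_right F (ε_ V (lDual V))
    rw [BraidedCategory.braiding_tensor_right_hom, braiding_tensorUnit_right] at h1
    calc
      _ = coevalRight V ≫ V ◁ (i.map V ≫ D.antipode) := by simp only [coaction]; monoidal
      _ = 𝟙 _ ⊗≫ η_ V (lDual V) ▷ V ⊗≫ V ◁ i.coaction.coact (lDual V) ▷ V ⊗≫ V ◁ (β_ F (lDual V)).inv ▷ V ⊗≫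
          V ◁ (F ◁ ε_ V (lDual V) ≫ (ρ_ F).hom ≫ (λ_ F).inv) ⊗≫ 𝟙 _ := by
        rw [h.map_antipode, coevalRight]; monoidal
      _ = 𝟙 _ ⊗≫ η_ V (lDual V) ▷ V ⊗≫ V ◁ i.coaction.coact (lDual V) ▷ V ⊗≫
          V ◁ ((β_ F (lDual V)).inv ≫ (β_ F (lDual V)).hom) ▷ V ⊗≫ (V ⊗ lDual V) ◁ (β_ F V).hom ⊗≫
          V ◁ ε_ V (lDual V) ▷ F ⊗≫ 𝟙 _ := by
        rw [h1]; monoidal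
      _ = _ := by rw [Iso.inv_hom_id]; monoidal

end CoendFamily

/-- The endomorphism of `lDual W ⊗ lDual V` given by the dual of the double braiding. -/
def dualDoubleBraiding (V W : C) : lDual W ⊗ lDual V ⟶ lDual W ⊗ lDual V :=
  dualTensor V W ≫ dualHom ((β_ V W).hom ≫ (β_ W V).hom) ≫ dualTensorInv V W

/-- Both comparison maps preserve evaluations, hence the double braiding may be slid from the duals
to `V ⊗ W`. -/
theorem dualDoubleBraiding_evaluation (V W : C) :
    dualDoubleBraiding V W ▷ (V ⊗ W) ≫ ε_ (V ⊗ W) (lDual W ⊗ lDual V) =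
      (lDual W ⊗ lDual V) ◁ ((β_ V W).hom ≫ (β_ W V).hom) ≫ ε_ (V ⊗ W) (lDual W ⊗ lDual V) := by
  rw [dualDoubleBraiding, comp_whiskerRight, comp_whiskerRight, Category.assoc, Category.assoc,
    dualTensorInv_evaluation, dualHom_evaluation, ← whisker_exchange_assoc,
    dualTensor_evaluation]

/-- Reduces the characterisation of `Q` to a computation on `V* ⊗ V ⟶ W ⊗ W*`: the coevaluations of
`V` and `W` combine into that of `V ⊗ W`, the dualised double braiding slides across its evaluation,
and a zigzag remains. -/
theorem double_braiding_of_map {E F : C} {r : EndFamily E} {i : CoendFamily F} {Q : F ⟶ E}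
    (h : ∀ V W, i.map V ≫ Q ≫ r.map W = (λ_ (lDual V)).inv ▷ V ≫ η_ W (lDual W) ▷ lDual V ▷ V ≫ (α_ _ _ _).hom ▷ V ≫
      (α_ _ _ _).hom ≫ W ◁ dualDoubleBraiding V W ▷ V ≫ W ◁ (α_ _ _ _).hom ≫
      W ◁ lDual W ◁ ε_ V (lDual V) ≫ W ◁ (ρ_ (lDual W)).hom) (V W : C) :
    i.coaction.coact V ▷ W ≫ (α_ V F W).hom ≫ V ◁ (Q ▷ W ≫ r.action.act W) =
      (β_ V W).hom ≫ (β_ W V).hom := by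
  calc
    _ = 𝟙 _ ⊗≫ η_ V (lDual V) ▷ (V ⊗ W) ⊗≫ V ◁ (i.map V ≫ Q ≫ r.map W) ▷ W ⊗≫ (V ⊗ W) ◁ ε_ W (lDual W) ⊗≫
        𝟙 _ := by
      simp only [CoendFamily.coaction, EndFamily.action, coevalRight, evalRight]; monoidal
    _ = 𝟙 _ ⊗≫ (η_ V (lDual V) ⊗≫ V ◁ η_ W (lDual W) ▷ lDual V ⊗≫ 𝟙 ((V ⊗ W) ⊗ (lDual W ⊗ lDual V))) ▷ (V ⊗ W) ⊗≫
        (V ⊗ W) ◁ (dualDoubleBraiding V W ▷ (V ⊗ W) ≫ ε_ (V ⊗ W) (lDual W ⊗ lDual V)) ⊗≫ 𝟙 _ := by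
      rw [h, ExactPairing.tensor_evaluation]; monoidal
    _ = 𝟙 _ ⊗≫ (η_ (V ⊗ W) (lDual W ⊗ lDual V) ▷ (V ⊗ W) ≫
        ((V ⊗ W) ⊗ (lDual W ⊗ lDual V)) ◁ ((β_ V W).hom ≫ (β_ W V).hom)) ⊗≫
        (V ⊗ W) ◁ ε_ (V ⊗ W) (lDual W ⊗ lDual V) ⊗≫ 𝟙 _ := by
      rw [dualDoubleBraiding_evaluation, ExactPairing.tensor_coevaluation]; monoidal
    _ = 𝟙 _ ⊗≫ ((β_ V W).hom ≫ (β_ W V).hom) ⊗≫ (η_ (V ⊗ W) (lDual W ⊗ lDual V) ▷ (V ⊗ W) ≫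
        (α_ _ _ _).hom ≫ (V ⊗ W) ◁ ε_ (V ⊗ W) (lDual W ⊗ lDual V)) ⊗≫ 𝟙 _ := by
      rw [← whisker_exchange]; monoidal
    _ = _ := by rw [ExactPairing.evaluation_coevaluation]; monoidal

end Duals

end

/-! ### Rules for Sweedler sums -/

namespace QuasiHopf

section Instances

variable {k M N A B : Type*} [CommSemiring k] [AddCommMonoid M] [Module k M] [AddCommMonoid N]
  [Module k N] [Semiring A] [Algebra k A] [Semiring B] [Algebra k B]

/-! Shortcuts for frequent instance searches. -/

instance (priority := 2000) : AddHomClass (M →ₗ[k] N) M N := inferInstance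
instance (priority := 2000) : ZeroHomClass (M →ₗ[k] N) M N := inferInstance
instance (priority := 2000) : AddMonoidHomClass (M →ₗ[k] N) M N := inferInstance
instance (priority := 2000) : AddHomClass (M ≃ₗ[k] N) M N := inferInstance
instance (priority := 2000) : ZeroHomClass (M ≃ₗ[k] N) M N := inferInstance
instance (priority := 2000) : AddMonoidHomClass (M ≃ₗ[k] N) M N := inferInstance
instance (priority := 2000) : AddHomClass (A →ₐ[k] B) A B := inferInstance
instance (priority := 2000) : ZeroHomClass (A →ₐ[k] B) A B := inferInstance
instance (priority := 2000) : AddMonoidHomClass (A →ₐ[k] B) A B := inferInstance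
instance (priority := 2000) : MulHomClass (A →ₐ[k] B) A B := inferInstance
instance (priority := 2000) : MonoidHomClass (A →ₐ[k] B) A B := inferInstance

end Instances

section Sums

variable {k M N L P P' : Type*} [CommSemiring k] [AddCommMonoid M] [Module k M]
  [AddCommMonoid N] [Module k N] [AddCommMonoid L] [Module k L] [AddCommMonoid P]
  [AddCommMonoid P']

theorem map_sum2 {F : Type*} [FunLike F P P'] [AddMonoidHomClass F P P'] (g : F) (t : M ⊗[k] N)
    (f : M → N → P) : g (sum2 t f) = sum2 t fun a b => g (f a b) := by
  simp only [sum2, map_multiset_sum, Multiset.map_map, Function.comp_def]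

theorem map_sum3 {F : Type*} [FunLike F P P'] [AddMonoidHomClass F P P'] (g : F)
    (t : M ⊗[k] (N ⊗[k] L)) (f : M → N → L → P) :
    g (sum3 t f) = sum3 t fun a b c => g (f a b c) := by
  simp only [sum3, map_sum2]

/-- Each sum runs over a decomposition fixed by the tensor alone, so sums may be interchanged
without any linearity of the summand. -/
theorem sum2_comm {M' N' : Type*} [AddCommMonoid M'] [Module k M'] [AddCommMonoid N'] [Module k N']
    (t : M ⊗[k] N) (s : M' ⊗[k] N') (f : M → N → M' → N' → P) :
    (sum2 t fun a b => sum2 s fun c d => f a b c d) =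
      sum2 s fun c d => sum2 t fun a b => f a b c d := by
  simp only [sum2]
  exact Multiset.sum_map_sum_map _ _

theorem sum2_sum3_comm {M' N' L' : Type*} [AddCommMonoid M'] [Module k M'] [AddCommMonoid N']
    [Module k N'] [AddCommMonoid L'] [Module k L']
    (t : M ⊗[k] N) (s : M' ⊗[k] (N' ⊗[k] L')) (f : M → N → M' → N' → L' → P) :
    (sum2 t fun a b => sum3 s fun c d e => f a b c d e) =
      sum3 s fun c d e => sum2 t fun a b => f a b c d e := by
  simp only [sum3]
  rw [sum2_comm]
  congr! 5
  rw [sum2_comm]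

theorem sum3_comm {M' N' L' : Type*} [AddCommMonoid M'] [Module k M'] [AddCommMonoid N']
    [Module k N'] [AddCommMonoid L'] [Module k L'] (t : M ⊗[k] (N ⊗[k] L))
    (s : M' ⊗[k] (N' ⊗[k] L')) (f : M → N → L → M' → N' → L' → P) :
    (sum3 t fun x y z => sum3 s fun c d e => f x y z c d e) =
      sum3 s fun c d e => sum3 t fun x y z => f x y z c d e := by
  rw [sum3]
  simp only [sum2_sum3_comm]
  rfl

variable [Module k P] [Module k P'] {Q : Type*} [AddCommMonoid Q] [Module k Q]

theorem sum2_apply (t : M ⊗[k] N) (f : M → N → P →ₗ[k] P') (x : P) :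
    sum2 t f x = sum2 t fun a b => f a b x :=
  map_sum2 (LinearMap.applyₗ x) t f

theorem sum3_apply (t : M ⊗[k] (N ⊗[k] L)) (f : M → N → L → P →ₗ[k] P') (x : P) :
    sum3 t f x = sum3 t fun a b c => f a b c x :=
  map_sum3 (LinearMap.applyₗ x) t f

theorem tmul_sum2 (x : P') (t : M ⊗[k] N) (f : M → N → P) :
    x ⊗ₜ[k] sum2 t f = sum2 t fun a b => x ⊗ₜ[k] f a b :=
  map_sum2 (TensorProduct.mk k P' P x) t f

theorem sum2_tmul (x : P') (t : M ⊗[k] N) (f : M → N → P) :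
    sum2 t f ⊗ₜ[k] x = sum2 t fun a b => f a b ⊗ₜ[k] x :=
  map_sum2 ((TensorProduct.mk k P P').flip x) t f

theorem tmul_sum3 (x : P') (t : M ⊗[k] (N ⊗[k] L)) (f : M → N → L → P) :
    x ⊗ₜ[k] sum3 t f = sum3 t fun a b c => x ⊗ₜ[k] f a b c :=
  map_sum3 (TensorProduct.mk k P' P x) t f

theorem sum3_tmul (x : P') (t : M ⊗[k] (N ⊗[k] L)) (f : M → N → L → P) :
    sum3 t f ⊗ₜ[k] x = sum3 t fun a b c => f a b c ⊗ₜ[k] x :=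
  map_sum3 ((TensorProduct.mk k P P').flip x) t f

end Sums

end QuasiHopf

/-! ### Actions of tensor products of algebras -/

namespace QuasiHopfAlgebra

open QuasiHopf

section OuterAct

variable {k A₁ A₂ A₃ : Type*} [Field k] [Ring A₁] [Algebra k A₁] [Ring A₂] [Algebra k A₂]
  [Ring A₃] [Algebra k A₃]
  {V W X : Type*} [AddCommGroup V] [Module k V] [AddCommGroup W] [Module k W]
  [AddCommGroup X] [Module k X]
  (ρ : A₁ →ₐ[k] Module.End k V) (σ : A₂ →ₐ[k] Module.End k W) (τ : A₃ →ₐ[k] Module.End k X)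

@[simp]
theorem outerAct_tmul (a : A₁) (b : A₂) :
    outerAct ρ σ (a ⊗ₜ[k] b) = TensorProduct.map (ρ a) (σ b) := by
  simp only [outerAct, AlgHom.comp_apply, Algebra.TensorProduct.map_tmul,
    Module.endTensorEndAlgHom_apply]
  rfl

theorem outerAct_eq_sum2 (t : A₁ ⊗[k] A₂) :
    outerAct ρ σ t = sum2 t fun a b => TensorProduct.map (ρ a) (σ b) := by
  simp only [← outerAct_tmul]
  exact (sum2_eq t (outerAct ρ σ).toLinearMap).symm

theorem outerAct_outerAct_eq_sum3 (t : A₁ ⊗[k] (A₂ ⊗[k] A₃)) :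
    outerAct ρ (outerAct σ τ) t =
      sum3 t fun a b c => TensorProduct.map (ρ a) (TensorProduct.map (σ b) (τ c)) := by
  simp only [← outerAct_tmul]
  exact (sum3_eq t (outerAct ρ (outerAct σ τ)).toLinearMap).symm

theorem outerAct_comp {B₁ B₂ : Type*} [Ring B₁] [Algebra k B₁] [Ring B₂] [Algebra k B₂]
    (f : B₁ →ₐ[k] A₁) (g : B₂ →ₐ[k] A₂) (t : B₁ ⊗[k] B₂) :
    outerAct (ρ.comp f) (σ.comp g) t = outerAct ρ σ (Algebra.TensorProduct.map f g t) := by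
  induction t with
  | zero => simp
  | tmul a b => simp
  | add x y hx hy => simp [hx, hy]

theorem outerAct_comp_left {B₁ : Type*} [Ring B₁] [Algebra k B₁]
    (f : B₁ →ₐ[k] A₁) (t : B₁ ⊗[k] A₂) :
    outerAct (ρ.comp f) σ t = outerAct ρ σ (Algebra.TensorProduct.map f (AlgHom.id k A₂) t) :=
  outerAct_comp ρ σ f (AlgHom.id k A₂) t

theorem outerAct_comp_right {B₂ : Type*} [Ring B₂] [Algebra k B₂]
    (g : B₂ →ₐ[k] A₂) (t : A₁ ⊗[k] B₂) :
    outerAct ρ (σ.comp g) t = outerAct ρ σ (Algebra.TensorProduct.map (AlgHom.id k A₁) g t) :=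
  outerAct_comp ρ σ (AlgHom.id k A₁) g t

theorem assoc_comp_outerAct (t : (A₁ ⊗[k] A₂) ⊗[k] A₃) :
    (TensorProduct.assoc k V W X).toLinearMap ∘ₗ outerAct (outerAct ρ σ) τ t =
      outerAct ρ (outerAct σ τ) (Algebra.TensorProduct.assoc k k k A₁ A₂ A₃ t) ∘ₗ
        (TensorProduct.assoc k V W X).toLinearMap := by
  induction t with
  | zero => simp
  | add x y hx hy => simp only [map_add, LinearMap.comp_add, LinearMap.add_comp, hx, hy]
  | tmul a b =>
    induction a with
    | zero => simp
    | add x y hx hy =>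
      simp only [TensorProduct.add_tmul, map_add, LinearMap.comp_add, LinearMap.add_comp, hx, hy]
    | tmul a c =>
      ext v w x
      simp

theorem comm_comp_outerAct (t : A₁ ⊗[k] A₂) :
    (TensorProduct.comm k V W).toLinearMap ∘ₗ outerAct ρ σ t =
      outerAct σ ρ (Algebra.TensorProduct.comm k A₁ A₂ t) ∘ₗ
        (TensorProduct.comm k V W).toLinearMap := by
  induction t with
  | zero => simp
  | add x y hx hy => simp only [map_add, LinearMap.comp_add, LinearMap.add_comp, hx, hy]
  | tmul a b =>
    ext v w
    simp

theorem map_comp_outerAct {V' W' : Type*} [AddCommGroup V'] [Module k V'] [AddCommGroup W']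
    [Module k W'] {ρ : A₁ →ₐ[k] Module.End k V} {σ : A₂ →ₐ[k] Module.End k W}
    {ρ' : A₁ →ₐ[k] Module.End k V'} {σ' : A₂ →ₐ[k] Module.End k W'}
    {f : V →ₗ[k] V'} {g : W →ₗ[k] W'} (hf : ∀ a, f ∘ₗ ρ a = ρ' a ∘ₗ f)
    (hg : ∀ a, g ∘ₗ σ a = σ' a ∘ₗ g) (t : A₁ ⊗[k] A₂) :
    TensorProduct.map f g ∘ₗ outerAct ρ σ t = outerAct ρ' σ' t ∘ₗ TensorProduct.map f g := by
  induction t with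
  | zero => simp
  | add x y hx hy => simp only [map_add, LinearMap.comp_add, LinearMap.add_comp, hx, hy]
  | tmul a b =>
    simp only [outerAct_tmul, ← TensorProduct.map_comp, hf, hg]

theorem lTensor_outerAct (t : A₂ ⊗[k] A₃) :
    (outerAct σ τ t).lTensor V = outerAct ρ (outerAct σ τ) (1 ⊗ₜ[k] t) := by
  rw [outerAct_tmul, map_one]; rfl

end OuterAct

end QuasiHopfAlgebra

/-! ### The associativity constraint and the monoidal category of modules -/

namespace QuasiHopfAlgebra

open QuasiHopf

section Associator

variable {k H : Type*} [Field k] [Ring H] [Algebra k H] (A : QuasiHopfAlgebra k H)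
  {V W X Y : Type*} [AddCommGroup V] [Module k V] [AddCommGroup W] [Module k W]
  [AddCommGroup X] [Module k X] [AddCommGroup Y] [Module k Y]
  (ρ : H →ₐ[k] Module.End k V) (σ : H →ₐ[k] Module.End k W) (τ : H →ₐ[k] Module.End k X)
  (υ : H →ₐ[k] Module.End k Y)

theorem Phi_mul_PhiInv : A.Phi * A.PhiInv = 1 := A.Φ.mul_inv

theorem PhiInv_mul_Phi : A.PhiInv * A.Phi = 1 := A.Φ.inv_mul

/-- The action of `H` through the augmentation. -/
def trivialAct (M : Type*) [AddCommGroup M] [Module k M] : H →ₐ[k] Module.End k M :=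
  (Algebra.ofId k (Module.End k M)).comp A.ε

theorem trivialAct_apply {M : Type*} [AddCommGroup M] [Module k M] (h : H) (x : M) :
    A.trivialAct M h x = A.ε h • x := by
  simp [trivialAct, Algebra.ofId_apply]

theorem tensorAct_eq_sum2 (h : H) :
    A.tensorAct ρ σ h = sum2 (A.Δ h) fun a b => TensorProduct.map (ρ a) (σ b) :=
  outerAct_eq_sum2 ρ σ (A.Δ h)

theorem outerAct_tensorAct_left (t : H ⊗[k] H) :
    outerAct (A.tensorAct ρ σ) τ t =
      outerAct (outerAct ρ σ) τ (Algebra.TensorProduct.map A.Δ (AlgHom.id k H) t) :=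
  outerAct_comp_left _ _ _ _

theorem outerAct_tensorAct_right (t : H ⊗[k] H) :
    outerAct ρ (A.tensorAct σ τ) t =
      outerAct ρ (outerAct σ τ) (Algebra.TensorProduct.map (AlgHom.id k H) A.Δ t) :=
  outerAct_comp_right _ _ _ _

/-- Quasi-coassociativity, read on modules, is the `H`-linearity of the associativity constraint. -/
theorem assocMap_tensorAct (h : H) :
    A.assocMap ρ σ τ ∘ₗ A.tensorAct (A.tensorAct ρ σ) τ h =
      A.tensorAct ρ (A.tensorAct σ τ) h ∘ₗ A.assocMap ρ σ τ := by
  change _ ∘ₗ outerAct (A.tensorAct ρ σ) τ (A.Δ h) = outerAct ρ (A.tensorAct σ τ) (A.Δ h) ∘ₗ _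
  rw [outerAct_tensorAct_left, outerAct_tensorAct_right, assocMap, LinearMap.comp_assoc, assoc_comp_outerAct,
    A.quasi_coassoc, ← LinearMap.comp_assoc, ← LinearMap.comp_assoc]
  congr 1
  simp only [← Module.End.mul_eq_comp, ← map_mul]
  congr 1
  rw [Phi, mul_assoc, A.Φ.inv_mul, mul_one]

theorem assocMap_comp_assocInvMap : A.assocMap ρ σ τ ∘ₗ A.assocInvMap ρ σ τ = LinearMap.id := by
  refine LinearMap.ext fun x => ?_
  have := congrArg (fun t => outerAct ρ (outerAct σ τ) t) A.Phi_mul_PhiInv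
  simp only [map_mul, map_one] at this
  simpa [assocMap, assocInvMap] using congrArg (fun f => f x) this

theorem assocInvMap_comp_assocMap : A.assocInvMap ρ σ τ ∘ₗ A.assocMap ρ σ τ = LinearMap.id := by
  refine LinearMap.ext fun x => ?_
  have := congrArg (fun t => outerAct ρ (outerAct σ τ) t) A.PhiInv_mul_Phi
  simp only [map_mul, map_one] at this
  have h2 := congrArg (fun f => f (TensorProduct.assoc k V W X x)) this
  simpa [assocMap, assocInvMap] using congrArg (TensorProduct.assoc k V W X).symm h2

theorem assocMap_natural {V' W' X' : Type*} [AddCommGroup V'] [Module k V'] [AddCommGroup W']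
    [Module k W'] [AddCommGroup X'] [Module k X'] {ρ : H →ₐ[k] Module.End k V}
    {σ : H →ₐ[k] Module.End k W} {τ : H →ₐ[k] Module.End k X}
    {ρ' : H →ₐ[k] Module.End k V'} {σ' : H →ₐ[k] Module.End k W'} {τ' : H →ₐ[k] Module.End k X'}
    {f : V →ₗ[k] V'} {g : W →ₗ[k] W'} {l : X →ₗ[k] X'} (hf : ∀ a, f ∘ₗ ρ a = ρ' a ∘ₗ f)
    (hg : ∀ a, g ∘ₗ σ a = σ' a ∘ₗ g) (hl : ∀ a, l ∘ₗ τ a = τ' a ∘ₗ l) :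
    A.assocMap ρ' σ' τ' ∘ₗ TensorProduct.map (TensorProduct.map f g) l =
      TensorProduct.map f (TensorProduct.map g l) ∘ₗ A.assocMap ρ σ τ := by
  rw [assocMap, assocMap, ← LinearMap.comp_assoc,
    map_comp_outerAct hf (map_comp_outerAct hg hl), LinearMap.comp_assoc, LinearMap.comp_assoc]
  congr 1
  ext
  rfl

theorem lTensor_assoc_comp_outerAct (t : H ⊗[k] (H ⊗[k] H)) :
    (TensorProduct.assoc k W X Y).toLinearMap.lTensor V ∘ₗ
        outerAct ρ (outerAct (A.tensorAct σ τ) υ) t =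
      outerAct ρ (outerAct σ (outerAct τ υ)) (Algebra.TensorProduct.map (AlgHom.id k H)
        ((Algebra.TensorProduct.assoc k k k H H H).toAlgHom.comp
          (Algebra.TensorProduct.map A.Δ (AlgHom.id k H))) t) ∘ₗ
        (TensorProduct.assoc k W X Y).toLinearMap.lTensor V := by
  induction t with
  | zero => simp
  | add x y hx hy => simp only [map_add, LinearMap.comp_add, LinearMap.add_comp, hx, hy]
  | tmul a t =>
    rw [outerAct_tmul, outerAct_tensorAct_left, LinearMap.lTensor, ← TensorProduct.map_comp,
      assoc_comp_outerAct, Algebra.TensorProduct.map_tmul, outerAct_tmul,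
      ← TensorProduct.map_comp]
    rfl

theorem lTensor_assoc_comp_rTensor_outerAct (t : H ⊗[k] (H ⊗[k] H)) :
    (TensorProduct.assoc k W X Y).toLinearMap.lTensor V ∘ₗ
        (TensorProduct.assoc k V (W ⊗[k] X) Y).toLinearMap ∘ₗ
          (outerAct ρ (outerAct σ τ) t).rTensor Y =
      outerAct ρ (outerAct σ (outerAct τ υ)) (Algebra.TensorProduct.map (AlgHom.id k H)
        (Algebra.TensorProduct.map (AlgHom.id k H) Algebra.TensorProduct.includeLeft) t) ∘ₗ
        (TensorProduct.assoc k W X Y).toLinearMap.lTensor V ∘ₗ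
        (TensorProduct.assoc k V (W ⊗[k] X) Y).toLinearMap := by
  induction t with
  | zero => simp
  | add x y hx hy => simp only [map_add, LinearMap.comp_add, LinearMap.add_comp, hx, hy,
    LinearMap.rTensor_add]
  | tmul a t =>
    induction t with
    | zero => simp
    | add x y hx hy => simp only [map_add, LinearMap.comp_add, LinearMap.add_comp, hx, hy,
        LinearMap.rTensor_add, TensorProduct.tmul_add]
    | tmul b c =>
      ext v w x y
      simp

theorem assoc_comp_outerAct_tensorAct (t : H ⊗[k] (H ⊗[k] H)) :
    (TensorProduct.assoc k V W (X ⊗[k] Y)).toLinearMap ∘ₗ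
        outerAct (A.tensorAct ρ σ) (outerAct τ υ) t =
      outerAct ρ (outerAct σ (outerAct τ υ)) (Algebra.TensorProduct.assoc k k k H H (H ⊗[k] H)
        (Algebra.TensorProduct.map A.Δ (AlgHom.id k (H ⊗[k] H)) t)) ∘ₗ
        (TensorProduct.assoc k V W (X ⊗[k] Y)).toLinearMap := by
  rw [tensorAct, outerAct_comp_left, assoc_comp_outerAct]

theorem outerAct_outerAct_tensorAct (t : H ⊗[k] (H ⊗[k] H)) :
    outerAct ρ (outerAct σ (A.tensorAct τ υ)) t =
      outerAct ρ (outerAct σ (outerAct τ υ)) (Algebra.TensorProduct.map (AlgHom.id k H)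
        (Algebra.TensorProduct.map (AlgHom.id k H) A.Δ) t) := by
  induction t with
  | zero => simp
  | add x y hx hy => simp only [map_add, hx, hy]
  | tmul a t => rw [outerAct_tmul, outerAct_tensorAct_right]; simp

/-- The image of the 3-cocycle identity in the endomorphisms of `V ⊗ (W ⊗ (X ⊗ Y))`. The preceding
lemmas move all reparenthesisations to the right of the five factors, where the remaining
isomorphisms of vector spaces agree. -/
theorem pentagon :
    (A.assocMap σ τ υ).lTensor V ∘ₗ A.assocMap ρ (A.tensorAct σ τ) υ ∘ₗ
        (A.assocMap ρ σ τ).rTensor Y =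
      A.assocMap ρ σ (A.tensorAct τ υ) ∘ₗ A.assocMap (A.tensorAct ρ σ) τ υ := by
  have h1 := A.cocycle
  have h2 := A.lTensor_assoc_comp_outerAct ρ σ τ υ A.Phi
  have h3 := lTensor_assoc_comp_rTensor_outerAct ρ σ τ υ A.Phi
  have h4 := A.assoc_comp_outerAct_tensorAct ρ σ τ υ A.Phi
  have h5 := A.outerAct_outerAct_tensorAct ρ σ τ υ A.Phi
  set P := outerAct ρ (outerAct σ (outerAct τ υ)) with hP
  have h6 := congrArg P h1
  rw [map_mul, map_mul, map_mul] at h6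
  have h7 : ((outerAct σ (outerAct τ υ)) A.Phi).lTensor V = P (1 ⊗ₜ A.Phi) :=
    lTensor_outerAct ρ _ _ _
  calc
    _ = P (1 ⊗ₜ A.Phi) ∘ₗ ((TensorProduct.assoc k W X Y).toLinearMap.lTensor V ∘ₗ
        outerAct ρ (outerAct (A.tensorAct σ τ) υ) A.Phi) ∘ₗ
        (TensorProduct.assoc k V (W ⊗[k] X) Y).toLinearMap ∘ₗ
        (outerAct ρ (outerAct σ τ) A.Phi).rTensor Y ∘ₗ
          (TensorProduct.assoc k V W X).toLinearMap.rTensor Y := by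
      simp only [assocMap, LinearMap.lTensor_comp, LinearMap.rTensor_comp, h7, LinearMap.comp_assoc]
    _ = P (1 ⊗ₜ A.Phi) ∘ₗ P (Algebra.TensorProduct.map (AlgHom.id k H)
        ((Algebra.TensorProduct.assoc k k k H H H).toAlgHom.comp
          (Algebra.TensorProduct.map A.Δ (AlgHom.id k H))) A.Phi) ∘ₗ
        ((TensorProduct.assoc k W X Y).toLinearMap.lTensor V ∘ₗ
        (TensorProduct.assoc k V (W ⊗[k] X) Y).toLinearMap ∘ₗ
        (outerAct ρ (outerAct σ τ) A.Phi).rTensor Y) ∘ₗ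
          (TensorProduct.assoc k V W X).toLinearMap.rTensor Y := by
      rw [h2]; simp only [LinearMap.comp_assoc]
    _ = (P (1 ⊗ₜ A.Phi) * P (Algebra.TensorProduct.map (AlgHom.id k H)
        ((Algebra.TensorProduct.assoc k k k H H H).toAlgHom.comp
          (Algebra.TensorProduct.map A.Δ (AlgHom.id k H))) A.Phi) *
          P (Algebra.TensorProduct.map (AlgHom.id k H)
        (Algebra.TensorProduct.map (AlgHom.id k H) Algebra.TensorProduct.includeLeft) A.Phi)) ∘ₗ
        ((TensorProduct.assoc k W X Y).toLinearMap.lTensor V ∘ₗ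
        (TensorProduct.assoc k V (W ⊗[k] X) Y).toLinearMap ∘ₗ
          (TensorProduct.assoc k V W X).toLinearMap.rTensor Y) := by
      rw [h3]; simp only [LinearMap.comp_assoc, Module.End.mul_eq_comp]
    _ = (P (Algebra.TensorProduct.map (AlgHom.id k H)
        (Algebra.TensorProduct.map (AlgHom.id k H) A.Δ) A.Phi) *
      P (Algebra.TensorProduct.assoc k k k H H (H ⊗[k] H)
        (Algebra.TensorProduct.map A.Δ (AlgHom.id k (H ⊗[k] H)) A.Phi))) ∘ₗ
        ((TensorProduct.assoc k V W (X ⊗[k] Y)).toLinearMap ∘ₗ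
        (TensorProduct.assoc k (V ⊗[k] W) X Y).toLinearMap) := by
      rw [Phi, h6]
      congr 1
      ext
      rfl
    _ = _ := by
      rw [assocMap, assocMap, Module.End.mul_eq_comp, LinearMap.comp_assoc, LinearMap.comp_assoc,
        ← LinearMap.comp_assoc (TensorProduct.assoc k (V ⊗[k] W) X Y).toLinearMap
          (TensorProduct.assoc k V W (X ⊗[k] Y)).toLinearMap]
      rw [← LinearMap.comp_assoc _ (outerAct (A.tensorAct ρ σ) (outerAct τ υ) A.Phi), h4, h5]

theorem assocMap_tmul (x : V) (y : W) (z : X) :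
    A.assocMap ρ σ τ ((x ⊗ₜ[k] y) ⊗ₜ[k] z) =
      sum3 A.Phi fun X1 X2 X3 => ρ X1 x ⊗ₜ[k] (σ X2 y ⊗ₜ[k] τ X3 z) := by
  rw [assocMap, outerAct_outerAct_eq_sum3]
  simp only [LinearMap.comp_apply, sum3_apply]
  rfl

theorem assocInvMap_tmul (x : V) (y : W) (z : X) :
    A.assocInvMap ρ σ τ (x ⊗ₜ[k] (y ⊗ₜ[k] z)) =
      sum3 A.PhiInv fun x1 x2 x3 => (ρ x1 x ⊗ₜ[k] σ x2 y) ⊗ₜ[k] τ x3 z := by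
  rw [assocInvMap, outerAct_outerAct_eq_sum3]
  simp only [LinearMap.comp_apply, sum3_apply, map_sum3]
  rfl

end Associator

section Category

variable {k : Type u} {H : Type v} [Field k] [Ring H] [Algebra k H] {A : QuasiHopfAlgebra k H}
  {R : H ⊗[k] H}

/-- Finite-dimensional modules over a quasi-triangular quasi-Hopf algebra. -/
structure Rep (hR : A.IsRMatrix R) where
  carrier : Type (max u v)
  [addCommGroup : AddCommGroup carrier]
  [module : Module k carrier]
  [finite : FiniteDimensional k carrier]
  act : H →ₐ[k] Module.End k carrier

namespace Rep

attribute [instance] addCommGroup module finite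

variable {hR : A.IsRMatrix R}

instance : CoeSort (Rep hR) (Type (max u v)) := ⟨carrier⟩

/-- Morphisms of modules. -/
@[ext]
structure Hom (V W : Rep hR) where
  lin : V →ₗ[k] W
  comm : ∀ h : H, lin ∘ₗ V.act h = W.act h ∘ₗ lin

open CategoryTheory MonoidalCategory

noncomputable instance : Category (Rep hR) where
  Hom := Hom
  id V := ⟨LinearMap.id, fun _ => rfl⟩
  comp f g := ⟨g.lin ∘ₗ f.lin, fun h => by
    rw [LinearMap.comp_assoc, f.comm, ← LinearMap.comp_assoc, g.comm, LinearMap.comp_assoc]⟩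

@[ext]
theorem hom_ext {V W : Rep hR} {f g : V ⟶ W} (h : f.lin = g.lin) : f = g := Hom.ext h

@[simp] theorem comp_lin {V W X : Rep hR} (f : V ⟶ W) (g : W ⟶ X) :
    (f ≫ g).lin = g.lin ∘ₗ f.lin := rfl

@[simp] theorem id_lin (V : Rep hR) : Hom.lin (𝟙 V) = LinearMap.id := rfl

/-- A bijective morphism is an isomorphism. -/
noncomputable def isoMk {V W : Rep hR} (e : V ≃ₗ[k] W)
    (comm : ∀ h, e.toLinearMap ∘ₗ V.act h = W.act h ∘ₗ e.toLinearMap) : V ≅ W where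
  hom := ⟨e.toLinearMap, comm⟩
  inv := ⟨e.symm.toLinearMap, fun h => by
    refine LinearMap.ext fun x => e.injective ?_
    have := LinearMap.congr_fun (comm h) (e.symm x)
    simp at this
    simp [this]⟩
  hom_inv_id := by ext; simp
  inv_hom_id := by ext; simp

variable (hR)

/-- The trivial module. -/
noncomputable abbrev unit : Rep hR where
  -- Carriers lie in a universe common to `k` and `H`; hence the lift here, in the regular module
  -- and in the adjoint module.
  carrier := ULift.{v} k
  act := A.trivialAct _

variable {hR}

/-- The tensor product of modules. -/
noncomputable abbrev tensor (V W : Rep hR) : Rep hR where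
  carrier := V ⊗[k] W
  act := A.tensorAct V.act W.act

/-- The tensor product of morphisms. -/
noncomputable def homTensor {V W X Y : Rep hR} (f : V ⟶ W) (g : X ⟶ Y) :
    tensor V X ⟶ tensor W Y :=
  ⟨TensorProduct.map f.lin g.lin, fun h => map_comp_outerAct f.comm g.comm (A.Δ h)⟩

/-- The associativity constraint. -/
noncomputable def assocIso (V W X : Rep hR) : tensor (tensor V W) X ≅ tensor V (tensor W X) :=
  isoMk (LinearEquiv.ofLinearMap (A.assocMap V.act W.act X.act) (A.assocInvMap V.act W.act X.act)
    (A.assocMap_comp_assocInvMap _ _ _) (A.assocInvMap_comp_assocMap _ _ _))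
    (A.assocMap_tensorAct _ _ _)

/-- The left unit constraint. -/
noncomputable def leftUnitIso (V : Rep hR) : tensor (unit hR) V ≅ V :=
  isoMk (TensorProduct.congr ULift.moduleEquiv (LinearEquiv.refl k V) ≪≫ₗ TensorProduct.lid k V) <| by
    intro h
    change _ ∘ₗ outerAct (A.trivialAct _) V.act (A.Δ h) = _
    rw [trivialAct, outerAct_comp_left, A.counit_left, outerAct_tmul]
    refine TensorProduct.ext' fun a b => ?_
    simp

/-- The right unit constraint. -/
noncomputable def rightUnitIso (V : Rep hR) : tensor V (unit hR) ≅ V :=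
  isoMk (TensorProduct.congr (LinearEquiv.refl k V) ULift.moduleEquiv ≪≫ₗ TensorProduct.rid k V) <| by
    intro h
    change _ ∘ₗ outerAct V.act (A.trivialAct _) (A.Δ h) = _
    rw [trivialAct, outerAct_comp_right, A.counit_right, outerAct_tmul]
    refine TensorProduct.ext' fun a b => ?_
    simp

noncomputable instance : MonoidalCategoryStruct (Rep hR) where
  tensorObj := tensor
  whiskerLeft V _ _ f := homTensor (𝟙 V) f
  whiskerRight f V := homTensor f (𝟙 V)
  tensorHom := homTensor
  tensorUnit := unit hR
  associator := assocIso
  leftUnitor := leftUnitIso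
  rightUnitor := rightUnitIso

@[simp] theorem tensorHom_lin {V W X Y : Rep hR} (f : V ⟶ W) (g : X ⟶ Y) :
    (f ⊗ₘ g).lin = TensorProduct.map f.lin g.lin := rfl

@[simp] theorem whiskerLeft_lin (V : Rep hR) {X Y : Rep hR} (g : X ⟶ Y) :
    (V ◁ g).lin = g.lin.lTensor V := rfl

@[simp] theorem whiskerRight_lin {V W : Rep hR} (f : V ⟶ W) (X : Rep hR) :
    (f ▷ X).lin = f.lin.rTensor X := rfl

@[simp] theorem associator_hom_lin (V W X : Rep hR) :
    (α_ V W X).hom.lin = A.assocMap V.act W.act X.act := rfl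

@[simp] theorem associator_inv_lin (V W X : Rep hR) :
    (α_ V W X).inv.lin = A.assocInvMap V.act W.act X.act := rfl

@[simp] theorem leftUnitor_hom_lin_tmul (V : Rep hR) (c : ULift.{v} k) (x : V) :
    (λ_ V).hom.lin (c ⊗ₜ[k] x) = c.down • x := rfl

@[simp] theorem rightUnitor_hom_lin_tmul (V : Rep hR) (c : ULift.{v} k) (x : V) :
    (ρ_ V).hom.lin (x ⊗ₜ[k] c) = c.down • x := rfl

@[simp] theorem rightUnitor_inv_lin_apply (V : Rep hR) (x : V) :
    (ρ_ V).inv.lin x = x ⊗ₜ[k] (ULift.up 1 : ULift.{v} k) := rfl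

/-- The unit object sees only `(id ⊗ ε ⊗ id)(Φ) = 1`; this is the triangle axiom. -/
theorem assocMap_unit (V W : Rep hR) (x : V) (c : ULift.{v} k) (y : W) :
    A.assocMap V.act (𝟙_ (Rep hR)).act W.act ((x ⊗ₜ[k] c) ⊗ₜ[k] y) = x ⊗ₜ[k] (c ⊗ₜ[k] y) := by
  have h : ∀ t : H ⊗[k] (H ⊗[k] H), outerAct V.act (outerAct (A.trivialAct (ULift.{v} k)) W.act) t =
      outerAct V.act (outerAct (Algebra.ofId k (Module.End k (ULift.{v} k))) W.act)
        (Algebra.TensorProduct.map (AlgHom.id k H)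
          (Algebra.TensorProduct.map A.ε (AlgHom.id k H)) t) := by
    intro t
    induction t with
    | zero => simp
    | add x y hx hy => simp only [map_add, hx, hy]
    | tmul a t => rw [outerAct_tmul, trivialAct, outerAct_comp_left]; simp
  change outerAct V.act (outerAct (A.trivialAct (ULift.{v} k)) W.act) A.Phi (x ⊗ₜ[k] (c ⊗ₜ[k] y)) = _
  rw [h, Phi, A.counit_Φ, map_one]
  rfl

noncomputable instance : MonoidalCategory (Rep hR) where
  tensorHom_def f g := by
    ext : 1
    change TensorProduct.map f.lin g.lin = TensorProduct.map _ _ ∘ₗ TensorProduct.map _ _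
    rw [← TensorProduct.map_comp]
    rfl
  id_tensorHom_id V W := by ext : 1; exact TensorProduct.map_id
  tensorHom_comp_tensorHom f g f' g' := by
    ext : 1
    exact (TensorProduct.map_comp _ _ _ _).symm
  whiskerLeft_id V W := by ext : 1; exact TensorProduct.map_id
  id_whiskerRight V W := by ext : 1; exact TensorProduct.map_id
  associator_naturality f g l := by
    ext : 1
    exact A.assocMap_natural f.comm g.comm l.comm
  leftUnitor_naturality {V W} f := by
    ext : 1
    refine TensorProduct.ext' fun c x => ?_
    change (λ_ W).hom.lin ((c : ULift.{v} k) ⊗ₜ[k] f.lin x) = f.lin ((λ_ V).hom.lin (c ⊗ₜ[k] x))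
    simp
  rightUnitor_naturality {V W} f := by
    ext : 1
    refine TensorProduct.ext' fun x c => ?_
    change (ρ_ W).hom.lin (f.lin x ⊗ₜ[k] (c : ULift.{v} k)) = f.lin ((ρ_ V).hom.lin (x ⊗ₜ[k] c))
    simp
  pentagon V W X Y := by
    ext : 1
    exact A.pentagon V.act W.act X.act Y.act
  triangle V W := by
    ext : 1
    refine TensorProduct.ext' fun t y => ?_
    induction t using TensorProduct.induction_on with
    | zero => simp
    | add a b ha hb => simp only [TensorProduct.add_tmul, map_add, ha, hb]
    | tmul x c =>
      change (V ◁ (λ_ W).hom).lin (A.assocMap V.act (𝟙_ (Rep hR)).act W.act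
        ((x ⊗ₜ[k] c) ⊗ₜ[k] y)) = (ρ_ V).hom.lin (x ⊗ₜ[k] c) ⊗ₜ[k] y
      rw [assocMap_unit]
      change x ⊗ₜ[k] (λ_ W).hom.lin (c ⊗ₜ[k] y) = _
      rw [leftUnitor_hom_lin_tmul, rightUnitor_hom_lin_tmul, TensorProduct.smul_tmul]

end Rep

end Category

end QuasiHopfAlgebra

/-! ### Dual modules -/

namespace QuasiHopfAlgebra

open QuasiHopf

section DualModule

variable {k H : Type*} [Field k] [Ring H] [Algebra k H] (A : QuasiHopfAlgebra k H)
  {V W X : Type*} [AddCommGroup V] [Module k V] [AddCommGroup W] [Module k W]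
  [AddCommGroup X] [Module k X]
  (ρ : H →ₐ[k] Module.End k V) (σ : H →ₐ[k] Module.End k W)

/-- The action on the dual of a module. -/
def dualAct : H →ₐ[k] Module.End k (Module.Dual k V) :=
  AlgHom.ofLinearMap
    (Module.Dual.transpose (R := k) (M := V) (M' := V) ∘ₗ ρ.toLinearMap ∘ₗ A.S)
    (by ext φ x; simp [A.S_one, Module.Dual.transpose_apply])
    (by intro a b; ext φ x; simp [A.S_mul, Module.Dual.transpose_apply])

@[simp]
theorem dualAct_apply (h : H) (φ : Module.Dual k V) : A.dualAct ρ h φ = φ ∘ₗ ρ (A.S h) := rfl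

variable (k V W) in
/-- `w ⊗ φ ↦ (v ↦ φ(v) w)` -/
noncomputable def toHom : W ⊗[k] Module.Dual k V →ₗ[k] V →ₗ[k] W :=
  dualTensorHom k V W ∘ₗ (TensorProduct.comm k W (Module.Dual k V)).toLinearMap

@[simp]
theorem toHom_tmul (w : W) (φ : Module.Dual k V) (x : V) :
    toHom k V W (w ⊗ₜ[k] φ) x = φ x • w := rfl

/-- The means by which identities in `W ⊗ V*` are checked: for finite-dimensional `V` they may be
checked as identities of linear maps. -/
theorem toHom_injective [FiniteDimensional k V] : Function.Injective (toHom k V W) := by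
  intro x y h
  refine (TensorProduct.comm k W (Module.Dual k V)).injective ?_
  refine (dualTensorHomEquiv k V W).injective ?_
  simpa [toHom] using h

theorem toHom_map {V' W' : Type*} [AddCommGroup V'] [Module k V'] [AddCommGroup W'] [Module k W']
    (f : W →ₗ[k] W') (g : V' →ₗ[k] V) (t : W ⊗[k] Module.Dual k V) :
    toHom k V' W' (TensorProduct.map f g.dualMap t) = f ∘ₗ toHom k V W t ∘ₗ g := by
  induction t with
  | zero => simp
  | add x y hx hy => simp only [map_add, hx, hy, LinearMap.add_comp, LinearMap.comp_add]
  | tmul w φ => ext x; simp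

theorem toHom_coevaluation [FiniteDimensional k V] :
    toHom k V V (coevaluation k V 1) = LinearMap.id := by
  ext x
  rw [coevaluation_apply_one]
  simp only [map_sum, LinearMap.sum_apply, toHom_tmul]
  exact (Module.Basis.ofVectorSpace k V).sum_repr x

theorem toHom_rTensor_coevaluation [FiniteDimensional k V] (f : V →ₗ[k] W) (c : k) :
    toHom k V W (f.rTensor (Module.Dual k V) (coevaluation k V c)) = c • f := by
  rw [← mul_one c, ← smul_eq_mul, map_smul, map_smul, map_smul]
  have h : toHom k V W (f.rTensor (Module.Dual k V) (coevaluation k V 1)) =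
      f ∘ₗ toHom k V V (coevaluation k V 1) ∘ₗ LinearMap.id := by
    rw [← toHom_map, LinearMap.dualMap_id]
    rfl
  rw [h, toHom_coevaluation]
  simp

theorem toHom_tensorAct_dualAct (h : H) (t : W ⊗[k] Module.Dual k V) :
    toHom k V W (A.tensorAct σ (A.dualAct ρ) h t) =
      sum2 (A.Δ h) fun a b => σ a ∘ₗ toHom k V W t ∘ₗ ρ (A.S b) := by
  rw [tensorAct_eq_sum2, sum2_apply, map_sum2]
  congr! 3
  exact toHom_map _ _ _

end DualModule

namespace Rep

open CategoryTheory MonoidalCategory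

variable {k : Type u} {H : Type v} [Field k] [Ring H] [Algebra k H] {A : QuasiHopfAlgebra k H}
  {R : H ⊗[k] H} {hR : A.IsRMatrix R}

/-- The dual of a module. -/
noncomputable abbrev dual (V : Rep hR) : Rep hR where
  carrier := Module.Dual k V
  act := A.dualAct V.act

/-- The evaluation. -/
noncomputable def ev (V : Rep hR) : dual V ⊗ V ⟶ 𝟙_ (Rep hR) where
  lin := ULift.moduleEquiv.symm.toLinearMap ∘ₗ contractLeft k V ∘ₗ
    (V.act A.α).lTensor (Module.Dual k V)
  comm h := by
    refine TensorProduct.ext' fun φ x => ?_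
    change ((ULift.moduleEquiv (R := k) (M := k)).symm.toLinearMap ∘ₗ contractLeft k V ∘ₗ
      (V.act A.α).lTensor (Module.Dual k V)) (A.tensorAct (A.dualAct V.act) V.act h (φ ⊗ₜ[k] x)) =
      A.trivialAct (ULift.{v} k) h _
    rw [tensorAct_eq_sum2, sum2_apply, map_sum2, trivialAct_apply]
    -- The relation `S(h₁) α h₂ = ε(h) α` is exactly the linearity of the evaluation twisted by `α`.
    have h1 := congrArg (fun a => φ (V.act a x)) (A.antipode_left h)
    simp only [map_smul, LinearMap.smul_apply] at h1
    rw [show φ (V.act (sum2 (A.Δ h) fun h1 h2 => A.S h1 * A.α * h2) x) =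
      sum2 (A.Δ h) fun h1 h2 => φ (V.act (A.S h1 * A.α * h2) x) by
        rw [map_sum2, sum2_apply, map_sum2]] at h1
    refine ULift.down_injective ?_
    have h2 : ∀ F : H → H → ULift.{v} k,
        (sum2 (A.Δ h) F).down = sum2 (A.Δ h) fun a b => (F a b).down :=
      map_sum2 (ULift.moduleEquiv (R := k) (M := k)).toLinearMap (A.Δ h)
    rw [h2]
    simp only [map_mul, Module.End.mul_apply] at h1
    exact h1

theorem ev_lin_tmul (V : Rep hR) (φ : Module.Dual k V) (x : V) :
    (ev V).lin (φ ⊗ₜ[k] x) = ULift.up (φ (V.act A.α x)) := rfl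

/-- The coevaluation. -/
noncomputable def coev (V : Rep hR) : 𝟙_ (Rep hR) ⟶ V ⊗ dual V where
  lin := (V.act A.β).rTensor (Module.Dual k V) ∘ₗ coevaluation k V ∘ₗ
    ULift.moduleEquiv.toLinearMap
  comm h := by
    refine LinearMap.ext fun c => toHom_injective ?_
    obtain ⟨c⟩ := c
    change toHom k V V ((V.act A.β).rTensor (Module.Dual k V) (coevaluation k V
      (A.trivialAct (ULift.{v} k) h (ULift.up c)).down)) = toHom k V V
        (A.tensorAct V.act (A.dualAct V.act) h
          ((V.act A.β).rTensor (Module.Dual k V) (coevaluation k V c)))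
    rw [trivialAct_apply, toHom_tensorAct_dualAct, toHom_rTensor_coevaluation,
      toHom_rTensor_coevaluation]
    have h1 := congrArg (fun a => c • V.act a) (A.antipode_right h)
    simp only [map_sum2, map_smul] at h1
    rw [ULift.smul_down, smul_eq_mul, mul_comm, mul_smul, ← h1, ← LinearMap.lsmul_apply, map_sum2]
    congr! 3
    simp [Module.End.mul_eq_comp, LinearMap.comp_assoc, LinearMap.comp_smul, LinearMap.smul_comp]

theorem toHom_coev_lin (V : Rep hR) (c : k) :
    toHom k V V ((coev V).lin (ULift.up c)) = c • V.act A.β := by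
  exact toHom_rTensor_coevaluation _ _

/-- Evaluating an element of `W ⊗ V* ≅ Hom(V, W)` at a vector. -/
theorem whiskerLeft_ev_assocMap (W V : Rep hR) (t : W ⊗[k] Module.Dual k V) (x : V) :
    (ρ_ W).hom.lin ((W ◁ ev V).lin (A.assocMap W.act (A.dualAct V.act) V.act (t ⊗ₜ[k] x))) =
      sum3 A.Phi fun X1 X2 X3 => W.act X1 (toHom k V W t (V.act (A.S X2 * A.α * X3) x)) := by
  induction t with
  | zero => simp [sum3, sum2]
  | add s t hs ht =>
    rw [TensorProduct.add_tmul, map_add, map_add, map_add, hs, ht]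
    simp only [map_add, LinearMap.add_apply, sum3, sum2, Multiset.sum_map_add]
  | tmul w φ =>
    rw [assocMap_tmul, map_sum3, map_sum3]
    congr! 4 with a b c
    change (ρ_ W).hom.lin (W.act a w ⊗ₜ[k] (ULift.up (φ (V.act (A.S b) (V.act A.α (V.act c x)))) :
      ULift.{v} k)) = _
    simp

/-- Composing a functional with an element of `V ⊗ W* ≅ Hom(W, V)`. -/
theorem ev_whiskerRight_assocInvMap (V W : Rep hR) (φ : Module.Dual k V) (t : V ⊗[k] Module.Dual k W) :
    (λ_ (dual W)).hom.lin ((ev V ▷ dual W).lin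
      (A.assocInvMap (A.dualAct V.act) V.act (A.dualAct W.act) (φ ⊗ₜ[k] t))) =
      sum3 A.PhiInv fun x1 x2 x3 =>
        φ ∘ₗ V.act (A.S x1 * A.α * x2) ∘ₗ toHom k W V t ∘ₗ W.act (A.S x3) := by
  induction t with
  | zero => simp [sum3, sum2]
  | add s t hs ht =>
    rw [TensorProduct.tmul_add, map_add, map_add, map_add, hs, ht]
    simp only [map_add, LinearMap.add_comp, LinearMap.comp_add, sum3, sum2, Multiset.sum_map_add]
  | tmul w ψ =>
    rw [assocInvMap_tmul, map_sum3, map_sum3]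
    congr! 4 with a b c
    change (λ_ (dual W)).hom.lin ((ULift.up (φ (V.act (A.S a) (V.act A.α (V.act b w)))) :
      ULift.{v} k) ⊗ₜ[k] (ψ ∘ₗ W.act (A.S c))) = _
    rw [leftUnitor_hom_lin_tmul]
    refine LinearMap.ext fun x => ?_
    change φ (V.act (A.S a) (V.act A.α (V.act b w))) * ψ (W.act (A.S c) x) =
      φ (V.act (A.S a * A.α * b) (ψ (W.act (A.S c) x) • w))
    rw [map_smul, map_smul, smul_eq_mul, mul_comm, map_mul, map_mul]
    rfl

/-- This zigzag is the relation `X¹ β S(X²) α X³ = 1` acting on `V`. -/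
theorem evaluation_coevaluation (V : Rep hR) :
    coev V ▷ V ≫ (α_ V (dual V) V).hom ≫ V ◁ ev V = (λ_ V).hom ≫ (ρ_ V).inv := by
  rw [← cancel_mono (ρ_ V).hom]
  ext : 1
  refine TensorProduct.ext' fun c x => ?_
  obtain ⟨c⟩ := c
  refine (whiskerLeft_ev_assocMap V V ((coev V).lin (ULift.up c)) x).trans ?_
  rw [toHom_coev_lin]
  have h := congrArg (fun a => c • V.act a x) A.antipode_Φ
  simp only [map_sum3, sum3_apply] at h
  rw [← LinearMap.lsmul_apply, map_sum3] at h
  have h2 : (((λ_ V).hom ≫ (ρ_ V).inv) ≫ (ρ_ V).hom).lin ((ULift.up c : ULift.{v} k) ⊗ₜ[k] x) = c • x := by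
    simp
  rw [h2]
  simpa [mul_assoc, Phi] using h

/-- The other zigzag is `S(x¹) α x² β S(x³) = 1`. -/
theorem coevaluation_evaluation (V : Rep hR) :
    dual V ◁ coev V ≫ (α_ (dual V) V (dual V)).inv ≫ ev V ▷ dual V =
      (ρ_ (dual V)).hom ≫ (λ_ (dual V)).inv := by
  rw [← cancel_mono (λ_ (dual V)).hom]
  ext : 1
  refine TensorProduct.ext' fun φ c => ?_
  obtain ⟨c⟩ := c
  refine (ev_whiskerRight_assocInvMap V V φ ((coev V).lin (ULift.up c))).trans ?_
  rw [toHom_coev_lin]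
  have h2 : (((ρ_ (dual V)).hom ≫ (λ_ (dual V)).inv) ≫ (λ_ (dual V)).hom).lin
      (φ ⊗ₜ[k] (ULift.up c : ULift.{v} k)) = c • φ := by
    simp only [Category.assoc, Iso.inv_hom_id, Category.comp_id]
    rfl
  rw [h2]
  have h := congrArg (fun a => c • φ ∘ₗ V.act a) A.antipode_Φ_inv
  simp only [map_sum3, map_one] at h
  ext x
  have h3 := congrArg (fun f : Module.Dual k V => f x) h
  simp only [LinearMap.smul_apply, LinearMap.comp_apply, sum3_apply, map_sum3] at h3
  rw [← LinearMap.lsmul_apply, map_sum3] at h3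
  rw [sum3_apply]
  simpa [mul_assoc, PhiInv] using h3

noncomputable instance : HasDuals (Rep hR) where
  lDual := dual
  pairing V :=
    { coevaluation' := coev V
      evaluation' := ev V
      coevaluation_evaluation' := coevaluation_evaluation V
      evaluation_coevaluation' := evaluation_coevaluation V }

end Rep

end QuasiHopfAlgebra

/-! ### The braiding, invertibility of the R-matrix and bijectivity of the antipode -/

section LaxBraiding

open CategoryTheory MonoidalCategory

universe v₁ u₁

/-- A natural transformation satisfying one of the hexagon identities is invertible on objects which
have a dual. -/
theorem CategoryTheory.isIso_of_hexagon {C : Type u₁} [Category.{v₁} C] [MonoidalCategory C]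
    (c : ∀ V W : C, V ⊗ W ⟶ W ⊗ V)
    (natural_left : ∀ {V W : C} (f : V ⟶ W) (X : C), f ▷ X ≫ c W X = c V X ≫ X ◁ f)
    (hexagon : ∀ X Y Z : C, (α_ X Y Z).inv ≫ c (X ⊗ Y) Z ≫ (α_ Z X Y).inv =
      X ◁ c Y Z ≫ (α_ X Z Y).inv ≫ c X Z ▷ Y)
    (unit : ∀ X : C, c (𝟙_ C) X = (λ_ X).hom ≫ (ρ_ X).inv)
    (V V' W : C) [ExactPairing V V'] : IsIso (c V W) := by
  have hex : ∀ X Y Z : C, c (X ⊗ Y) Z =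
      𝟙 _ ⊗≫ X ◁ c Y Z ⊗≫ c X Z ▷ Y ⊗≫ 𝟙 _ := by
    intro X Y Z
    rw [← cancel_epi (α_ X Y Z).inv, ← cancel_mono (α_ Z X Y).inv, Category.assoc, hexagon]
    monoidal
  have h1 := natural_left (η_ V V') W
  have h2 := natural_left (ε_ V V') W
  rw [unit, hex] at h1 h2
  -- The inverse of `c V W` is the mate of `c V' W`. By the hexagon and naturality, `c V W` and `c
  -- V' W` together cancel against the evaluation or the coevaluation.
  refine ⟨⟨𝟙 _ ⊗≫ η_ V V' ▷ W ▷ V ⊗≫ V ◁ c V' W ▷ V ⊗≫ (V ⊗ W) ◁ ε_ V V' ⊗≫ 𝟙 _, ?_, ?_⟩⟩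
  · calc
      _ = 𝟙 _ ⊗≫ (𝟙_ C ◁ c V W ≫ η_ V V' ▷ (W ⊗ V)) ⊗≫ V ◁ c V' W ▷ V ⊗≫
          (V ⊗ W) ◁ ε_ V V' ⊗≫ 𝟙 _ := by monoidal
      _ = 𝟙 _ ⊗≫ η_ V V' ▷ (V ⊗ W) ⊗≫ V ◁ ((𝟙 ((V' ⊗ V) ⊗ W) ⊗≫ V' ◁ c V W ⊗≫ c V' W ▷ V ⊗≫
          𝟙 (W ⊗ (V' ⊗ V))) ≫
          W ◁ ε_ V V') ⊗≫ 𝟙 _ := by rw [whisker_exchange]; monoidal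
      _ = 𝟙 _ ⊗≫ (η_ V V' ▷ V ⊗≫ V ◁ ε_ V V') ▷ W ⊗≫ 𝟙 _ := by
        rw [← h2]; monoidal
      _ = _ := by rw [ExactPairing.evaluation_coevaluation'']; monoidal
  · calc
      _ = 𝟙 _ ⊗≫ η_ V V' ▷ W ▷ V ⊗≫ V ◁ c V' W ▷ V ⊗≫ ((V ⊗ W) ◁ ε_ V V' ≫ c V W ▷ 𝟙_ C) ⊗≫
          𝟙 _ := by monoidal
      _ = 𝟙 _ ⊗≫ (η_ V V' ▷ W ≫ (𝟙 ((V ⊗ V') ⊗ W) ⊗≫ V ◁ c V' W ⊗≫ c V W ▷ V' ⊗≫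
          𝟙 (W ⊗ (V ⊗ V')))) ▷ V ⊗≫
          W ◁ V ◁ ε_ V V' ⊗≫ 𝟙 _ := by rw [whisker_exchange]; monoidal
      _ = 𝟙 _ ⊗≫ W ◁ (η_ V V' ▷ V ⊗≫ V ◁ ε_ V V') ⊗≫ 𝟙 _ := by
        rw [h1]; monoidal
      _ = _ := by rw [ExactPairing.evaluation_coevaluation'']; monoidal

end LaxBraiding

namespace QuasiHopfAlgebra

open QuasiHopf

section Braiding

variable {k H : Type*} [Field k] [Ring H] [Algebra k H] {A : QuasiHopfAlgebra k H}
  {R : H ⊗[k] H} (hR : A.IsRMatrix R)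
  {V W X Y : Type*} [AddCommGroup V] [Module k V] [AddCommGroup W] [Module k W]
  [AddCommGroup X] [Module k X]
  (ρ : H →ₐ[k] Module.End k V) (σ : H →ₐ[k] Module.End k W) (τ : H →ₐ[k] Module.End k X)

theorem braiding_tmul (R : H ⊗[k] H) (x : V) (y : W) :
    braiding R ρ σ (x ⊗ₜ[k] y) = sum2 R fun R1 R2 => σ R2 y ⊗ₜ[k] ρ R1 x := by
  rw [braiding, outerAct_eq_sum2, LinearMap.comp_apply, sum2_apply, map_sum2]
  rfl

include hR in
theorem braiding_tensorAct (h : H) :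
    braiding R ρ σ ∘ₗ A.tensorAct ρ σ h = A.tensorAct σ ρ h ∘ₗ braiding R ρ σ := by
  have h1 := congrArg (outerAct ρ σ) (hR.comul_op h)
  rw [map_mul, map_mul] at h1
  change _ ∘ₗ outerAct ρ σ (A.Δ h) = outerAct σ ρ (A.Δ h) ∘ₗ _
  rw [braiding, LinearMap.comp_assoc, ← Module.End.mul_eq_comp, ← h1, Module.End.mul_eq_comp,
    ← LinearMap.comp_assoc, comm_comp_outerAct, LinearMap.comp_assoc]
  congr 2
  exact (Algebra.TensorProduct.comm k H H).symm_apply_apply (A.Δ h)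

theorem braiding_natural {V' W' : Type*} [AddCommGroup V'] [Module k V'] [AddCommGroup W']
    [Module k W'] {ρ : H →ₐ[k] Module.End k V} {σ : H →ₐ[k] Module.End k W}
    {ρ' : H →ₐ[k] Module.End k V'} {σ' : H →ₐ[k] Module.End k W'} (R : H ⊗[k] H)
    {f : V →ₗ[k] V'} {g : W →ₗ[k] W'} (hf : ∀ a, f ∘ₗ ρ a = ρ' a ∘ₗ f)
    (hg : ∀ a, g ∘ₗ σ a = σ' a ∘ₗ g) :
    braiding R ρ' σ' ∘ₗ TensorProduct.map f g = TensorProduct.map g f ∘ₗ braiding R ρ σ := by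
  rw [braiding, braiding, LinearMap.comp_assoc, ← map_comp_outerAct hf hg]
  simp only [← LinearMap.comp_assoc]
  congr 1
  exact TensorProduct.ext' fun _ _ => rfl

theorem comm_comp_outerAct_rotate (t : H ⊗[k] (H ⊗[k] H)) :
    (TensorProduct.comm k V (W ⊗[k] X)).toLinearMap ∘ₗ
      outerAct ρ (outerAct σ τ) (sum3 t fun x1 x2 x3 => x3 ⊗ₜ[k] (x1 ⊗ₜ[k] x2)) =
    (TensorProduct.assoc k W X V).symm.toLinearMap ∘ₗ outerAct σ (outerAct τ ρ) t ∘ₗ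
      (TensorProduct.assoc k W X V).toLinearMap ∘ₗ
        (TensorProduct.comm k V (W ⊗[k] X)).toLinearMap := by
  rw [map_sum3, outerAct_outerAct_eq_sum3]
  ext x y z
  simp [map_sum3, sum3_apply]

theorem comm_comp_outerAct_rotate' (t : H ⊗[k] (H ⊗[k] H)) :
    (TensorProduct.assoc k X V W).symm.toLinearMap ∘ₗ
    (TensorProduct.comm k (V ⊗[k] W) X).toLinearMap ∘ₗ (TensorProduct.assoc k V W X).symm.toLinearMap ∘ₗ
      outerAct ρ (outerAct σ τ) (sum3 t fun x1 x2 x3 => x2 ⊗ₜ[k] (x3 ⊗ₜ[k] x1)) = 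
    (TensorProduct.assoc k X V W).symm.toLinearMap ∘ₗ outerAct τ (outerAct ρ σ) t ∘ₗ
      (TensorProduct.comm k (V ⊗[k] W) X).toLinearMap ∘ₗ 
        (TensorProduct.assoc k V W X).symm.toLinearMap := by
  rw [map_sum3, outerAct_outerAct_eq_sum3]
  ext x y z
  simp [map_sum3, sum3_apply]

include hR in
-- The formula for `(id ⊗ Δ)(R)`: its outermost factors cancel two of the associators, and the
-- middle three are the right-hand side.
theorem braiding_hexagon_forward :
    A.assocMap σ τ ρ ∘ₗ braiding R ρ (A.tensorAct σ τ) ∘ₗ A.assocMap ρ σ τ =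
      (braiding R ρ τ).lTensor W ∘ₗ A.assocMap σ ρ τ ∘ₗ (braiding R ρ σ).rTensor X := by
  have h1 : (TensorProduct.comm k V (W ⊗[k] X)).toLinearMap ∘ₗ
      outerAct ρ (outerAct σ τ) (sum3 A.PhiInv fun x1 x2 x3 => x3 ⊗ₜ[k] (x1 ⊗ₜ[k] x2)) =
    A.assocInvMap σ τ ρ ∘ₗ
      (TensorProduct.assoc k W X V).toLinearMap ∘ₗ
        (TensorProduct.comm k V (W ⊗[k] X)).toLinearMap := comm_comp_outerAct_rotate ρ σ τ _
  rw [braiding, outerAct_tensorAct_right, hR.comul_right, assocMap.eq_1 A ρ]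
  rw [← LinearMap.comp_assoc (TensorProduct.assoc k V W X).toLinearMap, LinearMap.comp_assoc _ _
    (TensorProduct.comm k V (W ⊗[k] X)).toLinearMap, ← Module.End.mul_eq_comp (outerAct _ _ _), ← map_mul,
    mul_assoc, A.PhiInv_mul_Phi, mul_one]
  simp only [map_mul, Module.End.mul_eq_comp]
  simp only [← LinearMap.comp_assoc]
  rw [LinearMap.comp_assoc _ (TensorProduct.comm k V (W ⊗[k] X)).toLinearMap, h1,
    ← LinearMap.comp_assoc _ _ (A.assocMap σ τ ρ), assocMap_comp_assocInvMap, LinearMap.id_comp]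
  ext x y z
  simp only [map_sum3, sum3_apply, map_sum2, sum2_apply, sum2_tmul,
    braiding_tmul, assocMap_tmul, tmul_sum2, LinearMap.comp_apply, outerAct_tmul,
    TensorProduct.AlgebraTensorModule.curry_apply, LinearMap.restrictScalars_self,
    TensorProduct.curry_apply, LinearMap.rTensor_tmul, LinearMap.lTensor_tmul,
    LinearEquiv.coe_coe, TensorProduct.assoc_tmul, TensorProduct.comm_tmul,
    TensorProduct.map_tmul, map_one, Module.End.one_apply]

include hR in
-- Likewise for `(Δ ⊗ id)(R)`, with the inverse associators.
theorem braiding_hexagon_reverse :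
    A.assocInvMap τ ρ σ ∘ₗ braiding R (A.tensorAct ρ σ) τ ∘ₗ A.assocInvMap ρ σ τ =
      (braiding R ρ τ).rTensor W ∘ₗ A.assocInvMap ρ τ σ ∘ₗ (braiding R σ τ).lTensor V := by
  have h1 := comm_comp_outerAct_rotate' ρ σ τ A.Phi
  have h2 : braiding R (A.tensorAct ρ σ) τ ∘ₗ (TensorProduct.assoc k V W X).symm.toLinearMap =
    (TensorProduct.comm k (V ⊗[k] W) X).toLinearMap ∘ₗ
      (TensorProduct.assoc k V W X).symm.toLinearMap ∘ₗ outerAct ρ (outerAct σ τ)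
        (Algebra.TensorProduct.assoc k k k H H H
        (Algebra.TensorProduct.map A.Δ (AlgHom.id k H) R)) := by
    rw [braiding, outerAct_tensorAct_left, LinearMap.comp_assoc]
    congr 1
    have h := assoc_comp_outerAct ρ σ τ (Algebra.TensorProduct.map A.Δ (AlgHom.id k H) R)
    refine LinearMap.ext fun x => (TensorProduct.assoc k V W X).injective ?_
    have h3 := LinearMap.congr_fun h ((TensorProduct.assoc k V W X).symm x)
    simpa using h3
  have h3 : outerAct ρ (outerAct σ τ) A.Phi ∘ₗ outerAct ρ (outerAct σ τ) A.PhiInv =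
      LinearMap.id := by
    rw [← Module.End.mul_eq_comp, ← map_mul, Phi_mul_PhiInv, map_one]; rfl
  have h4 : outerAct τ (outerAct ρ σ) A.PhiInv ∘ₗ outerAct τ (outerAct ρ σ) A.Phi =
      LinearMap.id := by
    rw [← Module.End.mul_eq_comp, ← map_mul, PhiInv_mul_Phi, map_one]; rfl
  have h5 : (TensorProduct.comm k (V ⊗[k] W) X).toLinearMap ∘ₗ (TensorProduct.assoc k V W X).symm.toLinearMap ∘ₗ
      outerAct ρ (outerAct σ τ) (sum3 A.Phi fun x1 x2 x3 => x2 ⊗ₜ[k] (x3 ⊗ₜ[k] x1)) = 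
    outerAct τ (outerAct ρ σ) A.Phi ∘ₗ
      (TensorProduct.comm k (V ⊗[k] W) X).toLinearMap ∘ₗ 
        (TensorProduct.assoc k V W X).symm.toLinearMap := by
    refine LinearMap.ext fun x => (TensorProduct.assoc k X V W).symm.injective ?_
    exact LinearMap.congr_fun h1 x
  calc
    _ = (TensorProduct.assoc k X V W).symm.toLinearMap ∘ₗ outerAct τ (outerAct ρ σ) A.PhiInv ∘ₗ
        (braiding R (A.tensorAct ρ σ) τ ∘ₗ (TensorProduct.assoc k V W X).symm.toLinearMap) ∘ₗ
        outerAct ρ (outerAct σ τ) A.PhiInv := by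
      simp only [assocInvMap, LinearMap.comp_assoc]
    _ = (TensorProduct.assoc k X V W).symm.toLinearMap ∘ₗ outerAct τ (outerAct ρ σ) A.PhiInv ∘ₗ
        ((TensorProduct.comm k (V ⊗[k] W) X).toLinearMap ∘ₗ
          (TensorProduct.assoc k V W X).symm.toLinearMap ∘ₗ
          outerAct ρ (outerAct σ τ) (sum3 A.Phi fun x1 x2 x3 => x2 ⊗ₜ[k] (x3 ⊗ₜ[k] x1))) ∘ₗ
        outerAct ρ (outerAct σ τ) (sum2 R (fun R1 R2 => R1 ⊗ₜ[k] ((1 : H) ⊗ₜ[k] R2))) ∘ₗ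
        outerAct ρ (outerAct σ τ) (sum3 A.PhiInv (fun x1 x2 x3 => x1 ⊗ₜ[k] (x3 ⊗ₜ[k] x2))) ∘ₗ
        outerAct ρ (outerAct σ τ) (sum2 R (fun R1 R2 => (1 : H) ⊗ₜ[k] (R1 ⊗ₜ[k] R2))) ∘ₗ
        (outerAct ρ (outerAct σ τ) A.Phi ∘ₗ outerAct ρ (outerAct σ τ) A.PhiInv) := by
      rw [h2, hR.comul_left]
      simp only [map_mul, Module.End.mul_eq_comp, LinearMap.comp_assoc]
    _ = (TensorProduct.assoc k X V W).symm.toLinearMap ∘ₗ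
        (outerAct τ (outerAct ρ σ) A.PhiInv ∘ₗ outerAct τ (outerAct ρ σ) A.Phi) ∘ₗ
        (TensorProduct.comm k (V ⊗[k] W) X).toLinearMap ∘ₗ
          (TensorProduct.assoc k V W X).symm.toLinearMap ∘ₗ
        outerAct ρ (outerAct σ τ) (sum2 R (fun R1 R2 => R1 ⊗ₜ[k] ((1 : H) ⊗ₜ[k] R2))) ∘ₗ
        outerAct ρ (outerAct σ τ) (sum3 A.PhiInv (fun x1 x2 x3 => x1 ⊗ₜ[k] (x3 ⊗ₜ[k] x2))) ∘ₗ
        outerAct ρ (outerAct σ τ) (sum2 R (fun R1 R2 => (1 : H) ⊗ₜ[k] (R1 ⊗ₜ[k] R2))) := by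
      rw [h3, h5]
      simp only [LinearMap.comp_assoc, LinearMap.comp_id]
    _ = _ := by
      rw [h4, LinearMap.id_comp]
      ext x y z
      simp only [map_sum3, sum3_apply, map_sum2, sum2_apply, sum2_tmul,
        braiding_tmul, assocInvMap_tmul, tmul_sum2, LinearMap.comp_apply, outerAct_tmul,
        TensorProduct.AlgebraTensorModule.curry_apply, LinearMap.restrictScalars_self,
        TensorProduct.curry_apply, LinearMap.rTensor_tmul, LinearMap.lTensor_tmul,
        LinearEquiv.coe_coe, TensorProduct.assoc_symm_tmul, TensorProduct.comm_tmul,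
        TensorProduct.map_tmul, map_one, Module.End.one_apply]

end Braiding

namespace Rep

open CategoryTheory MonoidalCategory

variable {k : Type u} {H : Type v} [Field k] [Ring H] [Algebra k H] {A : QuasiHopfAlgebra k H}
  {R : H ⊗[k] H} {hR : A.IsRMatrix R}

/-- The braiding, as a morphism. -/
noncomputable def braid (V W : Rep hR) : V ⊗ W ⟶ W ⊗ V :=
  ⟨braiding R V.act W.act, braiding_tensorAct hR V.act W.act⟩

@[simp] theorem braid_lin (V W : Rep hR) : (braid V W).lin = braiding R V.act W.act := rfl

theorem braid_natural {V W X Y : Rep hR} (f : V ⟶ W) (g : X ⟶ Y) :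
    (f ⊗ₘ g) ≫ braid W Y = braid V X ≫ (g ⊗ₘ f) := by
  ext : 1
  exact braiding_natural R f.comm g.comm

theorem braid_hexagon_reverse (X Y Z : Rep hR) :
    (α_ X Y Z).inv ≫ braid (X ⊗ Y) Z ≫ (α_ Z X Y).inv =
      X ◁ braid Y Z ≫ (α_ X Z Y).inv ≫ braid X Z ▷ Y := by
  ext : 1
  exact braiding_hexagon_reverse hR X.act Y.act Z.act

theorem braid_hexagon_forward (X Y Z : Rep hR) :
    (α_ X Y Z).hom ≫ braid X (Y ⊗ Z) ≫ (α_ Y Z X).hom =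
      braid X Y ▷ Z ≫ (α_ Y X Z).hom ≫ Y ◁ braid X Z := by
  ext : 1
  exact braiding_hexagon_forward hR X.act Y.act Z.act

theorem braid_unit (X : Rep hR) : braid (𝟙_ (Rep hR)) X = (λ_ X).hom ≫ (ρ_ X).inv := by
  ext : 1
  have h : outerAct (A.trivialAct (ULift.{v} k)) X.act R = LinearMap.id := by
    rw [trivialAct, outerAct_comp_left, hR.counit_left, map_one]
    rfl
  refine TensorProduct.ext' fun c x => ?_
  change TensorProduct.comm k (ULift.{v} k) X (outerAct (A.trivialAct (ULift.{v} k)) X.act R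
    (c ⊗ₜ[k] x)) = (ρ_ X).inv.lin ((λ_ X).hom.lin (c ⊗ₜ[k] x))
  rw [h, leftUnitor_hom_lin_tmul, rightUnitor_inv_lin_apply, TensorProduct.smul_tmul]
  change x ⊗ₜ[k] c = x ⊗ₜ[k] (c.down • (ULift.up 1 : ULift.{v} k))
  congr 1
  exact ULift.down_injective (mul_one c.down).symm

instance (V W : Rep hR) : IsIso (braid V W) :=
  isIso_of_hexagon braid (fun f X => by simpa using braid_natural f (𝟙 X))
    braid_hexagon_reverse braid_unit V (lDual V) W

noncomputable instance : BraidedCategory (Rep hR) where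
  braiding V W := asIso (braid V W)
  braiding_naturality_right X {_ _} f := by simpa using braid_natural (𝟙 X) f
  braiding_naturality_left f X := by simpa using braid_natural f (𝟙 X)
  hexagon_forward := braid_hexagon_forward
  hexagon_reverse := braid_hexagon_reverse

@[simp] theorem braiding_hom_lin (V W : Rep hR) :
    (β_ V W).hom.lin = braiding R V.act W.act := rfl

variable (hR) [FiniteDimensional k H]

/-- The regular module. -/
noncomputable abbrev regular : Rep hR where
  carrier := ULift.{u} H
  act := (LinearEquiv.conjAlgEquiv k (ULift.moduleEquiv (R := k) (M := H)).symm).toAlgHom.comp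
    (Algebra.lmul k H)

theorem regular_act (h x : H) : (regular hR).act h (ULift.up x) = ULift.up (h * x) := rfl

include hR in
-- The braiding on the regular module is invertible, and a preimage of `1 ⊗ 1` is a right inverse of
-- `R`.
theorem isUnit_R : IsUnit R := by
  have h1 : Function.Surjective (braid (regular hR) (regular hR)).lin := fun y =>
    ⟨(inv (braid (regular hR) (regular hR))).lin y, by
      rw [← LinearMap.comp_apply, ← comp_lin, IsIso.inv_hom_id]; rfl⟩
  obtain ⟨t, ht⟩ := h1 ((ULift.up 1 : ULift.{u} H) ⊗ₜ[k] (ULift.up 1 : ULift.{u} H))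
  let e := TensorProduct.congr (ULift.moduleEquiv (R := k) (M := H) : ULift.{u} H ≃ₗ[k] H)
    (ULift.moduleEquiv (R := k) (M := H) : ULift.{u} H ≃ₗ[k] H)
  have h2 : ∀ (r : H ⊗[k] H) t, e (outerAct (regular hR).act (regular hR).act r t) = r * e t := by
    intro r t
    induction r with
    | zero => simp
    | add x y hx hy => simp [hx, hy, add_mul]
    | tmul a b =>
      induction t with
      | zero => simp
      | add x y hx hy => simp only [map_add, hx, hy, mul_add]
      | tmul x y =>
        rw [outerAct_tmul]
        exact (Algebra.TensorProduct.tmul_mul_tmul a x.down b y.down).symm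
  have h3 : R * e t = 1 := by
    rw [← h2]
    have h4 := congrArg (TensorProduct.comm k _ _) ht
    have h5 : outerAct (regular hR).act (regular hR).act R t =
      (ULift.up 1 : ULift.{u} H) ⊗ₜ[k] (ULift.up 1 : ULift.{u} H) := by
      simpa [braiding] using h4
    rw [h5]
    rfl
  -- In a finite-dimensional algebra a one-sided inverse is two-sided.
  have : IsNoetherianRing (H ⊗[k] H) := isNoetherian_of_tower k inferInstance
  exact IsUnit.of_mul_eq_one _ h3

theorem braiding_inv_lin (V W : Rep hR) : (β_ V W).inv.lin =
    outerAct V.act W.act (Ring.inverse R) ∘ₗ (TensorProduct.comm k W V).toLinearMap := by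
  have h1 : (β_ V W).inv.lin ∘ₗ braiding R V.act W.act = LinearMap.id := by
    rw [← braiding_hom_lin, ← comp_lin, Iso.hom_inv_id]; rfl
  have h2 : outerAct V.act W.act R ∘ₗ outerAct V.act W.act (Ring.inverse R) = LinearMap.id := by
    rw [← Module.End.mul_eq_comp, ← map_mul, Ring.mul_inverse_cancel _ (isUnit_R hR), map_one]; rfl
  refine LinearMap.ext fun x => ?_
  obtain ⟨y, rfl⟩ := (TensorProduct.comm k V W).surjective x
  have h3 := LinearMap.congr_fun h1 (outerAct V.act W.act (Ring.inverse R) y)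
  have h4 := LinearMap.congr_fun h2 y
  simp only [LinearMap.comp_apply, braiding, LinearEquiv.coe_coe, LinearMap.id_apply] at h3 h4
  rw [h4] at h3
  rw [h3]
  exact congrArg (outerAct V.act W.act (Ring.inverse R))
    ((TensorProduct.comm k V W).symm_apply_apply y).symm

include hR in
-- The braiding makes `V` a dual of `V*`, so `V ≅ V**`. An element killed by `S` acts as zero on
-- `V**`, hence on the regular module, hence vanishes; injectivity suffices in finite dimension.
theorem S_bijective : Function.Bijective A.S := by
  have h1 : Function.Injective A.S := by
    refine (injective_iff_map_eq_zero A.S).2 fun x hx => ?_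
    let V := regular hR
    let e : V ≅ lDual (lDual V) := rightDualIso (BraidedCategory.exactPairing_swap V (lDual V))
      (HasDuals.pairing (lDual V))
    have h2 : (lDual (lDual V)).act x = 0 := by
      refine LinearMap.ext fun φ => ?_
      change φ ∘ₗ (lDual V).act (A.S x) = 0
      rw [hx, map_zero, LinearMap.comp_zero]
    have h3 := LinearMap.congr_fun (e.hom.comm x) (ULift.up 1 : ULift.{u} H)
    rw [h2] at h3
    have h4 : V.act x (ULift.up 1 : ULift.{u} H) = e.inv.lin (e.hom.lin (V.act x (ULift.up 1 : ULift.{u} H))) := by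
      rw [← LinearMap.comp_apply, ← comp_lin, Iso.hom_inv_id]; rfl
    have h5 : e.hom.lin (V.act x (ULift.up 1 : ULift.{u} H)) = 0 := h3
    rw [h5, map_zero] at h4
    have h6 := congrArg ULift.down h4
    simpa [V, regular_act] using h6
  exact ⟨h1, LinearMap.injective_iff_surjective.1 h1⟩

include hR in
theorem S_Sinv (x : H) : A.S (A.Sinv x) = x := by
  rw [Sinv, dif_pos (S_bijective hR)]
  exact (LinearEquiv.ofBijective A.S (S_bijective hR)).apply_symm_apply x

end Rep

end QuasiHopfAlgebra

/-! ### The universal families of `H` and `H*` -/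

namespace QuasiHopfAlgebra

open QuasiHopf

namespace Rep

open CategoryTheory MonoidalCategory

variable {k : Type u} {H : Type v} [Field k] [Ring H] [Algebra k H] {A : QuasiHopfAlgebra k H}
  {R : H ⊗[k] H} {hR : A.IsRMatrix R}

theorem mono_of_injective {V W : Rep hR} (f : V ⟶ W) (h : Function.Injective f.lin) : Mono f where
  right_cancellation a b hab := by
    ext x
    exact h (LinearMap.congr_fun (congrArg Hom.lin hab) x)

theorem epi_of_surjective {V W : Rep hR} (f : V ⟶ W) (h : Function.Surjective f.lin) : Epi f where
  left_cancellation a b hab := by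
    ext x
    obtain ⟨y, rfl⟩ := h x
    exact LinearMap.congr_fun (congrArg Hom.lin hab) y

theorem ev_eq (V : Rep hR) : ε_ V (lDual V) = ev V := rfl

theorem coev_eq (V : Rep hR) : η_ V (lDual V) = coev V := rfl

/-- The transpose of a morphism. -/
noncomputable def transpose {V W : Rep hR} (f : V ⟶ W) : lDual W ⟶ lDual V where
  lin := f.lin.dualMap
  comm h := by
    refine LinearMap.ext fun (φ : Module.Dual k W) => LinearMap.ext fun (x : V) => ?_
    exact congrArg φ (LinearMap.congr_fun (f.comm (A.S h)).symm x)

/-- The evaluation is twisted by `α`, but a module map commutes with `α`; hence the categorical dual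
is the ordinary transpose. -/
theorem dualHom_eq_transpose {V W : Rep hR} (f : V ⟶ W) : dualHom f = transpose f := by
  refine dualHom_unique ?_
  ext : 1
  refine TensorProduct.ext' fun (φ : Module.Dual k W) (x : V) => ?_
  change (ev V).lin (f.lin.dualMap φ ⊗ₜ[k] x) = (ev W).lin (φ ⊗ₜ[k] f.lin x)
  rw [ev_lin_tmul, ev_lin_tmul]
  exact congrArg (fun x => ULift.up (φ x)) (LinearMap.congr_fun (f.comm A.α) x)

theorem dualHom_lin {V W : Rep hR} (f : V ⟶ W) : (dualHom f).lin = f.lin.dualMap := by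
  rw [dualHom_eq_transpose]; rfl

variable (hR) [FiniteDimensional k H]

/-- The adjoint module. -/
noncomputable abbrev adjoint : Rep hR where
  carrier := ULift.{u} H
  act := (LinearEquiv.conjAlgEquiv k (ULift.moduleEquiv (R := k) (M := H)).symm).toAlgHom.comp
    A.adAct

/-- The coadjoint module. -/
noncomputable abbrev coadjoint : Rep hR where
  carrier := Module.Dual k H
  act := A.coadAct

variable {hR}

/-- The morphism from the adjoint module to `V ⊗ V* ≅ End(V)` given by the action. -/
noncomputable def toEnd (V : Rep hR) : adjoint hR ⟶ V ⊗ lDual V where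
  lin := LinearMap.applyₗ (coevaluation k V 1) ∘ₗ LinearMap.rTensorHom (Module.Dual k V) ∘ₗ
    V.act.toLinearMap ∘ₗ ULift.moduleEquiv.toLinearMap
  comm h := by
    refine LinearMap.ext fun x => toHom_injective ?_
    obtain ⟨x⟩ := x
    change toHom k V V ((V.act (A.adAct h x)).rTensor _ (coevaluation k V 1)) =
      toHom k V V (A.tensorAct V.act (A.dualAct V.act) h ((V.act x).rTensor _ (coevaluation k V 1)))
    rw [toHom_tensorAct_dualAct, toHom_rTensor_coevaluation, toHom_rTensor_coevaluation,
      adAct_apply, map_sum2, one_smul, one_smul]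
    congr! 3
    rw [map_mul, map_mul, mul_assoc]
    rfl

theorem toHom_toEnd_lin (V : Rep hR) (x : H) :
    toHom k V V ((toEnd V).lin (ULift.up x)) = V.act x :=
  (toHom_rTensor_coevaluation _ _).trans (one_smul _ _)

/-- Left multiplication by `x` is determined by its value at `1`. -/
theorem toEnd_injective : Function.Injective (toEnd (regular hR)).lin := by
  intro x y h
  have h1 := congrArg (toHom k _ _) h
  obtain ⟨x⟩ := x
  obtain ⟨y⟩ := y
  rw [toHom_toEnd_lin, toHom_toEnd_lin] at h1
  have h2 := LinearMap.congr_fun h1 (ULift.up 1)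
  rw [regular_act, regular_act] at h2
  simpa using h2

/-- The universal extranatural family. -/
noncomputable def endFamily : EndFamily (adjoint hR) where
  map := toEnd
  extranatural {V W} f := by
    ext : 1
    refine LinearMap.ext fun x => toHom_injective ?_
    obtain ⟨x⟩ := x
    change toHom k V W (TensorProduct.map f.lin (LinearMap.id.dualMap) ((toEnd V).lin (ULift.up x))) =
      toHom k V W (TensorProduct.map LinearMap.id (dualHom f).lin ((toEnd W).lin (ULift.up x)))
    rw [dualHom_lin, toHom_map, toHom_map, toHom_toEnd_lin, toHom_toEnd_lin]
    exact f.comm x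

theorem endFamily_faithful : (endFamily (hR := hR)).action.Faithful := by
  have : ∀ Y : Rep hR, Mono (endFamily.map (regular hR) ▷ Y) := fun Y =>
    mono_of_injective _ (Module.Flat.rTensor_preserves_injective_linearMap _ toEnd_injective)
  exact endFamily.faithful (regular hR)

/-- The matrix coefficients `φ ⊗ x ↦ (h ↦ φ(h x))` of a module. -/
noncomputable def coeffMap {V : Type*} [AddCommGroup V] [Module k V] (ρ : H →ₐ[k] Module.End k V) :
    Module.Dual k V ⊗[k] V →ₗ[k] Module.Dual k H :=
  TensorProduct.lift (LinearMap.mk₂ k (fun φ x => φ ∘ₗ ρ.toLinearMap.flip x)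
    (fun _ _ _ => rfl) (fun _ _ _ => rfl) (fun φ x y => by ext; simp) (fun c φ x => by ext; simp))

omit [FiniteDimensional k H] in
@[simp]
theorem coeffMap_tmul {V : Type*} [AddCommGroup V] [Module k V] (ρ : H →ₐ[k] Module.End k V)
    (φ : Module.Dual k V) (x : V) (h : H) : coeffMap ρ (φ ⊗ₜ[k] x) h = φ (ρ h x) := rfl

/-- The matrix coefficients of a module, as a morphism to the coadjoint module. -/
noncomputable def coeff (V : Rep hR) : lDual V ⊗ V ⟶ coadjoint hR where
  lin := coeffMap V.act
  comm h := by
    refine TensorProduct.ext' fun φ x => ?_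
    change coeffMap V.act (A.tensorAct (A.dualAct V.act) V.act h (φ ⊗ₜ[k] x)) =
      A.coadAct h (coeffMap V.act (φ ⊗ₜ[k] x))
    rw [coadAct_apply, tensorAct_eq_sum2, sum2_apply, map_sum2]
    congr! 3
    ext g
    simp [dualBiact, sandwich]

theorem coeff_lin_tmul (V : Rep hR) (φ : Module.Dual k V) (x : V) :
    (coeff V).lin (φ ⊗ₜ[k] x) = coeffMap V.act (φ ⊗ₜ[k] x) := rfl

/-- Every functional is the matrix coefficient of the regular module at the vector `1`. -/
theorem coeff_surjective : Function.Surjective (coeff (regular hR)).lin := by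
  intro χ
  refine ⟨(χ ∘ₗ ULift.moduleEquiv.toLinearMap) ⊗ₜ[k] (ULift.up 1 : ULift.{u} H), ?_⟩
  rw [coeff_lin_tmul]
  refine LinearMap.ext fun h => ?_
  rw [coeffMap_tmul, regular_act, mul_one]
  rfl

/-- The universal dinatural family. -/
noncomputable def coendFamily : CoendFamily (coadjoint hR) where
  map := coeff
  dinatural {V W} f := by
    ext : 1
    refine TensorProduct.ext' fun (φ : Module.Dual k W) (x : V) => ?_
    change (coeff V).lin ((dualHom f).lin φ ⊗ₜ[k] x) = (coeff W).lin (φ ⊗ₜ[k] f.lin x)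
    rw [coeff_lin_tmul, coeff_lin_tmul, dualHom_lin]
    refine LinearMap.ext fun h => ?_
    exact congrArg φ (LinearMap.congr_fun (f.comm h) x)

theorem coendFamily_faithful : (coendFamily (hR := hR)).coaction.Faithful := by
  have : ∀ Y : Rep hR, Epi (Y ◁ coendFamily.map (regular hR)) := fun Y =>
    epi_of_surjective _ (LinearMap.lTensor_surjective _ coeff_surjective)
  exact coendFamily.faithful (regular hR)

end Rep

end QuasiHopfAlgebra

/-! ### Contractions, and duality data of a tensor product -/

section

open CategoryTheory MonoidalCategory

variable {C : Type*} [Category C] [MonoidalCategory C] (V V' W W' : C) [ExactPairing V V']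
  [ExactPairing W W']

theorem CategoryTheory.evaluation_tensor : ε_ (V ⊗ W) (W' ⊗ V') =
    (α_ (W' ⊗ V') V W).inv ≫ ((α_ W' V' V).hom ≫ W' ◁ ε_ V V' ≫ (ρ_ W').hom) ▷ W ≫ ε_ W W' := by
  rw [ExactPairing.tensor_evaluation]
  monoidal

theorem CategoryTheory.coevaluation_tensor : η_ (V ⊗ W) (W' ⊗ V') =
    η_ V V' ≫ ((ρ_ V).inv ≫ V ◁ η_ W W' ≫ (α_ V W W').inv) ▷ V' ≫ (α_ (V ⊗ W) W' V').hom := by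
  rw [ExactPairing.tensor_coevaluation]
  monoidal

end

namespace QuasiHopf

section Contraction

variable {k : Type*} [Field k] {V W Y Z : Type*} [AddCommGroup V] [Module k V]
  [AddCommGroup W] [Module k W] [AddCommMonoid Y] [Module k Y] [AddCommGroup Z] [Module k Z]

theorem map_sum4 {M N L K P P' : Type*} [AddCommMonoid M] [Module k M] [AddCommMonoid N]
    [Module k N] [AddCommMonoid L] [Module k L] [AddCommMonoid K] [Module k K] [AddCommMonoid P]
    [AddCommMonoid P'] {F : Type*} [FunLike F P P'] [AddMonoidHomClass F P P'] (g : F)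
    (t : M ⊗[k] (N ⊗[k] (L ⊗[k] K))) (f : M → N → L → K → P) :
    g (sum4 t f) = sum4 t fun a b c d => g (f a b c d) := by
  simp only [sum4, map_sum2, map_sum3]

theorem sum4_apply {M N L K P P' : Type*} [AddCommMonoid M] [Module k M] [AddCommMonoid N]
    [Module k N] [AddCommMonoid L] [Module k L] [AddCommMonoid K] [Module k K] [AddCommMonoid P]
    [AddCommMonoid P'] [Module k P] [Module k P']
    (t : M ⊗[k] (N ⊗[k] (L ⊗[k] K))) (f : M → N → L → K → P →ₗ[k] P') (x : P) :
    sum4 t f x = sum4 t fun a b c d => f a b c d x :=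
  map_sum4 (LinearMap.applyₗ x) t f

variable (Z) in
/-- `z ⊗ y ↦ ℓ(y) z` -/
noncomputable def ctr (ℓ : Module.Dual k Y) : Z ⊗[k] Y →ₗ[k] Z :=
  (TensorProduct.rid k Z).toLinearMap ∘ₗ ℓ.lTensor Z

@[simp]
theorem ctr_tmul (ℓ : Module.Dual k Y) (z : Z) (y : Y) : ctr Z ℓ (z ⊗ₜ[k] y) = ℓ y • z := by
  simp [ctr]

theorem ctr_lTensor {Y' : Type*} [AddCommMonoid Y'] [Module k Y'] (ℓ : Module.Dual k Y)
    (f : Y' →ₗ[k] Y) (t : Z ⊗[k] Y') : ctr Z ℓ (f.lTensor Z t) = ctr Z (ℓ ∘ₗ f) t := by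
  induction t with
  | zero => simp
  | add x y hx hy => simp only [map_add, hx, hy]
  | tmul z y => simp

/-- `φ ⊗ ψ ↦ φ(v) ψ(w)` -/
noncomputable def evalAt (v : V) (w : W) : Module.Dual k (Module.Dual k V ⊗[k] Module.Dual k W) :=
  TensorProduct.dualDistrib k _ _ (Module.Dual.eval k V v ⊗ₜ Module.Dual.eval k W w)

@[simp]
theorem evalAt_tmul (v : V) (w : W) (φ : Module.Dual k V) (ψ : Module.Dual k W) :
    evalAt v w (φ ⊗ₜ[k] ψ) = φ v * ψ w := rfl

theorem evalAt_eq (v : V) (w : W) (s : Module.Dual k V ⊗[k] Module.Dual k W) :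
    evalAt v w s = TensorProduct.dualDistrib k V W s (v ⊗ₜ[k] w) := by
  induction s with
  | zero => simp
  | add x y hx hy => simp only [map_add, hx, hy, LinearMap.add_apply]
  | tmul φ ψ => rfl

variable [FiniteDimensional k V] [FiniteDimensional k W]

theorem evalAt_ext {s t : Module.Dual k V ⊗[k] Module.Dual k W}
    (h : ∀ v w, evalAt v w s = evalAt v w t) : s = t := by
  refine (TensorProduct.dualDistribEquiv k V W).injective ?_
  refine TensorProduct.ext' fun v w => ?_
  have := h v w
  rw [evalAt_eq, evalAt_eq] at this
  exact this

/-- Tensors with two dual factors are compared by contracting these with arbitrary vectors. -/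
theorem ctr_evalAt_ext {s t : Z ⊗[k] (Module.Dual k V ⊗[k] Module.Dual k W)}
    (h : ∀ v w, ctr Z (evalAt v w) s = ctr Z (evalAt v w) t) : s = t := by
  let e := LinearEquiv.lTensor Z (TensorProduct.dualDistribEquiv k V W)
  refine e.injective (QuasiHopfAlgebra.toHom_injective (TensorProduct.ext' fun v w => ?_))
  have h1 : ∀ s : Z ⊗[k] (Module.Dual k V ⊗[k] Module.Dual k W),
      QuasiHopfAlgebra.toHom k (V ⊗[k] W) Z (e s) (v ⊗ₜ[k] w) = ctr Z (evalAt v w) s := by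
    intro s
    induction s with
    | zero => simp
    | add x y hx hy => simp only [map_add, LinearMap.add_apply, hx, hy]
    | tmul z y =>
      change QuasiHopfAlgebra.toHom k (V ⊗[k] W) Z (z ⊗ₜ[k] TensorProduct.dualDistrib k V W y)
        (v ⊗ₜ[k] w) = _
      rw [QuasiHopfAlgebra.toHom_tmul, ctr_tmul, evalAt_eq]
  rw [h1, h1, h]

theorem coevaluation_eq_sum2 :
    coevaluation k V 1 = sum2 (coevaluation k V 1) fun v φ => v ⊗ₜ[k] φ :=
  (sum2_eq (coevaluation k V 1) LinearMap.id).symm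

/-- The dual basis formula, by which all coevaluations are eliminated below. -/
theorem sum2_coevaluation (f : V →ₗ[k] Z) (u : V) :
    (sum2 (coevaluation k V 1) fun v φ => φ u • f v) = f u := by
  have h := LinearMap.congr_fun (QuasiHopfAlgebra.toHom_coevaluation (k := k) (V := V)) u
  rw [coevaluation_eq_sum2, map_sum2, sum2_apply] at h
  have h1 := congrArg f h
  rw [map_sum2] at h1
  simpa using h1

end Contraction

end QuasiHopf

namespace QuasiHopfAlgebra

open QuasiHopf

namespace Rep

open CategoryTheory MonoidalCategory

variable {k : Type u} {H : Type v} [Field k] [Ring H] [Algebra k H] {A : QuasiHopfAlgebra k H}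
  {R : H ⊗[k] H} {hR : A.IsRMatrix R}

theorem coev_lin_eq_sum2 (V : Rep hR) : (coev V).lin (ULift.up 1) =
    sum2 (coevaluation k V 1) fun x φ => V.act A.β x ⊗ₜ[k] φ := by
  change (V.act A.β).rTensor (Module.Dual k V) (coevaluation k V 1) = _
  conv_lhs => rw [coevaluation_eq_sum2]
  rw [map_sum2]
  rfl

theorem evaluation_tensor (V W : Rep hR) : ε_ (V ⊗ W) (lDual W ⊗ lDual V) =
    (α_ (lDual W ⊗ lDual V) V W).inv ≫ ((α_ (lDual W) (lDual V) V).hom ≫ lDual W ◁ ev V ≫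
      (ρ_ (lDual W)).hom) ▷ W ≫ ev W :=
  CategoryTheory.evaluation_tensor V (lDual V) W (lDual W)

theorem coevaluation_tensor (V W : Rep hR) : η_ (V ⊗ W) (lDual W ⊗ lDual V) =
    coev V ≫ ((ρ_ V).inv ≫ V ◁ coev W ≫ (α_ V W (lDual W)).inv) ▷ lDual V ≫
      (α_ (V ⊗ W) (lDual W) (lDual V)).hom :=
  CategoryTheory.coevaluation_tensor V (lDual V) W (lDual W)

/-- The pairing of `W* ⊗ V*` with `V ⊗ W` is given by `γ`. -/
theorem evaluation_tensor_lin (V W : Rep hR) (y : Module.Dual k W ⊗[k] Module.Dual k V)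
    (x : V ⊗[k] W) : (ε_ (V ⊗ W) (lDual W ⊗ lDual V)).lin (y ⊗ₜ[k] x) =
      ULift.up (TensorProduct.dualDistrib k V W (TensorProduct.comm k _ _ y)
        (outerAct V.act W.act A.γ x)) := by
  -- The nested pairing: `V*` with `V` first, then `W*` with `W`, each through `α`. Preceding it by
  -- the two reassociations of the evaluation gives the element defining `γ`.
  let κ : Module.Dual k W ⊗[k] (Module.Dual k V ⊗[k] (V ⊗[k] W)) →ₗ[k] k :=
    (contractLeft k W ∘ₗ (W.act A.α).lTensor _) ∘ₗ
      ((TensorProduct.lid k W).toLinearMap ∘ₗ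
        (contractLeft k V ∘ₗ (V.act A.α).lTensor _).rTensor W ∘ₗ
        (TensorProduct.assoc k (Module.Dual k V) V W).symm.toLinearMap).lTensor (Module.Dual k W)
  let P := outerAct (A.dualAct W.act) (outerAct (A.dualAct V.act) (outerAct V.act W.act))
  have hγ : ∀ (t : H ⊗[k] (H ⊗[k] (H ⊗[k] H))) (ψ : Module.Dual k W) (φ : Module.Dual k V)
      (x : V) (y : W), κ (P t (ψ ⊗ₜ[k] (φ ⊗ₜ[k] (x ⊗ₜ[k] y)))) =
      TensorProduct.dualDistrib k V W (φ ⊗ₜ[k] ψ) (outerAct V.act W.act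
        (sum4 t fun A1 A2 A3 A4 => (A.S A2 * A.α * A3) ⊗ₜ[k] (A.S A1 * A.α * A4)) (x ⊗ₜ[k] y)) := by
    intro t ψ φ x y
    rw [map_sum4, sum4_apply, map_sum4]
    refine (sum4_eq t (κ ∘ₗ LinearMap.applyₗ (ψ ⊗ₜ[k] (φ ⊗ₜ[k] (x ⊗ₜ[k] y))) ∘ₗ
      P.toLinearMap)).symm.trans ?_
    congr! 5 with a b c d
    simp [P, κ]
  have h2 : (ev W).lin ∘ₗ (((ρ_ (lDual W)).hom.lin ∘ₗ (ev V).lin.lTensor (Module.Dual k W)).rTensor W) =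
      ULift.moduleEquiv.symm.toLinearMap ∘ₗ κ ∘ₗ
        (TensorProduct.assoc k (Module.Dual k V) V W).toLinearMap.lTensor (Module.Dual k W) ∘ₗ
        (TensorProduct.assoc k (Module.Dual k W) (Module.Dual k V ⊗[k] V) W).toLinearMap := by
    refine TensorProduct.ext (TensorProduct.ext (LinearMap.ext fun (ψ : Module.Dual k W) =>
      TensorProduct.ext (LinearMap.ext₂ fun (φ : Module.Dual k V) (x : V) =>
        LinearMap.ext fun (z : W) => ?_)))
    change (ev W).lin ((φ (V.act A.α x) • ψ) ⊗ₜ[k] z) =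
      ULift.up (ψ (W.act A.α (φ (V.act A.α x) • z)))
    rw [ev_lin_tmul, map_smul, map_smul]
    rfl
  have h3 := lTensor_assoc_comp_rTensor_outerAct (A.dualAct W.act) (A.dualAct V.act) V.act W.act A.Phi
  have h4 := assoc_comp_outerAct_tensorAct (A := A) (A.dualAct W.act) (A.dualAct V.act) V.act W.act A.PhiInv
  have h5 : (TensorProduct.assoc k (Module.Dual k V) V W).toLinearMap.lTensor (Module.Dual k W) ∘ₗ
        (TensorProduct.assoc k (Module.Dual k W) (Module.Dual k V ⊗[k] V) W).toLinearMap ∘ₗ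
        (TensorProduct.assoc k (Module.Dual k W) (Module.Dual k V) V).toLinearMap.rTensor W ∘ₗ
        (TensorProduct.assoc k (Module.Dual k W ⊗[k] Module.Dual k V) V W).symm.toLinearMap =
      (TensorProduct.assoc k (Module.Dual k W) (Module.Dual k V) (V ⊗[k] W)).toLinearMap := by
    refine TensorProduct.ext_fourfold' fun a b c d => ?_
    rfl
  have h6 : (ε_ (V ⊗ W) (lDual W ⊗ lDual V)).lin = ULift.moduleEquiv.symm.toLinearMap ∘ₗ κ ∘ₗ
      P (Algebra.TensorProduct.map (AlgHom.id k H)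
          (Algebra.TensorProduct.map (AlgHom.id k H) Algebra.TensorProduct.includeLeft) A.Phi *
        Algebra.TensorProduct.assoc k k k H H (H ⊗[k] H)
          (Algebra.TensorProduct.map A.Δ (AlgHom.id k (H ⊗[k] H)) A.PhiInv)) ∘ₗ
      (TensorProduct.assoc k (Module.Dual k W) (Module.Dual k V) (V ⊗[k] W)).toLinearMap := by
    rw [evaluation_tensor]
    change (ev W).lin ∘ₗ (((ρ_ (lDual W)).hom.lin ∘ₗ (ev V).lin.lTensor (Module.Dual k W)) ∘ₗ
      outerAct (A.dualAct W.act) (outerAct (A.dualAct V.act) V.act) A.Phi ∘ₗ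
        (TensorProduct.assoc k (Module.Dual k W) (Module.Dual k V) V).toLinearMap).rTensor W ∘ₗ
      (TensorProduct.assoc k (Module.Dual k W ⊗[k] Module.Dual k V) V W).symm.toLinearMap ∘ₗ
      outerAct (A.tensorAct (A.dualAct W.act) (A.dualAct V.act)) (outerAct V.act W.act) A.PhiInv = _
    rw [map_mul, Module.End.mul_eq_comp]
    simp only [P, LinearMap.comp_assoc]
    rw [← h4, ← h5, LinearMap.rTensor_comp,
      LinearMap.rTensor_comp]
    have h7 := congrArg (fun z => ULift.moduleEquiv.symm.toLinearMap ∘ₗ κ ∘ₗ z ∘ₗ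
      (TensorProduct.assoc k (Module.Dual k W) (Module.Dual k V) V).toLinearMap.rTensor W ∘ₗ
      (TensorProduct.assoc k (Module.Dual k W ⊗[k] Module.Dual k V) V W).symm.toLinearMap ∘ₗ
      outerAct (A.tensorAct (A.dualAct W.act) (A.dualAct V.act)) (outerAct V.act W.act) A.PhiInv) h3
    have h8 := congrArg (fun z => z ∘ₗ
      (outerAct (A.dualAct W.act) (outerAct (A.dualAct V.act) V.act) A.Phi).rTensor W ∘ₗ
      (TensorProduct.assoc k (Module.Dual k W) (Module.Dual k V) V).toLinearMap.rTensor W ∘ₗ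
      (TensorProduct.assoc k (Module.Dual k W ⊗[k] Module.Dual k V) V W).symm.toLinearMap ∘ₗ
      outerAct (A.tensorAct (A.dualAct W.act) (A.dualAct V.act)) (outerAct V.act W.act) A.PhiInv) h2
    simp only [LinearMap.comp_assoc, LinearMap.rTensor_comp] at h7 h8 ⊢
    rw [h8]
    exact h7
  rw [h6]
  induction y with
  | zero => simp
  | add y z hy hz =>
    rw [TensorProduct.add_tmul, map_add, map_add, map_add, LinearMap.add_apply, hy, hz]
    rfl
  | tmul ψ φ =>
    induction x with
    | zero => simp
    | add y z hy hz =>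
      rw [TensorProduct.tmul_add, map_add, map_add, map_add, hy, hz]
      rfl
    | tmul x y => exact congrArg ULift.up (hγ _ ψ φ x y)

/-- The coevaluation of `V ⊗ W` with values in `(V ⊗ W) ⊗ (W* ⊗ V*)` is given by `δ`. -/
theorem ctr_coevaluation_tensor_lin (V W : Rep hR) (w : W) (v : V) :
    ctr (V ⊗[k] W) (evalAt w v) ((η_ (V ⊗ W) (lDual W ⊗ lDual V)).lin (ULift.up 1)) =
      outerAct V.act W.act A.δ (v ⊗ₜ[k] w) := by
  let κ : V ⊗[k] (W ⊗[k] (Module.Dual k W ⊗[k] Module.Dual k V)) →ₗ[k] V ⊗[k] W :=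
    ctr (V ⊗[k] W) (evalAt w v) ∘ₗ (TensorProduct.assoc k V W _).symm.toLinearMap
  let P := outerAct V.act (outerAct W.act (outerAct (A.dualAct W.act) (A.dualAct V.act)))
  -- The nested coevaluation, each part twisted by `β`; acting on it with the two reassociators
  -- gives `δ`.
  let ζ : V ⊗[k] (W ⊗[k] (Module.Dual k W ⊗[k] Module.Dual k V)) :=
    sum2 (coevaluation k V 1) fun x φ => sum2 (coevaluation k W 1) fun y ψ =>
      V.act A.β x ⊗ₜ[k] (W.act A.β y ⊗ₜ[k] (ψ ⊗ₜ[k] φ))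
  have hδ : ∀ t : H ⊗[k] (H ⊗[k] (H ⊗[k] H)), κ (P t ζ) = outerAct V.act W.act
      (sum4 t fun B1 B2 B3 B4 => (B1 * A.β * A.S B4) ⊗ₜ[k] (B2 * A.β * A.S B3)) (v ⊗ₜ[k] w) := by
    intro t
    rw [map_sum4, sum4_apply]
    refine (sum4_eq t (κ ∘ₗ LinearMap.applyₗ ζ ∘ₗ P.toLinearMap)).symm.trans ?_
    congr! 5 with a b c d
    change κ (P (a ⊗ₜ[k] (b ⊗ₜ[k] (c ⊗ₜ[k] d))) ζ) = _
    have h1 : ∀ (x : V) (φ : Module.Dual k V) (y : W) (ψ : Module.Dual k W),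
        κ (P (a ⊗ₜ[k] (b ⊗ₜ[k] (c ⊗ₜ[k] d))) (V.act A.β x ⊗ₜ[k] (W.act A.β y ⊗ₜ[k] (ψ ⊗ₜ[k] φ)))) =
          (φ (V.act (A.S d) v) • V.act (a * A.β) x) ⊗ₜ[k] (ψ (W.act (A.S c) w) • W.act (b * A.β) y) := by
      intro x φ y ψ
      simp [κ, P, TensorProduct.smul_tmul', smul_smul, mul_comm]
    simp only [ζ, map_sum2, h1]
    simp only [← tmul_sum2, ← sum2_tmul, sum2_coevaluation]
    simp
  let ζ₀ : (V ⊗[k] (W ⊗[k] Module.Dual k W)) ⊗[k] Module.Dual k V :=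
    sum2 (coevaluation k V 1) fun x φ => sum2 (coevaluation k W 1) fun y ψ =>
      (V.act A.β x ⊗ₜ[k] (W.act A.β y ⊗ₜ[k] ψ)) ⊗ₜ[k] φ
  have h2 : (η_ (V ⊗ W : Rep hR) (lDual W ⊗ lDual V : Rep hR)).lin (ULift.up 1) =
      A.assocMap (A.tensorAct V.act W.act) (A.dualAct W.act) (A.dualAct V.act)
        ((A.assocInvMap V.act W.act (A.dualAct W.act)).rTensor (Module.Dual k V) ζ₀) := by
    rw [coevaluation_tensor]
    change A.assocMap (A.tensorAct V.act W.act) (A.dualAct W.act) (A.dualAct V.act)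
      ((A.assocInvMap V.act W.act (A.dualAct W.act) ∘ₗ (coev W).lin.lTensor V ∘ₗ
        (ρ_ V).inv.lin).rTensor (Module.Dual k V) ((coev V).lin (ULift.up 1))) = _
    congr 1
    rw [coev_lin_eq_sum2, map_sum2, map_sum2]
    congr! 3 with x φ
    change A.assocInvMap V.act W.act (A.dualAct W.act) (V.act A.β x ⊗ₜ[k] (coev W).lin (ULift.up 1)) ⊗ₜ[k] φ = _
    rw [coev_lin_eq_sum2, tmul_sum2, map_sum2, map_sum2, sum2_tmul]
    rfl
  have h3 := LinearMap.congr_fun (lTensor_assoc_comp_rTensor_outerAct V.act W.act (A.dualAct W.act)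
    (A.dualAct V.act) A.PhiInv) ζ₀
  have h4 := assoc_comp_outerAct_tensorAct (A := A) V.act W.act (A.dualAct W.act) (A.dualAct V.act) A.Phi
  have h5 : (TensorProduct.assoc k W (Module.Dual k W) (Module.Dual k V)).toLinearMap.lTensor V
      ((TensorProduct.assoc k V (W ⊗[k] Module.Dual k W) (Module.Dual k V)).toLinearMap ζ₀) = ζ := by
    simp only [ζ₀, ζ, map_sum2]
    rfl
  have h6 : (TensorProduct.assoc k V W (Module.Dual k W ⊗[k] Module.Dual k V)).toLinearMap ∘ₗ
      (TensorProduct.assoc k (V ⊗[k] W) (Module.Dual k W) (Module.Dual k V)).toLinearMap ∘ₗ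
      (TensorProduct.assoc k V W (Module.Dual k W)).symm.toLinearMap.rTensor (Module.Dual k V) =
      (TensorProduct.assoc k W (Module.Dual k W) (Module.Dual k V)).toLinearMap.lTensor V ∘ₗ
      (TensorProduct.assoc k V (W ⊗[k] Module.Dual k W) (Module.Dual k V)).toLinearMap := by
    refine TensorProduct.ext (TensorProduct.ext (LinearMap.ext fun (x : V) =>
      TensorProduct.ext (LinearMap.ext₂ fun (y : W) (ψ : Module.Dual k W) =>
        LinearMap.ext fun (φ : Module.Dual k V) => ?_)))
    rfl
  have h7 := LinearMap.congr_fun h6 ((outerAct V.act (outerAct W.act (A.dualAct W.act)) A.PhiInv).rTensor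
    (Module.Dual k V) ζ₀)
  simp only [LinearMap.comp_apply] at h3 h7
  rw [h5, ← h7] at h3
  have h8 := LinearMap.congr_fun h4 ((TensorProduct.assoc k (V ⊗[k] W) (Module.Dual k W)
    (Module.Dual k V)).toLinearMap ((TensorProduct.assoc k V W (Module.Dual k W)).symm.toLinearMap.rTensor
      (Module.Dual k V) ((outerAct V.act (outerAct W.act (A.dualAct W.act)) A.PhiInv).rTensor
    (Module.Dual k V) ζ₀)))
  simp only [LinearMap.comp_apply] at h8
  rw [h3] at h8
  rw [h2, δ, ← hδ, map_mul, Module.End.mul_apply]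
  dsimp only [P]
  rw [← h8]
  simp only [κ, assocInvMap, assocMap, LinearMap.comp_apply, LinearMap.rTensor_comp]
  exact congrArg _ (LinearEquiv.symm_apply_apply _ _).symm

end Rep

end QuasiHopfAlgebra

/-! ### The Drinfeld twist as comparison of duals -/

namespace QuasiHopfAlgebra

open QuasiHopf

section DualDistrib

variable {k H : Type*} [Field k] [Ring H] [Algebra k H] {A : QuasiHopfAlgebra k H}
  {V W : Type*} [AddCommGroup V] [Module k V] [AddCommGroup W] [Module k W]
  (ρ : H →ₐ[k] Module.End k V) (σ : H →ₐ[k] Module.End k W)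

theorem dualDistrib_outerAct_dualAct (t : H ⊗[k] H) (y : Module.Dual k V ⊗[k] Module.Dual k W)
    (x : V ⊗[k] W) : TensorProduct.dualDistrib k V W (outerAct (A.dualAct ρ) (A.dualAct σ) t y) x =
      TensorProduct.dualDistrib k V W y (outerAct ρ σ (TensorProduct.map A.S A.S t) x) := by
  induction t with
  | zero => simp
  | add s t hs ht => simp only [map_add, LinearMap.add_apply, hs, ht]
  | tmul a b =>
    induction y with
    | zero => simp
    | add s t hs ht => simp only [map_add, LinearMap.add_apply, hs, ht]
    | tmul φ ψ =>
      induction x with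
      | zero => simp
      | add s t hs ht => simp only [map_add, hs, ht]
      | tmul x y => simp

theorem dualDistrib_comm (y : Module.Dual k W ⊗[k] Module.Dual k V) (x : V ⊗[k] W) :
    TensorProduct.dualDistrib k V W (TensorProduct.comm k _ _ y) x =
      TensorProduct.dualDistrib k W V y (TensorProduct.comm k _ _ x) := by
  induction y with
  | zero => simp
  | add s t hs ht => simp only [map_add, LinearMap.add_apply, hs, ht]
  | tmul φ ψ =>
    induction x with
    | zero => simp
    | add s t hs ht => simp only [map_add, hs, ht]
    | tmul x y => simp [mul_comm]

theorem outerAct_comm (t : H ⊗[k] H) (x : V ⊗[k] W) :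
    TensorProduct.comm k V W (outerAct ρ σ t x) =
      outerAct σ ρ (TensorProduct.comm k H H t) (TensorProduct.comm k V W x) :=
  LinearMap.congr_fun (comm_comp_outerAct ρ σ t) x

theorem tensorAct_apply (h : H) : A.tensorAct ρ σ h = outerAct ρ σ (A.Δ h) := rfl

theorem comm_map_S (t : H ⊗[k] H) : TensorProduct.comm k H H (TensorProduct.map A.S A.S t) =
    TensorProduct.map A.S A.S (TensorProduct.comm k H H t) := by
  induction t with
  | zero => simp
  | add s t hs ht => simp only [map_add, hs, ht]
  | tmul a b => rfl

theorem ctr_dualDistrib (u : (V ⊗[k] W) ⊗[k] (Module.Dual k W ⊗[k] Module.Dual k V))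
    (B : (V ⊗[k] W) →ₗ[k] V ⊗[k] W)
    (h : ∀ w v, ctr (V ⊗[k] W) (evalAt w v) u = B (v ⊗ₜ[k] w)) (x : W ⊗[k] V) :
    ctr (V ⊗[k] W) ((TensorProduct.dualDistrib k W V).flip x) u = B (TensorProduct.comm k _ _ x) := by
  induction x with
  | zero => simp [ctr]
  | add s t hs ht => 
    rw [map_add, map_add, map_add, ← hs, ← ht]
    simp [ctr, LinearMap.lTensor_add]
  | tmul w v => 
    rw [TensorProduct.comm_tmul, ← h]
    congr 2
    exact LinearMap.ext fun y => (evalAt_eq w v y).symm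

end DualDistrib

namespace Rep

open CategoryTheory MonoidalCategory

variable {k : Type u} {H : Type v} [Field k] [Ring H] [Algebra k H] {A : QuasiHopfAlgebra k H}
  {R : H ⊗[k] H} {hR : A.IsRMatrix R}

/-- The origin of `f`: the comparison map coevaluates `V ⊗ W`, contributing `Δ(β)`, reassociates by
`x¹ ⊗ x² ⊗ x³`, and evaluates the nested dual through `γ`. The antipodes come from the actions on
the duals, and their flip from the reversed order of the dual factors. -/
theorem eval_dualTensor_lin (V W : Rep hR) (y : Module.Dual k W ⊗[k] Module.Dual k V)
    (x : V ⊗[k] W) : Module.Dual.eval k (V ⊗[k] W) x ((dualTensor V W).lin y) =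
      TensorProduct.dualDistrib k W V y
        (TensorProduct.comm k _ _ (outerAct V.act W.act A.f x)) := by
  have h1 : ∀ (y : Module.Dual k W ⊗[k] Module.Dual k V) (z : V ⊗[k] W)
      (φ : Module.Dual k (V ⊗[k] W)), Module.Dual.eval k (V ⊗[k] W) x
      ((λ_ (lDual (V ⊗ W : Rep hR))).hom.lin
        ((ε_ (V ⊗ W : Rep hR) (lDual W ⊗ lDual V : Rep hR) ▷ lDual (V ⊗ W : Rep hR)).lin
          ((y ⊗ₜ[k] z) ⊗ₜ[k] φ))) =
      φ x * (TensorProduct.dualDistrib k V W (TensorProduct.comm k _ _ y)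
        (outerAct V.act W.act A.γ z)) := by
    intro y z φ
    change Module.Dual.eval k (V ⊗[k] W) x ((λ_ (lDual (V ⊗ W : Rep hR))).hom.lin
      (((ε_ (V ⊗ W : Rep hR) (lDual W ⊗ lDual V : Rep hR)).lin (y ⊗ₜ[k] z)) ⊗ₜ[k] φ)) = _
    rw [evaluation_tensor_lin, mul_comm]
    rfl
  change Module.Dual.eval k (V ⊗[k] W) x ((λ_ (lDual (V ⊗ W : Rep hR))).hom.lin
    ((ε_ (V ⊗ W : Rep hR) (lDual W ⊗ lDual V : Rep hR) ▷ lDual (V ⊗ W : Rep hR)).lin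
    (A.assocInvMap (A.tensorAct (A.dualAct W.act) (A.dualAct V.act)) (A.tensorAct V.act W.act)
      (A.dualAct (A.tensorAct V.act W.act))
      (y ⊗ₜ[k] (coev (V ⊗ W : Rep hR)).lin (ULift.up 1))))) = _
  rw [coev_lin_eq_sum2]
  change Module.Dual.eval k (V ⊗[k] W) x ((λ_ (lDual (V ⊗ W : Rep hR))).hom.lin
    ((ε_ (V ⊗ W : Rep hR) (lDual W ⊗ lDual V : Rep hR) ▷ lDual (V ⊗ W : Rep hR)).lin
    (A.assocInvMap (A.tensorAct (A.dualAct W.act) (A.dualAct V.act)) (A.tensorAct V.act W.act)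
      (A.dualAct (A.tensorAct V.act W.act))
      (y ⊗ₜ[k] sum2 (coevaluation k (V ⊗[k] W) 1) fun z φ => A.tensorAct V.act W.act A.β z ⊗ₜ[k] φ)))) = _
  rw [tmul_sum2, map_sum2, map_sum2, map_sum2, map_sum2]
  simp only [assocInvMap_tmul, map_sum3]
  rw [sum2_sum3_comm, f, map_sum3, sum3_apply, map_sum3, map_sum3]
  congr! 4 with a b c
  refine Eq.trans (b := sum2 (coevaluation k (V ⊗[k] W) 1) fun z φ =>
    φ (A.tensorAct V.act W.act (A.S c) x) • (TensorProduct.dualDistrib k V W (TensorProduct.comm k _ _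
      (A.tensorAct (A.dualAct W.act) (A.dualAct V.act) a y)) ∘ₗ outerAct V.act W.act A.γ ∘ₗ
        A.tensorAct V.act W.act b ∘ₗ A.tensorAct V.act W.act A.β) z) ?_ ?_
  · congr! 3 with z φ
    exact h1 _ _ _
  · rw [sum2_coevaluation]
    simp only [LinearMap.comp_apply]
    rw [dualDistrib_comm, tensorAct_apply (A.dualAct W.act), dualDistrib_outerAct_dualAct]
    congr 1
    simp only [map_mul, Module.End.mul_apply]
    rw [outerAct_comm V.act W.act (TensorProduct.map A.S A.S _), comm_map_S]
    simp only [← LinearEquiv.coe_coe, ← tensorAct_apply]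
    congr 2
    exact congrArg _ ((TensorProduct.comm k H H).symm_apply_apply (A.Δ a)).symm

/-- Likewise for `fInv`, with the nested coevaluation giving `δ` and the evaluation of `V ⊗ W`
giving `Δ(α)`. -/
theorem dualDistrib_dualTensorInv_lin (V W : Rep hR) (χ : Module.Dual k (V ⊗[k] W)) (x : W ⊗[k] V) :
    TensorProduct.dualDistrib k W V ((dualTensorInv V W).lin χ) x =
      χ (outerAct V.act W.act A.fInv (TensorProduct.comm k _ _ x)) := by
  change TensorProduct.dualDistrib k W V ((λ_ (lDual W ⊗ lDual V : Rep hR)).hom.lin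
    ((ev (V ⊗ W : Rep hR) ▷ (lDual W ⊗ lDual V : Rep hR)).lin
    (A.assocInvMap (A.dualAct (A.tensorAct V.act W.act)) (A.tensorAct V.act W.act)
      (A.tensorAct (A.dualAct W.act) (A.dualAct V.act))
      (χ ⊗ₜ[k] (η_ (V ⊗ W) (lDual W ⊗ lDual V : Rep hR)).lin (ULift.up 1))))) x = _
  have h1 : ∀ u : (V ⊗[k] W) ⊗[k] (Module.Dual k W ⊗[k] Module.Dual k V),
      TensorProduct.dualDistrib k W V ((λ_ (lDual W ⊗ lDual V : Rep hR)).hom.lin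
    ((ev (V ⊗ W : Rep hR) ▷ (lDual W ⊗ lDual V : Rep hR)).lin
    (A.assocInvMap (A.dualAct (A.tensorAct V.act W.act)) (A.tensorAct V.act W.act)
      (A.tensorAct (A.dualAct W.act) (A.dualAct V.act)) (χ ⊗ₜ[k] u)))) x =
      sum3 A.PhiInv fun a b c => χ (A.tensorAct V.act W.act (A.S a * A.α * b)
        (ctr (V ⊗[k] W) ((TensorProduct.dualDistrib k W V).flip
          (outerAct W.act V.act (TensorProduct.map A.S A.S (A.Δ c)) x)) u)) := by
    intro u
    induction u with
    | zero => simp [sum3, sum2]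
    | add s t hs ht =>
      rw [TensorProduct.tmul_add, map_add, map_add, map_add, map_add, LinearMap.add_apply, hs, ht]
      simp only [map_add, sum3, sum2, Multiset.sum_map_add]
    | tmul z y =>
      rw [assocInvMap_tmul, map_sum3, map_sum3, map_sum3, sum3_apply]
      congr! 4 with a b c
      change TensorProduct.dualDistrib k W V (χ (A.tensorAct V.act W.act (A.S a) (A.tensorAct V.act W.act A.α
        (A.tensorAct V.act W.act b z))) • A.tensorAct (A.dualAct W.act) (A.dualAct V.act) c y) x = _
      rw [map_smul, LinearMap.smul_apply, tensorAct_apply _ _ c, dualDistrib_outerAct_dualAct,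
        ctr_tmul, map_smul, map_smul, map_mul, map_mul, smul_eq_mul, smul_eq_mul, mul_comm]
      rfl
  refine (h1 _).trans ?_
  simp only [ctr_dualDistrib _ _ fun w v => ctr_coevaluation_tensor_lin V W w v]
  rw [fInv, map_sum3, sum3_apply, map_sum3]
  congr! 4 with a b c
  rw [outerAct_comm, map_mul, map_mul, Module.End.mul_apply, Module.End.mul_apply,
    comm_map_S]
  simp only [map_mul, Module.End.mul_apply]
  rfl

end Rep

end QuasiHopfAlgebra

/-! ### Product and antipode of the enveloping algebra braided group -/

namespace QuasiHopf

theorem sum2_smul {k M N P : Type*} [CommSemiring k] [AddCommMonoid M] [Module k M]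
    [AddCommMonoid N] [Module k N] [AddCommMonoid P] [Module k P] (t : M ⊗[k] N)
    (f : M → N → k) (x : P) : sum2 t f • x = sum2 t fun a b => f a b • x :=
  map_sum2 (LinearMap.toSpanSingleton k P x) t f

end QuasiHopf

namespace QuasiHopfAlgebra

open QuasiHopf

namespace Rep

open CategoryTheory MonoidalCategory

variable {k : Type u} {H : Type v} [Field k] [Ring H] [Algebra k H] {A : QuasiHopfAlgebra k H}
  {R : H ⊗[k] H} {hR : A.IsRMatrix R}

/-- A linear map whose composition with a monomorphism is linear over `H`. -/
def homOfInjective {X Y Z : Rep hR} (j : Y ⟶ Z) (hj : Function.Injective j.lin) (f : X →ₗ[k] Y)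
    (g : X ⟶ Z) (h : j.lin ∘ₗ f = g.lin) : X ⟶ Y where
  lin := f
  comm a := by
    refine LinearMap.ext fun x => hj ?_
    have h1 := LinearMap.congr_fun h
    have h2 := LinearMap.congr_fun (j.comm a) (f x)
    have h3 := LinearMap.congr_fun (g.comm a) x
    simp only [LinearMap.comp_apply] at h1 h2 h3 ⊢
    rw [h1, h3, h2, h1]

/-- Composition in `V ⊗ V*` differs from composition of endomorphisms by the two reassociations and
the `α` in the evaluation. With `s` and `t` the actions of `h` and `h'`, the sum is the action of `h
• h'`. -/
theorem toHom_compMap (V : Rep hR) (s t : V ⊗[k] Module.Dual k V) :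
    toHom k V V ((EndFamily.compMap V).lin (s ⊗ₜ[k] t)) =
      sum3 A.Phi fun X1 X2 X3 => sum3 A.PhiInv fun x1 x2 x3 => sum2 (A.Δ X3) fun X31 X32 =>
        V.act X1 ∘ₗ toHom k V V s ∘ₗ V.act (A.S (x1 * X2) * A.α * x2 * X31) ∘ₗ toHom k V V t ∘ₗ
          V.act (A.S (x3 * X32)) := by
  induction s with
  | zero => simp [sum2, sum3]
  | add x y hx hy =>
    rw [TensorProduct.add_tmul, map_add, map_add, hx, hy]
    simp only [map_add, LinearMap.add_comp, LinearMap.comp_add, sum3, sum2, Multiset.sum_map_add]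
  | tmul v φ =>
    change toHom k V V ((V ◁ (λ_ (lDual V)).hom).lin ((V ◁ (ev V ▷ lDual V)).lin
      ((V ◁ (α_ (lDual V) V (lDual V)).inv).lin (A.assocMap V.act (A.dualAct V.act)
        (A.tensorAct V.act (A.dualAct V.act)) ((v ⊗ₜ[k] φ) ⊗ₜ[k] t))))) = _
    rw [assocMap_tmul, map_sum3, map_sum3, map_sum3, map_sum3]
    congr! 4 with a b c
    change toHom k V V (V.act a v ⊗ₜ[k] ((λ_ (dual V)).hom.lin ((ev V ▷ dual V).lin
      (A.assocInvMap (A.dualAct V.act) V.act (A.dualAct V.act) (A.dualAct V.act b φ ⊗ₜ[k]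
        A.tensorAct V.act (A.dualAct V.act) c t))))) = _
    rw [ev_whiskerRight_assocInvMap]
    refine LinearMap.ext fun z => ?_
    simp only [tmul_sum3, map_sum3, sum3_apply, toHom_tensorAct_dualAct, sum2_apply, map_sum2,
      LinearMap.comp_apply, toHom_tmul]
    congr! 4 with x1 x2 x3
    rw [sum2_smul]
    congr! 3
    simp [A.S_mul]

theorem toHom_coevaluation_comp {V W : Type*} [AddCommGroup V] [Module k V] [FiniteDimensional k V]
    [AddCommGroup W] [Module k W] (f : V →ₗ[k] W) (g : V →ₗ[k] V) : toHom k V W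
      (sum2 (coevaluation k V 1) fun v φ => f v ⊗ₜ[k] (φ ∘ₗ g)) = f ∘ₗ g := by
  refine LinearMap.ext fun z => ?_
  rw [map_sum2, sum2_apply]
  exact sum2_coevaluation f (g z)

variable (A) in
/-- The element through which `h`, as an element of the adjoint module, acts on modules. -/
noncomputable def theta : H →ₗ[k] H :=
  sum3 A.Phi fun X1 X2 X3 => sandwich k X1 (A.S X2 * A.α * X3)

theorem theta_apply (h : H) :
    theta A h = sum3 A.Phi fun X1 X2 X3 => X1 * (h * (A.S X2 * A.α * X3)) := by
  rw [theta, sum3_apply]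
  rfl

theorem sum2_pR {P : Type*} [AddCommMonoid P] [Module k P] (f : H →ₗ[k] H →ₗ[k] P) :
    (sum2 A.pR fun p1 p2 => f p1 p2) =
      sum3 A.PhiInv fun x1 x2 x3 => f x1 (x2 * A.β * A.S x3) := by
  refine (sum2_eq A.pR (TensorProduct.lift f)).trans ?_
  rw [pR, map_sum3]
  rfl

variable [FiniteDimensional k H]

/-- The reassociation in `(V ⊗ V*) ⊗ V` and the twisted evaluation make `h` act through `θ(h)`
rather than through `h` itself. -/
theorem action_act_lin (V : Rep hR) (h : H) (v : V) :
    (endFamily.action.act V).lin ((ULift.up h : ULift.{u} H) ⊗ₜ[k] v) = V.act (theta A h) v := by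
  change (ρ_ V).hom.lin ((V ◁ ev V).lin (A.assocMap V.act (A.dualAct V.act) V.act
    ((toEnd V).lin (ULift.up h) ⊗ₜ[k] v))) = _
  rw [whiskerLeft_ev_assocMap, toHom_toEnd_lin, theta_apply, map_sum3, sum3_apply]
  congr! 4
  simp

/-- `q_R` enters the antipode only through `S(q²)`, where the inverse antipode in its definition
cancels. -/
theorem theta_eq (hR : A.IsRMatrix R) (h : H) : theta A h = sum2 A.qR fun q1 q2 => q1 * h * A.S q2 := by
  have h1 := sum2_eq A.qR (LinearMap.mul' k H ∘ₗ TensorProduct.map (LinearMap.mulRight k h) A.S)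
  refine Eq.trans ?_ h1.symm
  rw [qR, map_sum3, theta_apply]
  congr! 4 with a b c
  simp only [LinearMap.comp_apply, TensorProduct.map_tmul, LinearMap.mul'_apply, A.S_mul, S_Sinv hR,
    LinearMap.mulRight_apply, mul_assoc]

theorem envelopingBraidedGroup_antipode (hR : A.IsRMatrix R) (h : H) : (A.envelopingBraidedGroup R).antipode h =
    sum3 A.Phi fun X1 X2 X3 => sum2 R fun R1 R2 => sum3 A.PhiInv fun x1 x2 x3 =>
      X1 * R2 * (x2 * A.β * A.S x3) * A.S (theta A (A.adAct (X2 * R1 * x1) h) * X3) := by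
  simp only [envelopingBraidedGroup, sum3_apply, sum2_apply]
  congr! 4 with X1 X2 X3
  congr! 3 with R1 R2
  refine Eq.trans ?_ (sum2_pR (A := A) (LinearMap.mk₂ k (fun p1 p2 =>
    X1 * R2 * p2 * A.S (theta A (A.adAct (X2 * R1 * p1) h) * X3)) ?_ ?_ ?_ ?_))
  · congr! 3 with p1 p2
    rw [LinearMap.mk₂_apply, theta_eq hR, ← LinearMap.mulRight_apply (R := k) X3]
    simp only [map_sum2]
    rw [← LinearMap.mulLeft_apply k (X1 * R2 * p2), map_sum2]
    congr! 3
    simp [sandwich, mul_assoc]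
  all_goals intros; simp [mul_add, add_mul]

/-- The coevaluation of `V` together with the inverse associator gives `p_R`, the braiding gives
`R`, and the action on `V*` gives `S(θ(…))`; eliminating the dual basis leaves the stated antipode.
-/
theorem toHom_antipode (V : Rep hR) (h : H) :
    toHom k V V (((ρ_ (adjoint hR)).inv ≫ adjoint hR ◁ η_ V (lDual V) ≫ (α_ _ _ _).inv ≫
      (β_ (adjoint hR) V).hom ▷ lDual V ≫ (α_ _ _ _).hom ≫
        V ◁ endFamily.action.act (lDual V)).lin (ULift.up h)) =
      V.act ((A.envelopingBraidedGroup R).antipode h) := by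
  change toHom k V V ((V ◁ endFamily.action.act (lDual V)).lin
    (A.assocMap V.act (adjoint hR).act (A.dualAct V.act)
      ((braiding R (adjoint hR).act V.act).rTensor (Module.Dual k V)
        (A.assocInvMap (adjoint hR).act V.act (A.dualAct V.act)
          ((ULift.up h : ULift.{u} H) ⊗ₜ[k] (coev V).lin (ULift.up 1)))))) = _
  rw [coev_lin_eq_sum2, envelopingBraidedGroup_antipode hR]
  simp only [tmul_sum2, assocInvMap_tmul, map_sum2, map_sum3, LinearMap.rTensor_tmul, braiding_tmul,
    sum2_tmul, assocMap_tmul]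
  simp only [sum2_sum3_comm, sum2_comm (coevaluation k V 1), ← map_sum2, ← map_sum3]
  rw [sum3_comm]
  simp only [← sum2_sum3_comm, map_sum2, map_sum3]
  congr! 3 with R1 R2
  rw [sum2_sum3_comm]
  congr! 4 with X1 X2 X3
  rw [sum2_sum3_comm]
  congr! 4 with x1 x2 x3
  refine (Eq.trans ?_ (toHom_coevaluation_comp (V.act (X1 * R2 * (x2 * A.β)))
    (V.act (A.S x3 * A.S (theta A (A.adAct (X2 * R1 * x1) h) * X3))))).trans ?_
  · rw [map_sum2]
    congr! 3 with v φ
    change toHom k V V (V.act X1 (V.act R2 (V.act x2 (V.act A.β v))) ⊗ₜ[k]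
      (endFamily.action.act (lDual V)).lin ((ULift.up (A.adAct X2 (A.adAct R1 (A.adAct x1 h))) :
        ULift.{u} H) ⊗ₜ[k] A.dualAct V.act X3 (A.dualAct V.act x3 φ))) = _
    rw [action_act_lin]
    change toHom k V V (_ ⊗ₜ[k] A.dualAct V.act _ (A.dualAct V.act X3 (A.dualAct V.act x3 φ))) = _
    simp only [map_mul, A.S_mul, Module.End.mul_apply, dualAct_apply, LinearMap.comp_assoc]
    rfl
  · rw [← Module.End.mul_eq_comp, ← map_mul]
    simp only [mul_assoc]

end Rep

end QuasiHopfAlgebra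

/-! ### Coproduct of the enveloping algebra braided group -/

namespace QuasiHopf

section

variable {k M N L P : Type*} [CommSemiring k] [AddCommMonoid M] [Module k M]
  [AddCommMonoid N] [Module k N] [AddCommMonoid L] [Module k L] [AddCommMonoid P]

theorem sum2_add (t : M ⊗[k] N) (f g : M → N → P) :
    (sum2 t fun a b => f a b + g a b) = sum2 t f + sum2 t g := by
  simp only [sum2, Multiset.sum_map_add]

theorem sum3_add (t : M ⊗[k] (N ⊗[k] L)) (f g : M → N → L → P) :
    (sum3 t fun a b c => f a b c + g a b c) = sum3 t f + sum3 t g := by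
  simp only [sum3, sum2_add]

theorem sum2_congr (t : M ⊗[k] N) {f g : M → N → P} (h : ∀ a b, f a b = g a b) :
    sum2 t f = sum2 t g :=
  congrArg (sum2 t) (funext₂ h)

theorem sum3_congr (t : M ⊗[k] (N ⊗[k] L)) {f g : M → N → L → P} (h : ∀ a b c, f a b c = g a b c) :
    sum3 t f = sum3 t g :=
  congrArg (sum3 t) (funext₃ h)

theorem sum2_zero (t : M ⊗[k] N) : (sum2 t fun _ _ => (0 : P)) = 0 := by
  simp only [sum2, Multiset.map_const', Multiset.sum_replicate, smul_zero]

theorem sum3_zero (t : M ⊗[k] (N ⊗[k] L)) : (sum3 t fun _ _ _ => (0 : P)) = 0 := by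
  simp only [sum3, sum2_zero]

end

section

variable {k : Type*} [Field k] {V W V' W' : Type*} [AddCommGroup V] [Module k V]
  [AddCommGroup W] [Module k W] [AddCommGroup V'] [Module k V'] [AddCommGroup W'] [Module k W']

theorem ctr_eval (s : W ⊗[k] Module.Dual k V) (x : V) :
    ctr W (Module.Dual.eval k V x) s = QuasiHopfAlgebra.toHom k V W s x := by
  induction s with
  | zero => simp
  | add x y hx hy => simp only [map_add, LinearMap.add_apply, hx, hy]
  | tmul z φ => simp

/-- Two elements of `End(V) ⊗ End(W)` are compared by applying both factors to arbitrary vectors. -/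
theorem map_toHom_ext [FiniteDimensional k V] [FiniteDimensional k W]
    {s t : (V' ⊗[k] Module.Dual k V) ⊗[k] (W' ⊗[k] Module.Dual k W)}
    (h : ∀ v w, TensorProduct.map ((QuasiHopfAlgebra.toHom k V V').flip v)
      ((QuasiHopfAlgebra.toHom k W W').flip w) s =
        TensorProduct.map ((QuasiHopfAlgebra.toHom k V V').flip v)
      ((QuasiHopfAlgebra.toHom k W W').flip w) t) : s = t := by
  have h1 : ∀ (v : V) (w : W), TensorProduct.map ((QuasiHopfAlgebra.toHom k V V').flip v)
      ((QuasiHopfAlgebra.toHom k W W').flip w) =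
        ctr (V' ⊗[k] W') (evalAt v w) ∘ₗ (TensorProduct.tensorTensorTensorComm k V'
          (Module.Dual k V) W' (Module.Dual k W)).toLinearMap := by
    intro v w
    refine TensorProduct.ext_fourfold' fun a b c d => ?_
    simp [TensorProduct.smul_tmul', TensorProduct.tmul_smul, smul_smul, mul_comm]
  refine (TensorProduct.tensorTensorTensorComm k V' (Module.Dual k V) W'
    (Module.Dual k W)).injective (ctr_evalAt_ext fun v w => ?_)
  have h2 := h v w
  rw [h1] at h2
  exact h2

end

end QuasiHopf

namespace QuasiHopfAlgebra

open QuasiHopf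

namespace Rep

open CategoryTheory MonoidalCategory

variable {k : Type u} {H : Type v} [Field k] [Ring H] [Algebra k H] {A : QuasiHopfAlgebra k H}
  {R : H ⊗[k] H} {hR : A.IsRMatrix R}

/-- The associators and the braiding in the shuffle supply every factor of the coproduct except
`Δ(h) f⁻¹`, which will come from `u`. -/
theorem map_toHom_shuffle (V W : Rep hR) (v₀ : V) (w₀ : W)
    (u : (V ⊗[k] W) ⊗[k] (Module.Dual k W ⊗[k] Module.Dual k V)) :
    TensorProduct.map ((toHom k V V).flip v₀) ((toHom k W W).flip w₀)
      ((EndFamily.shuffle V W).lin u) =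
      sum3 A.PhiInv fun x1 x2 x3 => sum3 A.Phi fun X1 X2 X3 => sum2 (A.Δ X3) fun X31 X32 =>
      sum2 R fun R1 R2 => sum3 A.PhiInv fun y1 y2 y3 => sum2 (A.Δ (x3 * R1)) fun a b =>
        TensorProduct.map (V.act (x1 * X1)) (W.act (a * (y1 * X2))) (ctr (V ⊗[k] W)
          (evalAt (W.act (A.S (y2 * X31)) (W.act (A.S b) w₀))
            (V.act (A.S (x2 * R2 * y3 * X32)) v₀)) u) := by
  induction u with
  | zero => simp only [TensorProduct.tmul_zero, TensorProduct.zero_tmul, map_zero, sum3_zero, sum2_zero]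
  | add s t hs ht =>
    rw [map_add, map_add, hs, ht]
    simp only [map_add, sum3_add, sum2_add]
  | tmul z y =>
    induction z with
    | zero => simp only [TensorProduct.tmul_zero, TensorProduct.zero_tmul, map_zero, sum3_zero, sum2_zero]
    | add s t hs ht =>
      rw [TensorProduct.add_tmul, map_add, map_add, hs, ht]
      simp only [map_add, sum3_add, sum2_add]
    | tmul v w =>
      induction y with
      | zero => simp only [TensorProduct.tmul_zero, TensorProduct.zero_tmul, map_zero, sum3_zero, sum2_zero]
      | add s t hs ht =>
        rw [TensorProduct.tmul_add, map_add, map_add, hs, ht]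
        simp only [map_add, sum3_add, sum2_add]
      | tmul ψ φ =>
        change TensorProduct.map ((toHom k V V).flip v₀) ((toHom k W W).flip w₀)
          (A.assocInvMap V.act (A.dualAct V.act) (A.tensorAct W.act (A.dualAct W.act))
            ((braiding R (A.tensorAct W.act (A.dualAct W.act)) (A.dualAct V.act)).lTensor V
              ((A.assocInvMap W.act (A.dualAct W.act) (A.dualAct V.act)).lTensor V
                (A.assocMap V.act W.act (A.tensorAct (A.dualAct W.act) (A.dualAct V.act))
                  ((v ⊗ₜ[k] w) ⊗ₜ[k] (ψ ⊗ₜ[k] φ)))))) = _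
        simp only [assocMap_tmul, assocInvMap_tmul, map_sum3, braiding_tmul, map_sum2, tmul_sum2,
          tmul_sum3, LinearMap.lTensor_tmul, tensorAct_eq_sum2 A (A.dualAct W.act) (A.dualAct V.act),
          sum2_apply, TensorProduct.map_tmul, sum2_sum3_comm]
        conv_rhs => rw [sum3_comm]
        refine sum3_congr _ fun X1 X2 X3 => ?_
        rw [sum3_comm]
        refine sum3_congr _ fun x1 x2 x3 => ?_
        refine sum3_congr _ fun y1 y2 y3 => ?_
        refine sum2_congr _ fun X31 X32 => ?_
        refine sum2_congr _ fun R1 R2 => ?_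
        rw [← Module.End.mul_apply (A.tensorAct W.act (A.dualAct W.act) x3), ← map_mul,
          LinearMap.flip_apply, LinearMap.flip_apply, toHom_tensorAct_dualAct, sum2_apply, tmul_sum2]
        refine sum2_congr _ fun a b => ?_
        simp [A.S_mul, TensorProduct.smul_tmul', TensorProduct.tmul_smul, smul_smul, mul_comm]

variable [FiniteDimensional k H]

/-- The remaining factor: `h` acts on `V ⊗ W` by `Δ(h)`, and splitting the dual of `V ⊗ W` inserts
`f⁻¹`. -/
theorem ctr_dualTensorInv_toEnd (V W : Rep hR) (v : V) (w : W) (h : H) :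
    ctr (V ⊗[k] W) (evalAt w v) ((dualTensorInv V W).lin.lTensor (V ⊗[k] W)
      ((toEnd (V ⊗ W : Rep hR)).lin (ULift.up h))) =
        outerAct V.act W.act (A.Δ h) (outerAct V.act W.act A.fInv (v ⊗ₜ[k] w)) := by
  have h1 : evalAt w v ∘ₗ (dualTensorInv V W).lin =
      Module.Dual.eval k (V ⊗[k] W) (outerAct V.act W.act A.fInv (v ⊗ₜ[k] w)) := by
    refine LinearMap.ext fun χ => ?_
    rw [LinearMap.comp_apply, evalAt_eq]
    exact dualDistrib_dualTensorInv_lin V W χ (w ⊗ₜ[k] v)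
  refine (ctr_lTensor (Z := V ⊗[k] W) (evalAt w v) (dualTensorInv V W).lin _).trans ?_
  rw [h1]
  refine (ctr_eval _ _).trans ?_
  exact LinearMap.congr_fun (toHom_toEnd_lin (V ⊗ W : Rep hR) h) _

omit [FiniteDimensional k H] in
theorem outerAct_sandwich_adAct {V W : Type*} [AddCommGroup V] [Module k V] [AddCommGroup W]
    [Module k W] (ρ : H →ₐ[k] Module.End k V) (σ : H →ₐ[k] Module.End k W) (p q r s m g1 g2 : H)
    (d : H ⊗[k] H) (v₀ : V) (w₀ : W) :
    outerAct ρ σ (TensorProduct.map (sandwich k p (g1 * q)) (A.adAct m ∘ₗ sandwich k r (g2 * s)) d)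
      (v₀ ⊗ₜ[k] w₀) = sum2 (A.Δ m) fun a b => TensorProduct.map (ρ p) (σ (a * r))
        (outerAct ρ σ d (TensorProduct.map (ρ g1) (σ g2) (ρ q v₀ ⊗ₜ[k] σ s (σ (A.S b) w₀)))) := by
  induction d with
  | zero => simp only [map_zero, LinearMap.zero_apply, sum2_zero]
  | add s t hs ht => simp only [map_add, LinearMap.add_apply, hs, ht, sum2_add]
  | tmul c d =>
    simp only [TensorProduct.map_tmul, outerAct_tmul, LinearMap.comp_apply, adAct_apply, map_sum2,
      sum2_apply, tmul_sum2]
    congr! 3 with a b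
    simp [sandwich]

end Rep

end QuasiHopfAlgebra

namespace QuasiHopfAlgebra

open QuasiHopf

namespace Rep

open CategoryTheory MonoidalCategory

variable {k : Type u} {H : Type v} [Field k] [Ring H] [Algebra k H] {A : QuasiHopfAlgebra k H}
  {R : H ⊗[k] H} {hR : A.IsRMatrix R} [FiniteDimensional k H]

/-- Brings the explicit coproduct to the form of `map_toHom_shuffle`, so that the two can be
compared term by term. -/
theorem outerAct_comul_apply (V W : Rep hR) (v₀ : V) (w₀ : W) (h : H) :
    outerAct V.act W.act ((A.envelopingBraidedGroup R).comul h) (v₀ ⊗ₜ[k] w₀) =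
      sum3 A.PhiInv fun x1 x2 x3 => sum3 A.Phi fun X1 X2 X3 => sum2 (A.Δ X3) fun X31 X32 =>
      sum2 R fun R1 R2 => sum3 A.PhiInv fun y1 y2 y3 => sum2 (A.Δ (x3 * R1)) fun a b =>
        TensorProduct.map (V.act (x1 * X1)) (W.act (a * (y1 * X2))) (outerAct V.act W.act (A.Δ h)
          (outerAct V.act W.act A.fInv (V.act (A.S (x2 * R2 * y3 * X32)) v₀ ⊗ₜ[k]
            W.act (A.S (y2 * X31)) (W.act (A.S b) w₀)))) := by
  simp only [envelopingBraidedGroup, sum3_apply, sum2_apply, map_sum3, map_sum2,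
    sum2_comm A.fInv R]
  simp only [sum2_sum3_comm A.fInv A.PhiInv]
  refine sum3_congr _ fun x1 x2 x3 => sum3_congr _ fun X1 X2 X3 => sum2_congr _ fun X31 X32 =>
    sum2_congr _ fun R1 R2 => sum3_congr _ fun y1 y2 y3 => ?_
  rw [outerAct_eq_sum2 _ _ A.fInv]
  simp only [sum2_apply, map_sum2]
  rw [sum2_comm]
  refine sum2_congr _ fun g1 g2 => ?_
  exact outerAct_sandwich_adAct _ _ _ _ _ _ _ _ _ _ _ _

end Rep

end QuasiHopfAlgebra

/-! ### The enveloping algebra braided group inside the category -/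

namespace QuasiHopfAlgebra

open QuasiHopf

namespace Rep

open CategoryTheory MonoidalCategory

variable {k : Type u} {H : Type v} [Field k] [Ring H] [Algebra k H] {A : QuasiHopfAlgebra k H}
  {R : H ⊗[k] H} {hR : A.IsRMatrix R} [FiniteDimensional k H]

variable (k H) in
/-- The identification of `H` with the carrier of the adjoint module. -/
abbrev down : ULift.{u} H ≃ₗ[k] H := ULift.moduleEquiv

/-- Valid for every `V`. The regular module shows that the explicit product is `H`-linear, as
`toEnd` is injective there; the other modules give the compatibility with the whole family. The same
double use is made of the next lemmas. -/
theorem toEnd_mul (V : Rep hR) : (toEnd V).lin ∘ₗ (down k H).symm.toLinearMap ∘ₗ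
    (A.envelopingBraidedGroup R).mul ∘ₗ
      TensorProduct.map (down k H).toLinearMap (down k H).toLinearMap =
    ((toEnd V ⊗ₘ toEnd V) ≫ EndFamily.compMap V).lin := by
  refine TensorProduct.ext' fun x y => toHom_injective ?_
  obtain ⟨x⟩ := x
  obtain ⟨y⟩ := y
  refine Eq.trans ?_ (toHom_compMap V ((toEnd V).lin (ULift.up x)) ((toEnd V).lin (ULift.up y))).symm
  change toHom k V V ((toEnd V).lin (ULift.up ((A.envelopingBraidedGroup R).mul (x ⊗ₜ[k] y)))) = _
  rw [toHom_toEnd_lin, toHom_toEnd_lin, toHom_toEnd_lin]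
  simp only [envelopingBraidedGroup, sum3_apply, sum2_apply, map_sum2, map_sum3]
  refine sum3_congr _ fun X1 X2 X3 => ?_
  refine sum3_congr _ fun x1 x2 x3 => ?_
  refine sum2_congr _ fun X31 X32 => ?_
  simp only [← Module.End.mul_eq_comp, ← map_mul]
  congr 1
  simp [sandwich, mul_assoc]

theorem toEnd_one (V : Rep hR) : (toEnd V).lin ∘ₗ (down k H).symm.toLinearMap ∘ₗ
    LinearMap.toSpanSingleton k H (A.envelopingBraidedGroup R).one ∘ₗ
      (ULift.moduleEquiv : ULift.{v} k ≃ₗ[k] k).toLinearMap = (η_ V (lDual V)).lin := by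
  refine LinearMap.ext fun c => toHom_injective ?_
  obtain ⟨c⟩ := c
  rw [coev_eq]
  refine Eq.trans ?_ (toHom_coev_lin V c).symm
  refine (toHom_toEnd_lin V _).trans ?_
  exact map_smul V.act c A.β

theorem toEnd_comul (V W : Rep hR) : (toEnd V ⊗ₘ toEnd W).lin ∘ₗ
    TensorProduct.map (down k H).symm.toLinearMap (down k H).symm.toLinearMap ∘ₗ
    (A.envelopingBraidedGroup R).comul ∘ₗ (down k H).toLinearMap =
    (toEnd (V ⊗ W) ≫ (V ⊗ W) ◁ dualTensorInv V W ≫ EndFamily.shuffle V W).lin := by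
  refine LinearMap.ext fun h => map_toHom_ext fun v w => ?_
  obtain ⟨h⟩ := h
  have h1 : ∀ d : H ⊗[k] H, TensorProduct.map ((toHom k V V).flip v) ((toHom k W W).flip w)
      (TensorProduct.map (toEnd V).lin (toEnd W).lin
        (TensorProduct.map (down k H).symm.toLinearMap (down k H).symm.toLinearMap d)) =
      outerAct V.act W.act d (v ⊗ₜ[k] w) := by
    intro d
    induction d with
    | zero => simp only [map_zero, LinearMap.zero_apply]
    | add s t hs ht => simp only [map_add, LinearMap.add_apply, hs, ht]
    | tmul x y =>
      change toHom k V V ((toEnd V).lin (ULift.up x)) v ⊗ₜ[k]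
        toHom k W W ((toEnd W).lin (ULift.up y)) w = _
      rw [toHom_toEnd_lin, toHom_toEnd_lin, outerAct_tmul, TensorProduct.map_tmul]
  refine (h1 ((A.envelopingBraidedGroup R).comul h)).trans ?_
  rw [outerAct_comul_apply]
  refine Eq.trans ?_ (map_toHom_shuffle V W v w ((dualTensorInv V W).lin.lTensor (V ⊗[k] W)
      ((toEnd (V ⊗ W : Rep hR)).lin (ULift.up h)))).symm
  refine sum3_congr _ fun x1 x2 x3 => sum3_congr _ fun X1 X2 X3 => sum2_congr _ fun X31 X32 =>
    sum2_congr _ fun R1 R2 => sum3_congr _ fun y1 y2 y3 => sum2_congr _ fun a b => ?_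
  exact congrArg _ (ctr_dualTensorInv_toEnd V W _ _ h).symm

/-- The coevaluation of the unit object is multiplication by `ε(β)`; the normalisation makes it the
identity. -/
theorem toEnd_counit (hβ : A.ε A.β = 1) : (toEnd (𝟙_ (Rep hR))).lin =
    (η_ (𝟙_ (Rep hR)) (lDual (𝟙_ (Rep hR)))).lin ∘ₗ
      (ULift.moduleEquiv : ULift.{v} k ≃ₗ[k] k).symm.toLinearMap ∘ₗ
        (A.envelopingBraidedGroup R).counit ∘ₗ (down k H).toLinearMap := by
  refine LinearMap.ext fun h => toHom_injective ?_
  obtain ⟨h⟩ := h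
  rw [coev_eq]
  refine (toHom_toEnd_lin _ _).trans (Eq.trans ?_ (toHom_coev_lin (𝟙_ (Rep hR)) (A.ε h)).symm)
  refine LinearMap.ext fun x => ?_
  change A.trivialAct _ h x = A.ε h • A.trivialAct _ A.β x
  rw [trivialAct_apply, trivialAct_apply, hβ, one_smul]

theorem toEnd_antipode (V : Rep hR) : (toEnd V).lin ∘ₗ (down k H).symm.toLinearMap ∘ₗ
    (A.envelopingBraidedGroup R).antipode ∘ₗ (down k H).toLinearMap =
    ((ρ_ (adjoint hR)).inv ≫ adjoint hR ◁ η_ V (lDual V) ≫ (α_ _ _ _).inv ≫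
      (β_ (adjoint hR) V).hom ▷ lDual V ≫ (α_ _ _ _).hom ≫
        V ◁ endFamily.action.act (lDual V)).lin := by
  refine LinearMap.ext fun h => toHom_injective ?_
  obtain ⟨h⟩ := h
  change toHom k V V ((toEnd V).lin (ULift.up ((A.envelopingBraidedGroup R).antipode h))) = _
  rw [toHom_toEnd_lin]
  exact (toHom_antipode V h).symm

theorem toEnd_tensor_toEnd_injective :
    Function.Injective (toEnd (regular hR) ⊗ₘ toEnd (regular hR)).lin :=
  TensorProduct.map_injective_of_flat_flat _ _ toEnd_injective toEnd_injective

theorem coev_unit_injective (hβ : A.ε A.β = 1) :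
    Function.Injective (η_ (𝟙_ (Rep hR)) (lDual (𝟙_ (Rep hR)))).lin := by
  have h1 : ∀ c : k, toHom k _ _ ((coev (𝟙_ (Rep hR))).lin (ULift.up c)) (ULift.up 1) =
      ULift.up c := by
    intro c
    rw [toHom_coev_lin]
    change c • A.trivialAct (ULift.{v} k) A.β (ULift.up 1) = _
    rw [trivialAct_apply, hβ, one_smul]
    exact congrArg ULift.up (mul_one c)
  intro x y h
  obtain ⟨x⟩ := x
  obtain ⟨y⟩ := y
  exact (h1 x).symm.trans ((congrArg (fun t => toHom k _ _ t (ULift.up 1)) h).trans (h1 y))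

variable (hR) in
/-- The structure maps of the enveloping algebra braided group, as morphisms. -/
noncomputable def adjointMaps (hβ : A.ε A.β = 1) : HopfMaps (adjoint hR) where
  mul := homOfInjective (toEnd (regular hR)) toEnd_injective _ _ (toEnd_mul _)
  one := homOfInjective (toEnd (regular hR)) toEnd_injective _ _ (toEnd_one _)
  comul := homOfInjective _ toEnd_tensor_toEnd_injective _ _ (toEnd_comul _ _)
  counit := homOfInjective _ (coev_unit_injective hβ) _ _ (toEnd_counit hβ).symm
  antipode := homOfInjective (toEnd (regular hR)) toEnd_injective _ _ (toEnd_antipode _)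

theorem compatible_adjointMaps (hβ : A.ε A.β = 1) :
    endFamily.Compatible (adjointMaps hR hβ) where
  mul_map V := hom_ext (toEnd_mul V)
  one_map V := hom_ext (toEnd_one V)
  comul_map V W := hom_ext (toEnd_comul V W)
  map_unit := hom_ext (toEnd_counit hβ)
  antipode_map V := hom_ext (toEnd_antipode V)

end Rep

end QuasiHopfAlgebra

/-! ### Coproduct, unit and counit of the function algebra braided group -/

namespace QuasiHopfAlgebra

open QuasiHopf

section Dual

variable {k H : Type*} [Field k] [Ring H] [Algebra k H] {A : QuasiHopfAlgebra k H}

theorem dualBiact_apply (a b g : H) (χ : Module.Dual k H) : dualBiact k a b χ g = χ (b * (g * a)) :=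
  rfl

theorem evalAt_map_dualBiact (a b c d g h : H) (t : Module.Dual k H ⊗[k] Module.Dual k H) :
    evalAt g h (TensorProduct.map (dualBiact k a b) (dualBiact k c d) t) =
      evalAt (b * (g * a)) (d * (h * c)) t := by
  induction t with
  | zero => simp
  | add s t hs ht => simp only [map_add, hs, ht]
  | tmul φ ψ => rfl

theorem evalAt_dualComul [FiniteDimensional k H] (g h : H) (χ : Module.Dual k H) :
    evalAt g h (dualComul k H χ) = χ (g * h) := by
  rw [evalAt_eq]
  exact LinearMap.congr_fun ((TensorProduct.dualDistribEquiv k H H).apply_symm_apply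
    ((LinearMap.mul' k H).dualMap χ)) (g ⊗ₜ[k] h)

end Dual

namespace Rep

open CategoryTheory MonoidalCategory

variable {k : Type u} {H : Type v} [Field k] [Ring H] [Algebra k H] {A : QuasiHopfAlgebra k H}
  {R : H ⊗[k] H} {hR : A.IsRMatrix R}

theorem coevalRight_lin (V : Rep hR) (x : V) : (coevalRight V).lin x =
    sum3 A.Phi fun X1 X2 X3 => sum2 (coevaluation k V 1) fun v ψ =>
      V.act X1 (V.act A.β v) ⊗ₜ[k] (A.dualAct V.act X2 ψ ⊗ₜ[k] V.act X3 x) := by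
  change A.assocMap V.act (A.dualAct V.act) V.act ((coev V).lin (ULift.up 1) ⊗ₜ[k] x) = _
  rw [coev_lin_eq_sum2]
  simp only [sum2_tmul, map_sum2, assocMap_tmul, sum2_sum3_comm]

variable [FiniteDimensional k H]

/-- The cocomposition inserts a dual basis between `φ` and `x`. Removing it multiplies the two
arguments together, with the reassociators, `β` and the antipodes in between. -/
theorem coeff_comul (V : Rep hR) : (A.functionBraidedGroup R).comul ∘ₗ (coeff V).lin =
    (CoendFamily.cocompMap V ≫ (coeff V ⊗ₘ coeff V)).lin := by
  refine TensorProduct.ext' fun (φ : Module.Dual k V) x => evalAt_ext fun g h => ?_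
  change evalAt g h ((A.functionBraidedGroup R).comul (coeffMap V.act (φ ⊗ₜ[k] x))) =
    evalAt g h (TensorProduct.map (coeffMap V.act) (coeffMap V.act)
      (A.assocInvMap (A.dualAct V.act) V.act (A.tensorAct (A.dualAct V.act) V.act)
        (φ ⊗ₜ[k] (coevalRight V).lin x)))
  rw [coevalRight_lin]
  simp only [tmul_sum3, tmul_sum2, map_sum2, map_sum3, assocInvMap_tmul, tensorAct_eq_sum2,
    sum2_apply, functionBraidedGroup, sum3_apply, LinearMap.comp_apply, evalAt_map_dualBiact,
    evalAt_dualComul, TensorProduct.map_tmul]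
  simp only [sum2_sum3_comm]
  rw [sum3_comm]
  refine sum3_congr _ fun X1 X2 X3 => sum3_congr _ fun x1 x2 x3 => ?_
  rw [sum2_comm]
  refine sum2_congr _ fun a b => ?_
  have h1 := (sum2_coevaluation (Z := k)
    (φ ∘ₗ V.act (A.S x1 * g * (x2 * X1 * A.β))) (V.act (A.S (a * X2) * (h * (b * X3))) x)).symm
  refine Eq.trans ?_ (h1.trans ?_)
  · simp [mul_assoc]
  · refine sum2_congr _ fun v ψ => ?_
    simp [mul_assoc, A.S_mul, mul_comm]

/-- The evaluation of the unit object is scaled by `ε(α)`, which the normalisation sets to `1`. -/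
theorem coeff_unit (hα : A.ε A.α = 1) : (coeff (𝟙_ (Rep hR))).lin =
    LinearMap.toSpanSingleton k (Module.Dual k H) (A.functionBraidedGroup R).one ∘ₗ
      (ULift.moduleEquiv : ULift.{v} k ≃ₗ[k] k).toLinearMap ∘ₗ
        (ε_ (𝟙_ (Rep hR)) (lDual (𝟙_ (Rep hR)))).lin := by
  refine TensorProduct.ext' fun (φ : Module.Dual k (ULift.{v} k)) (x : ULift.{v} k) => ?_
  refine LinearMap.ext fun g => ?_
  change φ (A.trivialAct _ g x) = φ (A.trivialAct _ A.α x) * A.ε g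
  rw [trivialAct_apply, trivialAct_apply, hα, map_smul, one_smul, smul_eq_mul, mul_comm]

theorem coeff_counit (V : Rep hR) :
    ((ULift.moduleEquiv : ULift.{v} k ≃ₗ[k] k).symm.toLinearMap ∘ₗ
      (A.functionBraidedGroup R).counit) ∘ₗ (coeff V).lin = (ε_ V (lDual V)).lin := by
  refine TensorProduct.ext' fun (φ : Module.Dual k V) (x : V) => ?_
  rfl

end Rep

end QuasiHopfAlgebra

/-! ### Product of the function algebra braided group -/

namespace QuasiHopfAlgebra

open QuasiHopf

namespace Rep

open CategoryTheory MonoidalCategory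

variable {k : Type u} {H : Type v} [Field k] [Ring H] [Algebra k H] {A : QuasiHopfAlgebra k H}
  {R : H ⊗[k] H} {hR : A.IsRMatrix R}

theorem coendShuffle_lin_tmul (V W : Rep hR) (φ : Module.Dual k V) (x : V) (ψ : Module.Dual k W)
    (y : W) : (CoendFamily.shuffle V W).lin ((φ ⊗ₜ[k] x) ⊗ₜ[k] (ψ ⊗ₜ[k] y)) =
      sum3 A.PhiInv fun x1 x2 x3 => sum2 (A.Δ x3) fun x31 x32 =>
      sum3 A.Phi fun X1 X2 X3 => sum2 (A.Δ X3) fun X31 X32 =>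
      sum3 A.Phi fun Y1 Y2 Y3 => sum3 A.PhiInv fun y1 y2 y3 => sum2 R fun r1 r2 =>
        (A.dualAct V.act (x1 * X1) φ ⊗ₜ[k] A.dualAct W.act (x2 * Y1 * r2 * y2 * X31) ψ) ⊗ₜ[k]
          (V.act (x31 * Y2 * r1 * y1 * X2) x ⊗ₜ[k] W.act (x32 * Y3 * y3 * X32) y) := by
  change A.assocInvMap (A.dualAct V.act) (A.dualAct W.act) (A.tensorAct V.act W.act)
    ((A.assocMap (A.dualAct W.act) V.act W.act).lTensor (Module.Dual k V)
      (((braiding R V.act (A.dualAct W.act)).rTensor W).lTensor (Module.Dual k V)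
        ((A.assocInvMap V.act (A.dualAct W.act) W.act).lTensor (Module.Dual k V)
          (A.assocMap (A.dualAct V.act) V.act (A.tensorAct (A.dualAct W.act) W.act)
            ((φ ⊗ₜ[k] x) ⊗ₜ[k] (ψ ⊗ₜ[k] y)))))) = _
  simp only [assocMap_tmul, assocInvMap_tmul, map_sum3, braiding_tmul, map_sum2, tmul_sum2,
    tmul_sum3, LinearMap.lTensor_tmul, LinearMap.rTensor_tmul, tensorAct_eq_sum2,
    sum2_apply, sum3_tmul, sum2_tmul, TensorProduct.map_tmul]
  simp only [sum2_sum3_comm]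
  refine Eq.trans ?_ (sum3_comm _ _ _).symm
  refine sum3_congr _ fun X1 X2 X3 => ?_
  refine Eq.trans ((sum3_congr _ fun y1 y2 y3 => sum3_comm _ _ _).trans
    ((sum3_comm _ _ _).trans (sum3_congr _ fun x1 x2 x3 => sum3_comm _ _ _))) ?_
  refine sum3_congr _ fun x1 x2 x3 => sum3_congr _ fun Y1 Y2 Y3 => sum3_congr _ fun y1 y2 y3 => ?_
  refine Eq.trans ?_ (sum2_comm _ _ _)
  refine sum2_congr _ fun X31 X32 => (sum2_comm _ _ _).trans ?_
  refine sum2_congr _ fun x31 x32 => sum2_congr _ fun r1 r2 => ?_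
  simp only [map_mul, Module.End.mul_apply]

theorem dualDistrib_outerAct (B : H ⊗[k] H) {V W : Type*} [AddCommGroup V] [Module k V] [AddCommGroup W]
    [Module k W] (ρ : H →ₐ[k] Module.End k V) (σ : H →ₐ[k] Module.End k W) (φ : Module.Dual k V)
    (ψ : Module.Dual k W) (x : V) (y : W) :
    TensorProduct.dualDistrib k V W (φ ⊗ₜ[k] ψ) (outerAct ρ σ B (x ⊗ₜ[k] y)) =
      TensorProduct.dualDistrib k H H (coeffMap ρ (φ ⊗ₜ[k] x) ⊗ₜ[k] coeffMap σ (ψ ⊗ₜ[k] y)) B := by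
  induction B with
  | zero => simp
  | add s t hs ht => simp only [map_add, LinearMap.add_apply, hs, ht]
  | tmul a b => simp

theorem dualDistrib_comm_mul_mul (f R : H ⊗[k] H) (χ : Module.Dual k (H ⊗[k] H)) (t : H ⊗[k] H) :
    χ (TensorProduct.comm k H H f * R * t) = sum2 f fun f1 f2 => sum2 R fun R1 R2 =>
      χ ((f2 * R1) ⊗ₜ[k] (f1 * R2) * t) := by
  have h1 := (sum2_eq f (χ ∘ₗ LinearMap.mulRight k t ∘ₗ LinearMap.mulRight k R ∘ₗ
    (TensorProduct.comm k H H).toLinearMap)).symm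
  refine h1.trans (sum2_congr _ fun f1 f2 => ?_)
  refine (sum2_eq R (χ ∘ₗ LinearMap.mulRight k t ∘ₗ LinearMap.mulLeft k (f2 ⊗ₜ[k] f1))).symm.trans
    (sum2_congr _ fun R1 R2 => ?_)
  simp

variable [FiniteDimensional k H]

/-- The dual of the braiding evaluates on `W ⊗ V`, so the comparison map contributes the flipped
twist; the coefficient at `g` is thus taken at `f₂₁ R Δ(g)`. -/
theorem coeff_dualTensor_lin_tmul (V W : Rep hR) (φ : Module.Dual k V) (ψ : Module.Dual k W) (x : V)
    (y : W) (g : H) : (((dualTensor W V ≫ dualHom (β_ V W).hom) ▷ (V ⊗ W) ≫ coeff (V ⊗ W)).lin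
      ((φ ⊗ₜ[k] ψ) ⊗ₜ[k] (x ⊗ₜ[k] y)) : Module.Dual k H) g =
      TensorProduct.dualDistrib k V W (φ ⊗ₜ[k] ψ) (outerAct V.act W.act
        (TensorProduct.comm k H H A.f * R * A.Δ g) (x ⊗ₜ[k] y)) := by
  change (coeffMap (A.tensorAct V.act W.act) (((dualHom (β_ V W).hom).lin
    ((dualTensor W V).lin (φ ⊗ₜ[k] ψ))) ⊗ₜ[k] (x ⊗ₜ[k] y))) g = _
  rw [dualHom_lin]
  change Module.Dual.eval k (W ⊗[k] V) (braiding R V.act W.act (A.tensorAct V.act W.act g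
    (x ⊗ₜ[k] y))) ((dualTensor W V).lin (φ ⊗ₜ[k] ψ)) = _
  rw [eval_dualTensor_lin, outerAct_comm, map_mul, map_mul]
  simp only [Module.End.mul_apply]
  exact congrArg (fun z => TensorProduct.dualDistrib k V W (φ ⊗ₜ[k] ψ) (outerAct V.act W.act
    (TensorProduct.comm k H H A.f) z)) ((TensorProduct.comm k V W).symm_apply_apply _)

theorem coeff_mul (V W : Rep hR) :
    (A.functionBraidedGroup R).mul ∘ₗ TensorProduct.map (coeff V).lin (coeff W).lin =
      (CoendFamily.shuffle V W ≫ (dualTensor W V ≫ dualHom (β_ V W).hom) ▷ (V ⊗ W) ≫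
        coeff (V ⊗ W)).lin := by
  refine TensorProduct.ext (TensorProduct.ext (LinearMap.ext₂ fun (φ : Module.Dual k V) (x : V) =>
    TensorProduct.ext (LinearMap.ext₂ fun (ψ : Module.Dual k W) (y : W) =>
      LinearMap.ext fun g => ?_)))
  change (A.functionBraidedGroup R).mul (coeffMap V.act (φ ⊗ₜ[k] x) ⊗ₜ[k]
    coeffMap W.act (ψ ⊗ₜ[k] y)) g = Module.Dual.eval k H g
      (((dualTensor W V ≫ dualHom (β_ V W).hom) ▷ (V ⊗ W) ≫ coeff (V ⊗ W)).lin
        ((CoendFamily.shuffle V W).lin ((φ ⊗ₜ[k] x) ⊗ₜ[k] (ψ ⊗ₜ[k] y))))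
  rw [coendShuffle_lin_tmul]
  simp only [map_sum2, map_sum3]
  simp only [functionBraidedGroup, sum3_apply, sum2_apply]
  refine sum3_congr _ fun x1 x2 x3 => sum2_congr _ fun x31 x32 => ?_
  refine sum3_congr _ fun X1 X2 X3 => sum2_congr _ fun X31 X32 => ?_
  refine sum3_congr _ fun Y1 Y2 Y3 => sum3_congr _ fun y1 y2 y3 => ?_
  -- Two copies of `R` occur: `r¹ ⊗ r²` belongs to the shuffle, `R¹ ⊗ R²` to the dualised braiding.
  refine (sum2_congr _ fun f1 f2 => sum2_comm R R _).trans ((sum2_comm A.f R _).trans ?_)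
  refine sum2_congr _ fun r1 r2 => ?_
  refine Eq.trans ?_ (coeff_dualTensor_lin_tmul V W _ _ _ _ g).symm
  rw [dualDistrib_outerAct, dualDistrib_comm_mul_mul]
  refine sum2_congr _ fun f1 f2 => sum2_congr _ fun R1 R2 => ?_
  refine LinearMap.congr_fun (f := TensorProduct.dualDistrib k H H
    (TensorProduct.map (dualBiact k (x31 * Y2 * r1 * y1 * X2) (A.S (x1 * X1) * f2 * R1))
      (dualBiact k (x32 * Y3 * y3 * X32) (A.S (x2 * Y1 * r2 * y2 * X31) * f1 * R2))
      (coeffMap V.act (φ ⊗ₜ[k] x) ⊗ₜ[k] coeffMap W.act (ψ ⊗ₜ[k] y))))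
    (g := TensorProduct.dualDistrib k H H
        (coeffMap V.act (A.dualAct V.act (x1 * X1) φ ⊗ₜ[k] V.act (x31 * Y2 * r1 * y1 * X2) x) ⊗ₜ[k]
          coeffMap W.act (A.dualAct W.act (x2 * Y1 * r2 * y2 * X31) ψ ⊗ₜ[k]
            W.act (x32 * Y3 * y3 * X32) y)) ∘ₗ LinearMap.mulLeft k ((f2 * R1) ⊗ₜ[k] (f1 * R2)))
    (TensorProduct.ext' fun a b => ?_) (A.Δ g)
  simp [mul_assoc, dualBiact_apply, A.S_mul]

end Rep

end QuasiHopfAlgebra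

/-! ### Antipode of the function algebra braided group -/

namespace QuasiHopfAlgebra

open QuasiHopf

namespace Rep

open CategoryTheory MonoidalCategory

variable {k : Type u} {H : Type v} [Field k] [Ring H] [Algebra k H] {A : QuasiHopfAlgebra k H}
  {R : H ⊗[k] H} {hR : A.IsRMatrix R}

variable [FiniteDimensional k H]

theorem braiding_inv_lin_tmul (V W : Rep hR) (w : W) (v : V) : (β_ V W).inv.lin (w ⊗ₜ[k] v) =
    sum2 (Ring.inverse R) fun R1 R2 => V.act R1 v ⊗ₜ[k] W.act R2 w := by
  rw [braiding_inv_lin]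
  change outerAct V.act W.act (Ring.inverse R) (v ⊗ₜ[k] w) = _
  rw [outerAct_eq_sum2, sum2_apply]
  rfl

/-- Under the antipode the `S⁻¹` in `q_R` disappears, leaving `S(X²) α X³`, the factor produced by
reassociating before an evaluation. -/
theorem sum2_qR (hR : A.IsRMatrix R) {P : Type*} [AddCommMonoid P] [Module k P] (f : H →ₗ[k] H →ₗ[k] P) :
    (sum2 A.qR fun q1 q2 => f q1 (A.S q2)) =
      sum3 A.Phi fun X1 X2 X3 => f X1 (A.S X2 * A.α * X3) := by
  refine (sum2_eq A.qR (TensorProduct.lift f ∘ₗ A.S.lTensor H)).trans ?_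
  rw [qR, map_sum3]
  refine sum3_congr _ fun X1 X2 X3 => ?_
  simp [A.S_mul, S_Sinv hR, mul_assoc]

/-- Correspondingly `S(p̃¹) ⊗ p̃²` is the factor `X¹ β S(X²) ⊗ X³` produced by a coevaluation
followed by a reassociation. -/
theorem sum2_pL (hR : A.IsRMatrix R) {P : Type*} [AddCommMonoid P] [Module k P] (f : H →ₗ[k] H →ₗ[k] P) :
    (sum2 A.pL fun p1 p2 => f (A.S p1) p2) =
      sum3 A.Phi fun X1 X2 X3 => f (X1 * A.β * A.S X2) X3 := by
  refine (sum2_eq A.pL (TensorProduct.lift f ∘ₗ A.S.rTensor H)).trans ?_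
  rw [pL, map_sum3]
  refine sum3_congr _ fun X1 X2 X3 => ?_
  simp [A.S_mul, S_Sinv hR, mul_assoc]

/-- The split factors `q¹`, `R̄¹` combine into one coadjoint action, and `q_R`, `p_L` are replaced
by the reassociators they stand for; in this form the antipode can be compared with the categorical
one. -/
theorem functionBraidedGroup_antipode (hR : A.IsRMatrix R) (χ : Module.Dual k H) :
    (A.functionBraidedGroup R).antipode χ =
      sum3 A.Phi fun Z1 Z2 Z3 => sum2 (Ring.inverse R) fun R1 R2 =>
        A.coadAct (Z1 * R1) (sum3 A.Phi fun X1 X2 X3 =>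
          dualBiact k X3 (R2 * (X1 * A.β * A.S X2))
            (A.S.dualMap ((LinearMap.mul k H).flip.compr₂ χ (A.S Z2 * A.α * Z3)))) := by
  simp only [functionBraidedGroup, sum2_apply]
  have h1 : ∀ q1 q2 R1 R2 : H,
      (sum2 (A.Δ q1) fun q11 q12 => sum2 (A.Δ R1) fun R11 R12 => sum2 A.pL fun p1 p2 =>
        (dualBiact k (q12 * R12 * p2) (q2 * R2 * A.S (q11 * R11 * p1)) ∘ₗ A.S.dualMap) χ) =
      ((A.coadAct.toLinearMap ∘ₗ LinearMap.mulRight k R1).compl₂ ((sum3 A.Phi fun X1 X2 X3 =>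
          dualBiact k X3 (R2 * (X1 * A.β * A.S X2)) ∘ₗ A.S.dualMap) ∘ₗ
            (LinearMap.mul k H).flip.compr₂ χ)) q1 (A.S q2) := by
    intro q1 q2 R1 R2
    change _ = A.coadAct (q1 * R1) ((sum3 A.Phi fun X1 X2 X3 =>
          dualBiact k X3 (R2 * (X1 * A.β * A.S X2)) ∘ₗ A.S.dualMap)
            ((LinearMap.mul k H).flip.compr₂ χ (A.S q2)))
    have h2 := sum2_pL hR (LinearMap.mk₂ k (fun a b => dualBiact k b (R2 * a) (A.S.dualMap
      ((LinearMap.mul k H).flip.compr₂ χ (A.S q2))))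
      (fun a b c => by ext; simp [dualBiact_apply, mul_add, add_mul])
      (fun a b c => by ext; simp [dualBiact_apply])
      (fun a b c => by ext; simp [dualBiact_apply, mul_add, add_mul])
      (fun a b c => by ext; simp [dualBiact_apply]))
    simp only [LinearMap.mk₂_apply] at h2
    rw [sum3_apply]
    simp only [LinearMap.comp_apply]
    rw [← h2, map_mul, Module.End.mul_apply, coadAct_apply, coadAct_apply]
    refine sum2_congr _ fun q11 q12 => ?_
    rw [map_sum2]
    refine sum2_congr _ fun R11 R12 => ?_
    rw [map_sum2, map_sum2]
    refine sum2_congr _ fun p1 p2 => ?_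
    ext g
    simp [dualBiact_apply, A.S_mul, mul_assoc]
  refine Eq.trans (sum2_congr _ fun q1 q2 => (sum2_comm _ _ _).trans
    (sum2_congr _ fun R1 R2 => h1 q1 q2 R1 R2)) ?_
  refine (sum2_comm _ _ _).trans (Eq.trans ?_ (sum2_sum3_comm _ _ _))
  refine sum2_congr _ fun R1 R2 => (sum2_qR hR _).trans ?_
  refine sum3_congr _ fun Z1 Z2 Z3 => ?_
  refine congrArg (A.coadAct (Z1 * R1)) ?_
  refine (sum3_apply _ _ _).trans ?_
  rfl

omit [FiniteDimensional k H] in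
theorem sum2_coevaluation_lDual (V : Rep hR) (a b : H) (φ : Module.Dual k V) (u : V) :
    (sum2 (coevaluation k (Module.Dual k V) 1) fun ξ η =>
      ξ u • coeffMap (A.dualAct V.act) (A.dualAct (A.dualAct V.act) a η ⊗ₜ[k]
        A.dualAct V.act b φ)) =
      dualBiact k b (A.S a) (A.S.dualMap (coeffMap V.act (φ ⊗ₜ[k] u))) := by
  refine LinearMap.ext fun g => ?_
  have h1 := sum2_coevaluation (Z := k) (Module.Dual.eval k V u)
    (A.dualAct V.act (A.S a * (g * b)) φ)
  refine Eq.trans ((map_sum2 (LinearMap.applyₗ g) _ _).trans ?_) (h1.trans ?_)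
  · refine sum2_congr _ fun ξ η => ?_
    change ξ u * η (A.dualAct V.act (A.S a) (A.dualAct V.act g (A.dualAct V.act b φ))) =
      η (A.dualAct V.act (A.S a * (g * b)) φ) * ξ u
    rw [map_mul, map_mul, mul_comm]
    rfl
  · rfl

/-- The matrix coefficients of `V*` are those of `V` composed with `S`. The coevaluation of `V*`
gives `p_L`, the inverse braiding gives `R⁻¹`, and the final evaluation gives `q_R`. -/
theorem coeff_antipode (V : Rep hR) : (A.functionBraidedGroup R).antipode ∘ₗ (coeff V).lin =
    (coendFamily.coaction.coact (lDual V) ▷ V ≫ (β_ (coadjoint hR) (lDual V)).inv ▷ V ≫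
      (α_ _ _ _).hom ≫ coadjoint hR ◁ ε_ V (lDual V) ≫ (ρ_ (coadjoint hR)).hom).lin := by
  refine TensorProduct.ext' fun (φ : Module.Dual k V) (x : V) => ?_
  change (A.functionBraidedGroup R).antipode (coeffMap V.act (φ ⊗ₜ[k] x)) =
    (ρ_ (coadjoint hR)).hom.lin ((ev V).lin.lTensor (Module.Dual k H)
      (A.assocMap A.coadAct (A.dualAct V.act) V.act
        ((β_ (coadjoint hR) (lDual V)).inv.lin
          ((coeff (lDual V)).lin.lTensor (Module.Dual k V) ((coevalRight (lDual V)).lin φ)) ⊗ₜ[k] x)))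
  have h1 : ∀ (ξ : Module.Dual k V) (χ : Module.Dual k H),
      (ρ_ (coadjoint hR)).hom.lin ((ev V).lin.lTensor (Module.Dual k H)
        (A.assocMap A.coadAct (A.dualAct V.act) V.act
          ((β_ (coadjoint hR) (lDual V)).inv.lin (ξ ⊗ₜ[k] χ) ⊗ₜ[k] x))) =
      sum2 (Ring.inverse R) fun R1 R2 => sum3 A.Phi fun Z1 Z2 Z3 =>
        ξ (V.act (A.S R2 * (A.S Z2 * A.α * Z3)) x) • A.coadAct (Z1 * R1) χ := by
    intro ξ χ
    refine (congrArg (fun t => (ρ_ (coadjoint hR)).hom.lin ((ev V).lin.lTensor (Module.Dual k H)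
      (A.assocMap A.coadAct (A.dualAct V.act) V.act (t ⊗ₜ[k] x))))
      (braiding_inv_lin_tmul (coadjoint hR) (lDual V) ξ χ)).trans ?_
    rw [sum2_tmul, map_sum2, map_sum2, map_sum2]
    refine sum2_congr _ fun R1 R2 => ?_
    rw [assocMap_tmul, map_sum3, map_sum3]
    refine sum3_congr _ fun Z1 Z2 Z3 => ?_
    simp only [map_mul, Module.End.mul_apply]
    rfl
  rw [functionBraidedGroup_antipode hR, coevalRight_lin]
  simp only [map_sum3, map_sum2, LinearMap.lTensor_tmul, sum3_tmul, sum2_tmul]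
  symm
  refine Eq.trans (sum3_congr _ fun X1 X2 X3 => sum2_congr _ fun ξ η => h1 _ _) ?_
  refine (sum3_congr _ fun X1 X2 X3 => sum2_comm _ _ _).trans ?_
  refine (sum3_congr _ fun X1 X2 X3 => sum2_congr _ fun R1 R2 => sum2_sum3_comm _ _ _).trans ?_
  refine (sum3_congr _ fun X1 X2 X3 => sum2_sum3_comm _ _ _).trans ((sum3_comm _ _ _).trans ?_)
  refine sum3_congr _ fun Z1 Z2 Z3 => (sum2_sum3_comm _ _ _).symm.trans ?_
  refine sum2_congr _ fun R1 R2 => sum3_congr _ fun X1 X2 X3 => ?_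
  refine Eq.trans ?_ (congrArg (A.coadAct (Z1 * R1)) ((sum2_coevaluation_lDual V X2 X3 φ
    (V.act (A.S A.β * (A.S X1 * (A.S R2 * (A.S Z2 * A.α * Z3)))) x)).trans ?_))
  · rw [map_sum2]
    refine sum2_congr _ fun ξ η => ?_
    rw [map_smul, map_mul V.act (A.S A.β), map_mul V.act (A.S X1)]
    rfl
  · ext g
    simp [dualBiact_apply, A.S_mul, mul_assoc]

/-- A linear map whose composition with an epimorphism is linear over `H`. -/
def homOfSurjective {X Y Z : Rep hR} (p : X ⟶ Y) (hp : Function.Surjective p.lin) (f : Y →ₗ[k] Z)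
    (g : X ⟶ Z) (h : f ∘ₗ p.lin = g.lin) : Y ⟶ Z where
  lin := f
  comm a := by
    refine LinearMap.ext fun y => ?_
    obtain ⟨x, rfl⟩ := hp y
    have h1 := LinearMap.congr_fun h
    have h2 := LinearMap.congr_fun (p.comm a) x
    have h3 := LinearMap.congr_fun (g.comm a) x
    simp only [LinearMap.comp_apply] at h1 h2 h3 ⊢
    rw [← h2, h1, h1, h3]

theorem coeff_tensor_coeff_surjective :
    Function.Surjective (coeff (regular hR) ⊗ₘ coeff (regular hR)).lin :=
  TensorProduct.map_surjective coeff_surjective coeff_surjective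

theorem ev_unit_surjective (hα : A.ε A.α = 1) :
    Function.Surjective (ε_ (𝟙_ (Rep hR)) (lDual (𝟙_ (Rep hR)))).lin := by
  rintro ⟨c⟩
  refine ⟨(ULift.moduleEquiv : ULift.{v} k ≃ₗ[k] k).toLinearMap ⊗ₜ[k] (ULift.up c : ULift.{v} k), ?_⟩
  rw [ev_eq, ev_lin_tmul]
  refine congrArg ULift.up ?_
  change (A.trivialAct (ULift.{v} k) A.α (ULift.up c)).down = c
  rw [trivialAct_apply, hα, one_smul]

variable (hR) in
/-- The structure maps of the function algebra braided group, as morphisms. -/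
noncomputable def coadjointMaps (hα : A.ε A.α = 1) : HopfMaps (coadjoint hR) where
  mul := homOfSurjective _ coeff_tensor_coeff_surjective (A.functionBraidedGroup R).mul _
    (coeff_mul _ _)
  one := homOfSurjective _ (ev_unit_surjective hα) (LinearMap.toSpanSingleton k (Module.Dual k H)
    (A.functionBraidedGroup R).one ∘ₗ (ULift.moduleEquiv : ULift.{v} k ≃ₗ[k] k).toLinearMap) _
    (coeff_unit hα).symm
  comul := homOfSurjective _ coeff_surjective (A.functionBraidedGroup R).comul _ (coeff_comul _)
  counit := homOfSurjective _ coeff_surjective _ _ (coeff_counit _)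
  antipode := homOfSurjective _ coeff_surjective (A.functionBraidedGroup R).antipode _
    (coeff_antipode _)

theorem compatible_coadjointMaps (hα : A.ε A.α = 1) :
    coendFamily.Compatible (coadjointMaps hR hα) where
  map_mul V W := hom_ext (coeff_mul V W)
  map_unit := hom_ext (coeff_unit hα)
  map_comul V := hom_ext (coeff_comul V)
  map_counit V := hom_ext (coeff_counit V)
  map_antipode V := hom_ext (coeff_antipode V)

end Rep

end QuasiHopfAlgebra

/-! ### The map `𝒬` -/

namespace QuasiHopfAlgebra

open QuasiHopf

section Elements

variable {k H : Type*} [Field k] [Ring H] [Algebra k H] {A : QuasiHopfAlgebra k H}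

/-- Explains `U`: the factor `f⁻¹` from splitting the dual of `V ⊗ W`, followed by the `q_R` from
evaluating `V* ⊗ V` to the right of `W*`. -/
theorem U_eq : A.U = A.fInv * TensorProduct.comm k H H (TensorProduct.map A.S A.S A.qR) := by
  have h1 := (sum2_eq A.qR (LinearMap.mulLeft k A.fInv ∘ₗ (TensorProduct.comm k H H).toLinearMap ∘ₗ
    TensorProduct.map A.S A.S)).symm
  refine (sum2_comm _ _ _).trans (Eq.trans (sum2_congr _ fun q1 q2 => ?_) h1.symm)
  refine Eq.trans ?_ (sum2_eq A.fInv (LinearMap.mulRight k (A.S q2 ⊗ₜ[k] A.S q1)))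
  exact sum2_congr _ fun g1 g2 => by simp

theorem apply_mul_comm_mul_mul {P : Type*} [AddCommGroup P] [Module k P] (G : H ⊗[k] H →ₗ[k] P)
    (f R U : H ⊗[k] H) : G (f * TensorProduct.comm k H H R * R * U) =
      sum2 f fun f1 f2 => sum2 R fun R1 R2 => sum2 R fun r1 r2 => sum2 U fun U1 U2 =>
        G ((f1 * R2 * r1 * U1) ⊗ₜ[k] (f2 * R1 * r2 * U2)) := by
  refine (sum2_eq f (G ∘ₗ LinearMap.mulRight k U ∘ₗ LinearMap.mulRight k R ∘ₗ
    LinearMap.mulRight k (TensorProduct.comm k H H R))).symm.trans (sum2_congr _ fun f1 f2 => ?_)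
  refine (sum2_eq R (G ∘ₗ LinearMap.mulRight k U ∘ₗ LinearMap.mulRight k R ∘ₗ
    LinearMap.mulLeft k (f1 ⊗ₜ[k] f2) ∘ₗ (TensorProduct.comm k H H).toLinearMap)).symm.trans
    (sum2_congr _ fun R1 R2 => ?_)
  refine Eq.trans ?_ ((sum2_eq R (G ∘ₗ LinearMap.mulRight k U ∘ₗ
    LinearMap.mulLeft k ((f1 * R2) ⊗ₜ[k] (f2 * R1)))).symm.trans
    (sum2_congr _ fun r1 r2 => ?_))
  · simp
  refine Eq.trans ?_ ((sum2_eq U (G ∘ₗ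
    LinearMap.mulLeft k ((f1 * R2 * r1) ⊗ₜ[k] (f2 * R1 * r2)))).symm.trans
    (sum2_congr _ fun U1 U2 => ?_))
  · simp
  · simp

end Elements

namespace Rep

open CategoryTheory MonoidalCategory

variable {k : Type u} {H : Type v} [Field k] [Ring H] [Algebra k H] {A : QuasiHopfAlgebra k H}
  {R : H ⊗[k] H} {hR : A.IsRMatrix R} [FiniteDimensional k H]

/-- Joining the duals contributes `f`, the double braiding `R₂₁ R`, and splitting them again `f⁻¹`.
-/
theorem dualDistrib_dualDoubleBraiding_lin (V W : Rep hR) (ζ : Module.Dual k W ⊗[k] Module.Dual k V)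
    (x : W ⊗[k] V) :
    TensorProduct.dualDistrib k W V ((dualDoubleBraiding V W).lin ζ) x =
      TensorProduct.dualDistrib k W V ζ (TensorProduct.comm k V W (outerAct V.act W.act
        (A.f * TensorProduct.comm k H H R * R * A.fInv) (TensorProduct.comm k W V x))) := by
  change TensorProduct.dualDistrib k W V ((dualTensorInv V W).lin
    ((dualHom ((β_ V W).hom ≫ (β_ W V).hom)).lin ((dualTensor V W).lin ζ))) x = _
  rw [dualDistrib_dualTensorInv_lin, dualHom_lin]
  change Module.Dual.eval k (V ⊗[k] W) (braiding R W.act V.act (braiding R V.act W.act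
    (outerAct V.act W.act A.fInv (TensorProduct.comm k W V x)))) ((dualTensor V W).lin ζ) = _
  rw [eval_dualTensor_lin]
  refine congrArg (fun z => TensorProduct.dualDistrib k W V ζ (TensorProduct.comm k V W z)) ?_
  change outerAct V.act W.act A.f (TensorProduct.comm k W V (outerAct W.act V.act R
    (TensorProduct.comm k V W (outerAct V.act W.act R _)))) = _
  rw [outerAct_comm W.act V.act]
  simp only [map_mul, Module.End.mul_apply]
  refine congrArg _ (congrArg _ ?_)
  exact (TensorProduct.comm k V W).symm_apply_apply _

theorem ev_assoc_apply (V W : Rep hR) (t : Module.Dual k W ⊗[k] Module.Dual k V) (v : V) (w : W) :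
    Module.Dual.eval k W w (((α_ (lDual W) (lDual V) V).hom ≫ lDual W ◁ ε_ V (lDual V) ≫
      (ρ_ (lDual W)).hom).lin (t ⊗ₜ[k] v)) =
      TensorProduct.dualDistrib k W V t (outerAct W.act V.act (TensorProduct.map A.S A.S A.qR)
        (w ⊗ₜ[k] v)) := by
  induction t with
  | zero => simp only [TensorProduct.zero_tmul, map_zero, LinearMap.zero_apply]
  | add s t hs ht => simp only [TensorProduct.add_tmul, map_add, LinearMap.add_apply, hs, ht]
  | tmul ψ φ =>
    change Module.Dual.eval k W w ((ρ_ (lDual W)).hom.lin ((ev V).lin.lTensor (Module.Dual k W)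
      (A.assocMap (A.dualAct W.act) (A.dualAct V.act) V.act ((ψ ⊗ₜ[k] φ) ⊗ₜ[k] v)))) = _
    rw [assocMap_tmul]
    simp only [map_sum3]
    have h1 := sum2_qR hR (LinearMap.mk₂ k (fun a b => ψ (W.act (A.S a) w) * φ (V.act b v))
      (fun a b c => by simp [add_mul]) (fun a b c => by simp [mul_assoc])
      (fun a b c => by simp [mul_add]) (fun a b c => by simp [mul_left_comm]))
    have h2 := sum2_eq A.qR (TensorProduct.dualDistrib k W V (ψ ⊗ₜ[k] φ) ∘ₗ
      LinearMap.applyₗ (w ⊗ₜ[k] v) ∘ₗ (outerAct W.act V.act).toLinearMap ∘ₗ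
        TensorProduct.map A.S A.S)
    refine Eq.trans ?_ (h1.symm.trans h2)
    refine sum3_congr _ fun Z1 Z2 Z3 => ?_
    rw [LinearMap.mk₂_apply, map_mul, map_mul, mul_comm]
    rfl

/-- The element by which `W` is acted on is `𝒬` of a matrix coefficient of `V`: the coevaluation of
`W` gives `p_L`, the last reassociation gives `X¹ ⊗ X² ⊗ X³` with `Δ(X²)` acting on `W* ⊗ V*`, and
the rest is `f R₂₁ R U`. -/
theorem toHom_double_braiding (V W : Rep hR) (φ : Module.Dual k V) (v : V) (w : W) :
    toHom k W W (((λ_ (lDual V)).inv ▷ V ≫ η_ W (lDual W) ▷ lDual V ▷ V ≫ (α_ _ _ _).hom ▷ V ≫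
      (α_ _ _ _).hom ≫ W ◁ dualDoubleBraiding V W ▷ V ≫ W ◁ (α_ _ _ _).hom ≫
      W ◁ lDual W ◁ ε_ V (lDual V) ≫ W ◁ (ρ_ (lDual W)).hom).lin (φ ⊗ₜ[k] v)) w =
      W.act (A.Q R (coeffMap V.act (φ ⊗ₜ[k] v))) w := by
  rw [← MonoidalCategory.whiskerLeft_comp, ← MonoidalCategory.whiskerLeft_comp]
  change toHom k W W (((α_ (lDual W) (lDual V) V).hom ≫ lDual W ◁ ε_ V (lDual V) ≫
      (ρ_ (lDual W)).hom).lin.lTensor W (((dualDoubleBraiding V W).lin.rTensor V).lTensor W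
        (A.assocMap W.act (A.tensorAct (A.dualAct W.act) (A.dualAct V.act)) V.act
          (A.assocMap W.act (A.dualAct W.act) (A.dualAct V.act)
            ((coev W).lin (ULift.up 1) ⊗ₜ[k] φ) ⊗ₜ[k] v)))) w = _
  rw [coev_lin_eq_sum2]
  -- Contracts the dual basis of `W` against the linear form on `W* ⊗ V*` given by an arbitrary `z`,
  -- which later becomes `f R₂₁ R U` applied to vectors.
  have h1 : ∀ (Y1 Y21 Y22 : H) (z : V ⊗[k] W),
      (sum3 A.Phi fun X1 X2 X3 => sum2 (coevaluation k W 1) fun y ψ =>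
        TensorProduct.dualDistrib k W V (A.dualAct W.act (Y21 * X2) ψ ⊗ₜ[k] A.dualAct V.act (Y22 * X3) φ)
          (TensorProduct.comm k V W z) • W.act (Y1 * X1 * A.β) y) =
      sum2 A.pL fun p1 p2 => TensorProduct.lid k W (TensorProduct.map
        (φ ∘ₗ V.act (A.S (Y22 * p2))) (W.act (Y1 * A.S (Y21 * p1))) z) := by
    intro Y1 Y21 Y22 z
    induction z with
    | zero => simp only [map_zero, zero_smul, sum2_zero, sum3_zero]
    | add s t hs ht => simp only [map_add, add_smul, sum2_add, sum3_add, hs, ht]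
    | tmul v w =>
      have h2 := sum2_pL hR (LinearMap.mk₂ k (fun a b => φ (V.act (A.S b * A.S Y22) v) •
        W.act (Y1 * (a * A.S Y21)) w)
        (fun a b c => by simp [add_mul, mul_add]) (fun a b c => by
          simp only [smul_mul_assoc, mul_smul_comm, map_smul, LinearMap.smul_apply]
          exact smul_comm _ _ _)
        (fun a b c => by simp [add_mul, add_smul]) (fun a b c => by simp [mul_smul]))
      refine Eq.trans ?_ (h2.symm.trans ?_)
      · refine sum3_congr _ fun X1 X2 X3 => ?_
        rw [LinearMap.mk₂_apply]
        refine Eq.trans (sum2_congr _ fun y ψ => ?_) (sum2_coevaluation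
          (φ (V.act (A.S X3 * A.S Y22) v) • W.act (Y1 * X1 * A.β))
            (W.act (A.S X2 * A.S Y21) w)) |>.trans ?_
        · simp [A.S_mul, smul_smul, mul_comm]
        · simp [mul_assoc]
      · refine sum2_congr _ fun p1 p2 => ?_
        simp [A.S_mul, mul_assoc]
  have h2 : ∀ (ζ : Module.Dual k W ⊗[k] Module.Dual k V) (x : V) (y : W),
      toHom k W W (((α_ (lDual W) (lDual V) V).hom ≫ lDual W ◁ ε_ V (lDual V) ≫
        (ρ_ (lDual W)).hom).lin.lTensor W (((dualDoubleBraiding V W).lin.rTensor V).lTensor W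
          (y ⊗ₜ[k] (ζ ⊗ₜ[k] x)))) w =
      TensorProduct.dualDistrib k W V ζ (TensorProduct.comm k V W (outerAct V.act W.act
        (A.f * TensorProduct.comm k H H R * R * A.U) (x ⊗ₜ[k] w))) • y := by
    intro ζ x y
    rw [LinearMap.lTensor_tmul, LinearMap.rTensor_tmul, LinearMap.lTensor_tmul, toHom_tmul]
    refine congrArg (fun c : k => c • y)
      ((ev_assoc_apply V W ((dualDoubleBraiding V W).lin ζ) x w).trans ?_)
    rw [dualDistrib_dualDoubleBraiding_lin, outerAct_comm W.act V.act, U_eq]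
    simp only [map_mul, Module.End.mul_apply]
    rfl
  simp only [sum2_tmul, map_sum2, map_sum3, assocMap_tmul, sum3_tmul, sum2_apply, sum3_apply]
  refine (sum2_congr _ fun y ψ => sum3_congr _ fun X1 X2 X3 => sum3_congr _ fun Y1 Y2 Y3 =>
    h2 _ _ _).trans ?_
  simp only [tensorAct_eq_sum2, sum2_apply, map_sum2, sum2_smul, Q, sum3_apply, map_sum3]
  refine (sum2_congr _ fun y ψ => sum3_comm _ _ _).trans ((sum2_sum3_comm _ _ _).trans ?_)
  refine sum3_congr _ fun Y1 Y2 Y3 => ?_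
  refine (sum2_congr _ fun y ψ => (sum2_sum3_comm _ _ _).symm).trans ((sum2_comm _ _ _).trans ?_)
  refine sum2_congr _ fun Y21 Y22 => (sum2_sum3_comm _ _ _).trans ?_
  refine Eq.trans ?_ ((h1 Y1 Y21 Y22 (outerAct V.act W.act
    (A.f * TensorProduct.comm k H H R * R * A.U) (V.act Y3 v ⊗ₜ[k] w))).trans ?_)
  · refine sum3_congr _ fun X1 X2 X3 => sum2_congr _ fun y ψ => ?_
    simp only [map_mul, Module.End.mul_apply]
    rfl
  · refine sum2_congr _ fun p1 p2 => ?_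
    refine (apply_mul_comm_mul_mul ((TensorProduct.lid k W).toLinearMap ∘ₗ TensorProduct.map
      (φ ∘ₗ V.act (A.S (Y22 * p2))) (W.act (Y1 * A.S (Y21 * p1))) ∘ₗ
        LinearMap.applyₗ (V.act Y3 v ⊗ₜ[k] w) ∘ₗ (outerAct V.act W.act).toLinearMap) _ _ _).trans ?_
    refine sum2_congr _ fun f1 f2 => sum2_congr _ fun R1 R2 => sum2_congr _ fun r1 r2 =>
      sum2_congr _ fun U1 U2 => ?_
    simp [mul_assoc]

theorem toEnd_Q_coeff (V W : Rep hR) :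
    (toEnd W).lin ∘ₗ ((down k H).symm.toLinearMap ∘ₗ A.Q R) ∘ₗ (coeff V).lin =
    ((λ_ (lDual V)).inv ▷ V ≫ η_ W (lDual W) ▷ lDual V ▷ V ≫ (α_ _ _ _).hom ▷ V ≫
      (α_ _ _ _).hom ≫ W ◁ dualDoubleBraiding V W ▷ V ≫ W ◁ (α_ _ _ _).hom ≫
      W ◁ lDual W ◁ ε_ V (lDual V) ≫ W ◁ (ρ_ (lDual W)).hom).lin := by
  refine TensorProduct.ext' fun (φ : Module.Dual k V) (v : V) => toHom_injective ?_
  refine (toHom_toEnd_lin W _).trans (LinearMap.ext fun w => ?_)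
  exact (toHom_double_braiding V W φ v w).symm

variable (hR) in
/-- The morphism from the coadjoint to the adjoint module given by the R-matrix. -/
noncomputable def mapQ : coadjoint hR ⟶ adjoint hR :=
  -- Linearity of `𝒬` is tested on matrix coefficients of the regular module at the source and
  -- inside its endomorphisms at the target, where the composite is built from module maps.
  homOfSurjective (coeff (regular hR)) coeff_surjective ((down k H).symm.toLinearMap ∘ₗ A.Q R)
    (homOfInjective (toEnd (regular hR)) toEnd_injective _ _ (toEnd_Q_coeff _ _)) rfl

theorem isHopf_adjointMaps (hβ : A.ε A.β = 1) : (adjointMaps hR hβ).IsHopf :=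
  (compatible_adjointMaps hβ).induces.isHopf endFamily_faithful

theorem isHopf_coadjointMaps (hα : A.ε A.α = 1) : (coadjointMaps hR hα).IsHopf :=
  (compatible_coadjointMaps hα).induces.isHopf coendFamily_faithful

theorem isHom_mapQ (hα : A.ε A.α = 1) (hβ : A.ε A.β = 1) :
    (coadjointMaps hR hα).IsHom (adjointMaps hR hβ) (mapQ hR) :=
  HopfMaps.isHom_of_double_braiding (compatible_coadjointMaps hα).induces
    (compatible_adjointMaps hβ).induces coendFamily_faithful endFamily_faithful
    (double_braiding_of_map fun V W => hom_ext (toEnd_Q_coeff V W))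

end Rep

end QuasiHopfAlgebra

/-! ### Transport of braided Hopf algebras along isomorphisms -/

namespace QuasiHopfAlgebra

open QuasiHopf

section Transport

variable {k H : Type*} [Field k] [Ring H] [Algebra k H] (A : QuasiHopfAlgebra k H)
  (R : H ⊗[k] H) {B C : Type*} [AddCommGroup B] [Module k B] [AddCommGroup C] [Module k C]

/-- The linear isomorphism `e` is compatible with all structure maps. -/
structure BraidedHopfData.IsIso (D : BraidedHopfData k H B) (E : BraidedHopfData k H C)
    (e : B ≃ₗ[k] C) : Prop where
  act : ∀ h, e.toLinearMap ∘ₗ D.act h = E.act h ∘ₗ e.toLinearMap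
  mul : e.toLinearMap ∘ₗ D.mul = E.mul ∘ₗ TensorProduct.map e.toLinearMap e.toLinearMap
  one : e D.one = E.one
  comul : TensorProduct.map e.toLinearMap e.toLinearMap ∘ₗ D.comul = E.comul ∘ₗ e.toLinearMap
  counit : D.counit = E.counit ∘ₗ e.toLinearMap
  antipode : e.toLinearMap ∘ₗ D.antipode = E.antipode ∘ₗ e.toLinearMap

theorem map_lTensor_natural {M N M' N' : Type*} [AddCommGroup M] [Module k M] [AddCommGroup N]
    [Module k N] [AddCommGroup M'] [Module k M'] [AddCommGroup N'] [Module k N'] {a : M →ₗ[k] M'}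
    {b : N →ₗ[k] N'} {f : M →ₗ[k] N} {f' : M' →ₗ[k] N'} (h : b ∘ₗ f = f' ∘ₗ a) (e : B →ₗ[k] C) :
    TensorProduct.map e b ∘ₗ f.lTensor B = f'.lTensor C ∘ₗ TensorProduct.map e a := by
  rw [LinearMap.lTensor, LinearMap.lTensor, ← TensorProduct.map_comp, ← TensorProduct.map_comp, h]
  rfl

theorem map_rTensor_natural {M N M' N' : Type*} [AddCommGroup M] [Module k M] [AddCommGroup N]
    [Module k N] [AddCommGroup M'] [Module k M'] [AddCommGroup N'] [Module k N'] {a : M →ₗ[k] M'}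
    {b : N →ₗ[k] N'} {f : M →ₗ[k] N} {f' : M' →ₗ[k] N'} (h : b ∘ₗ f = f' ∘ₗ a) (e : B →ₗ[k] C) :
    TensorProduct.map b e ∘ₗ f.rTensor B = f'.rTensor C ∘ₗ TensorProduct.map a e := by
  rw [LinearMap.rTensor, LinearMap.rTensor, ← TensorProduct.map_comp, ← TensorProduct.map_comp, h]
  rfl

variable {A} in
theorem assocInvMap_natural {V W X V' W' X' : Type*} [AddCommGroup V] [Module k V] [AddCommGroup W]
    [Module k W] [AddCommGroup X] [Module k X] [AddCommGroup V'] [Module k V'] [AddCommGroup W']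
    [Module k W'] [AddCommGroup X'] [Module k X'] {ρ : H →ₐ[k] Module.End k V}
    {σ : H →ₐ[k] Module.End k W} {τ : H →ₐ[k] Module.End k X}
    {ρ' : H →ₐ[k] Module.End k V'} {σ' : H →ₐ[k] Module.End k W'} {τ' : H →ₐ[k] Module.End k X'}
    {f : V →ₗ[k] V'} {g : W →ₗ[k] W'} {l : X →ₗ[k] X'} (hf : ∀ a, f ∘ₗ ρ a = ρ' a ∘ₗ f)
    (hg : ∀ a, g ∘ₗ σ a = σ' a ∘ₗ g) (hl : ∀ a, l ∘ₗ τ a = τ' a ∘ₗ l) :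
    TensorProduct.map (TensorProduct.map f g) l ∘ₗ A.assocInvMap ρ σ τ =
      A.assocInvMap ρ' σ' τ' ∘ₗ TensorProduct.map f (TensorProduct.map g l) := by
  have h1 := congrArg (fun m => A.assocInvMap ρ' σ' τ' ∘ₗ m ∘ₗ A.assocInvMap ρ σ τ)
    (A.assocMap_natural hf hg hl)
  simp only [LinearMap.comp_assoc, assocMap_comp_assocInvMap, LinearMap.comp_id] at h1
  simp only [← LinearMap.comp_assoc, assocInvMap_comp_assocMap, LinearMap.id_comp] at h1
  exact h1

namespace BraidedHopfData.IsIso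

variable {D : BraidedHopfData k H B} {E : BraidedHopfData k H C} {e : B ≃ₗ[k] C}

theorem tensorAct_natural (h : D.IsIso E e) (a : H) :
    TensorProduct.map e.toLinearMap e.toLinearMap ∘ₗ A.tensorAct D.act D.act a =
      A.tensorAct E.act E.act a ∘ₗ TensorProduct.map e.toLinearMap e.toLinearMap :=
  map_comp_outerAct h.act h.act (A.Δ a)

theorem tensorSquareMul_natural (h : D.IsIso E e) :
    TensorProduct.map e.toLinearMap e.toLinearMap ∘ₗ tensorSquareMul A R D =
      tensorSquareMul A R E ∘ₗ TensorProduct.map (TensorProduct.map e.toLinearMap e.toLinearMap)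
        (TensorProduct.map e.toLinearMap e.toLinearMap) := by
  have ha := h.act
  have ht := h.tensorAct_natural A
  have h1 := (A.assocMap_natural ha ha ht).symm
  have h2 := map_lTensor_natural (A.assocInvMap_natural ha ha ha) e.toLinearMap
  have h3 := map_lTensor_natural (map_rTensor_natural (braiding_natural R ha ha).symm
    e.toLinearMap) e.toLinearMap
  have h4 := map_lTensor_natural (A.assocMap_natural ha ha ha).symm e.toLinearMap
  have h5 := A.assocInvMap_natural ha ha ht
  have h6 : TensorProduct.map e.toLinearMap e.toLinearMap ∘ₗ TensorProduct.map D.mul D.mul =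
      TensorProduct.map E.mul E.mul ∘ₗ TensorProduct.map
        (TensorProduct.map e.toLinearMap e.toLinearMap)
        (TensorProduct.map e.toLinearMap e.toLinearMap) := by
    rw [← TensorProduct.map_comp, ← TensorProduct.map_comp, h.mul]
  refine LinearMap.ext fun t => ?_
  refine (LinearMap.congr_fun h6 _).trans (congrArg (TensorProduct.map E.mul E.mul) ?_)
  refine (LinearMap.congr_fun h5 _).trans (congrArg (A.assocInvMap E.act E.act (A.tensorAct E.act E.act)) ?_)
  refine (LinearMap.congr_fun h4 _).trans (congrArg ((A.assocMap E.act E.act E.act).lTensor C) ?_)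
  refine (LinearMap.congr_fun h3 _).trans (congrArg (((braiding R E.act E.act).rTensor C).lTensor C) ?_)
  refine (LinearMap.congr_fun h2 _).trans (congrArg ((A.assocInvMap E.act E.act E.act).lTensor C) ?_)
  exact LinearMap.congr_fun h1 _

variable {A R} in
-- Needed because the adjoint module lives on a lift of `H`. Associators, braiding and tensor
-- actions are natural, so each axiom is carried over by `e`.
theorem isBraidedHopfAlgebra (h : D.IsIso E e) (hD : IsBraidedHopfAlgebra A R D) :
    IsBraidedHopfAlgebra A R E := by
  have s2 : Function.Surjective (TensorProduct.map e.toLinearMap e.toLinearMap) :=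
    TensorProduct.map_surjective e.surjective e.surjective
  have s3 := TensorProduct.map_surjective s2 (g' := e.toLinearMap) e.surjective
  have act : ∀ a x, E.act a (e x) = e (D.act a x) := fun a => LinearMap.congr_fun (h.act a).symm
  have mul : ∀ t, E.mul (TensorProduct.map e.toLinearMap e.toLinearMap t) = e (D.mul t) :=
    LinearMap.congr_fun h.mul.symm
  have comul : ∀ t, E.comul (e t) = TensorProduct.map e.toLinearMap e.toLinearMap (D.comul t) :=
    LinearMap.congr_fun h.comul.symm
  have counit : ∀ t, E.counit (e t) = D.counit t := LinearMap.congr_fun h.counit.symm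
  have antipode : ∀ t, E.antipode (e t) = e (D.antipode t) := LinearMap.congr_fun h.antipode.symm
  have tact : ∀ a t, A.tensorAct E.act E.act a (TensorProduct.map e.toLinearMap e.toLinearMap t) =
      TensorProduct.map e.toLinearMap e.toLinearMap (A.tensorAct D.act D.act a t) := fun a =>
    LinearMap.congr_fun (h.tensorAct_natural A a).symm
  have assoc := LinearMap.congr_fun (A.assocMap_natural h.act h.act h.act)
  have lmul := LinearMap.congr_fun (map_lTensor_natural h.mul e.toLinearMap)
  have rmul := LinearMap.congr_fun (map_rTensor_natural h.mul e.toLinearMap)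
  have lcomul := LinearMap.congr_fun (map_lTensor_natural h.comul e.toLinearMap)
  have rcomul := LinearMap.congr_fun (map_rTensor_natural h.comul e.toLinearMap)
  have lanti := LinearMap.congr_fun (map_lTensor_natural h.antipode e.toLinearMap)
  have ranti := LinearMap.congr_fun (map_rTensor_natural h.antipode e.toLinearMap)
  have hc : LinearMap.id ∘ₗ D.counit = E.counit ∘ₗ e.toLinearMap := h.counit
  have lcounit := LinearMap.congr_fun (map_lTensor_natural hc e.toLinearMap)
  have rcounit := LinearMap.congr_fun (map_rTensor_natural hc e.toLinearMap)
  simp only [LinearMap.comp_apply] at assoc lmul rmul lcomul rcomul lanti ranti lcounit rcounit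
  have mulT : ∀ x y, E.mul (e x ⊗ₜ[k] e y) = e (D.mul (x ⊗ₜ[k] y)) := fun x y => mul (x ⊗ₜ[k] y)
  constructor
  case mul_act =>
    refine fun a => LinearMap.ext fun t => ?_
    obtain ⟨t, rfl⟩ := s2 t
    simp only [LinearMap.comp_apply, tact, mul, act]
    exact congrArg e (LinearMap.congr_fun (hD.mul_act a) t)
  case one_act =>
    intro a
    rw [← h.one, act, hD.one_act, map_smul]
  case comul_act =>
    refine fun a => LinearMap.ext fun t => ?_
    obtain ⟨t, rfl⟩ := e.surjective t
    simp only [LinearMap.comp_apply, act, comul, tact]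
    exact congrArg _ (LinearMap.congr_fun (hD.comul_act a) t)
  case counit_act =>
    intro a b
    obtain ⟨b, rfl⟩ := e.surjective b
    rw [act, counit, counit, hD.counit_act]
  case antipode_act =>
    refine fun a => LinearMap.ext fun t => ?_
    obtain ⟨t, rfl⟩ := e.surjective t
    simp only [LinearMap.comp_apply, act, antipode]
    exact congrArg _ (LinearMap.congr_fun (hD.antipode_act a) t)
  case mul_assoc =>
    refine LinearMap.ext fun t => ?_
    obtain ⟨t, rfl⟩ := s3 t
    simp only [LinearMap.comp_apply, assoc, ← lmul, ← rmul, mul]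
    exact congrArg _ (LinearMap.congr_fun hD.mul_assoc t)
  case one_mul =>
    intro b
    obtain ⟨b, rfl⟩ := e.surjective b
    rw [← h.one, mulT, hD.one_mul]
  case mul_one =>
    intro b
    obtain ⟨b, rfl⟩ := e.surjective b
    rw [← h.one, mulT, hD.mul_one]
  case comul_coassoc =>
    refine LinearMap.ext fun t => ?_
    obtain ⟨t, rfl⟩ := e.surjective t
    simp only [LinearMap.comp_apply, comul, ← lcomul, ← rcomul, assoc]
    exact congrArg _ (LinearMap.congr_fun hD.comul_coassoc t)
  case counit_comul =>
    intro b
    obtain ⟨b, rfl⟩ := e.surjective b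
    rw [comul, ← rcounit, hD.counit_comul]
    rfl
  case comul_counit =>
    intro b
    obtain ⟨b, rfl⟩ := e.surjective b
    rw [comul, ← lcounit, hD.comul_counit]
    rfl
  case comul_mul =>
    refine LinearMap.ext fun t => ?_
    obtain ⟨t, rfl⟩ := s2 t
    simp only [LinearMap.comp_apply, mul, comul]
    have h1 : TensorProduct.map E.comul E.comul (TensorProduct.map e.toLinearMap e.toLinearMap t) =
        TensorProduct.map (TensorProduct.map e.toLinearMap e.toLinearMap)
          (TensorProduct.map e.toLinearMap e.toLinearMap) (TensorProduct.map D.comul D.comul t) := by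
      simp only [← LinearMap.comp_apply, ← TensorProduct.map_comp, h.comul]
    rw [h1]
    exact (congrArg _ (LinearMap.congr_fun hD.comul_mul t)).trans
      (LinearMap.congr_fun (h.tensorSquareMul_natural A R) _)
  case comul_one =>
    rw [← h.one, comul, hD.comul_one]
    rfl
  case counit_mul =>
    intro a b
    obtain ⟨a, rfl⟩ := e.surjective a
    obtain ⟨b, rfl⟩ := e.surjective b
    rw [mulT, counit, counit, counit, hD.counit_mul]
  case counit_one =>
    rw [← h.one, counit, hD.counit_one]
  case antipode_left =>
    intro b
    obtain ⟨b, rfl⟩ := e.surjective b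
    rw [comul, ← ranti, mul, hD.antipode_left, counit, map_smul, h.one]
  case antipode_right =>
    intro b
    obtain ⟨b, rfl⟩ := e.surjective b
    rw [comul, ← lanti, mul, hD.antipode_right, counit, map_smul, h.one]

end BraidedHopfData.IsIso

end Transport

end QuasiHopfAlgebra

/-! ### From morphisms of modules back to linear maps -/

namespace QuasiHopfAlgebra

open QuasiHopf

namespace Rep

open CategoryTheory MonoidalCategory

variable {k : Type u} {H : Type v} [Field k] [Ring H] [Algebra k H] {A : QuasiHopfAlgebra k H}
  {R : H ⊗[k] H} {hR : A.IsRMatrix R}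

/-- The structure maps underlying morphisms of modules. -/
noncomputable def hopfData {X : Rep hR} (M : HopfMaps X) : BraidedHopfData k H X where
  act := X.act
  mul := M.mul.lin
  one := M.one.lin (ULift.up 1)
  comul := M.comul.lin
  counit := (ULift.moduleEquiv : ULift.{v} k ≃ₗ[k] k).toLinearMap ∘ₗ M.counit.lin
  antipode := M.antipode.lin

theorem isBraidedHopfAlgebra_hopfData {X : Rep hR} {M : HopfMaps X} (hM : M.IsHopf) :
    IsBraidedHopfAlgebra A R (hopfData M) where
  mul_act h := M.mul.comm h
  one_act h := by
    refine (LinearMap.congr_fun (M.one.comm h) (ULift.up 1)).symm.trans ?_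
    refine Eq.trans ?_ (map_smul M.one.lin (A.ε h) (ULift.up 1))
    exact congrArg M.one.lin (trivialAct_apply _ _ _)
  comul_act h := M.comul.comm h
  counit_act h b := by
    refine congrArg ULift.down ((LinearMap.congr_fun (M.counit.comm h) b).trans ?_)
    exact trivialAct_apply _ _ _
  antipode_act h := M.antipode.comm h
  mul_assoc := (congrArg Hom.lin hM.mul_assoc).symm
  one_mul b := (LinearMap.congr_fun (congrArg Hom.lin hM.one_mul)
    ((ULift.up 1 : ULift.{v} k) ⊗ₜ[k] b)).trans (one_smul k b)
  mul_one b := (LinearMap.congr_fun (congrArg Hom.lin hM.mul_one)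
    (b ⊗ₜ[k] (ULift.up 1 : ULift.{v} k))).trans (one_smul k b)
  comul_coassoc := congrArg Hom.lin hM.comul_assoc
  counit_comul b := by
    refine (LinearMap.congr_fun (LinearMap.rTensor_comp X _ _) _).trans ?_
    exact congrArg _ (LinearMap.congr_fun (congrArg Hom.lin hM.counit_comul) b)
  comul_counit b := by
    refine (LinearMap.congr_fun (LinearMap.lTensor_comp X _ _) _).trans ?_
    exact congrArg _ (LinearMap.congr_fun (congrArg Hom.lin hM.comul_counit) b)
  -- `tensorμ` unfolds to the five rearrangements in `tensorSquareMul`.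
  comul_mul := congrArg Hom.lin hM.mul_comul
  comul_one := LinearMap.congr_fun (congrArg Hom.lin hM.one_comul) (ULift.up 1)
  counit_mul a b := congrArg ULift.down
    (LinearMap.congr_fun (congrArg Hom.lin hM.mul_counit) (a ⊗ₜ[k] b))
  counit_one := congrArg ULift.down
    (LinearMap.congr_fun (congrArg Hom.lin hM.one_counit) (ULift.up 1))
  antipode_left b := by
    refine (LinearMap.congr_fun (congrArg Hom.lin hM.antipode_left) b).trans ?_
    refine Eq.trans ?_ (map_smul M.one.lin _ _)
    exact congrArg M.one.lin (congrArg ULift.up (mul_one _).symm)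
  antipode_right b := by
    refine (LinearMap.congr_fun (congrArg Hom.lin hM.antipode_right) b).trans ?_
    refine Eq.trans ?_ (map_smul M.one.lin _ _)
    exact congrArg M.one.lin (congrArg ULift.up (mul_one _).symm)

variable [FiniteDimensional k H]

theorem isBraidedHopfAlgebra_envelopingBraidedGroup (hR : A.IsRMatrix R) (hβ : A.ε A.β = 1) :
    IsBraidedHopfAlgebra A R (A.envelopingBraidedGroup R) := by
  refine BraidedHopfData.IsIso.isBraidedHopfAlgebra (e := down k H)
    (D := hopfData (adjointMaps hR hβ)) ?_ (isBraidedHopfAlgebra_hopfData (isHopf_adjointMaps hβ))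
  constructor
  case act => exact fun h => rfl
  case mul => rfl
  case one => exact one_smul k A.β
  case comul =>
    refine LinearMap.ext fun x => ?_
    change (TensorProduct.map _ _ ∘ₗ TensorProduct.map _ _) _ = _
    rw [← TensorProduct.map_comp, LinearEquiv.comp_symm, TensorProduct.map_id]
    rfl
  case counit => rfl
  case antipode => rfl

theorem isBraidedHopfAlgebra_functionBraidedGroup (hR : A.IsRMatrix R) (hα : A.ε A.α = 1) :
    IsBraidedHopfAlgebra A R (A.functionBraidedGroup R) := by
  -- The transport is along the identity; it only adjusts the unit, which is extracted from a
  -- morphism as `1 • ε`.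
  refine BraidedHopfData.IsIso.isBraidedHopfAlgebra (e := LinearEquiv.refl k (Module.Dual k H))
    (D := hopfData (coadjointMaps hR hα)) ?_
    (isBraidedHopfAlgebra_hopfData (isHopf_coadjointMaps hα))
  constructor
  case act => exact fun h => rfl
  case mul =>
    rw [LinearEquiv.refl_toLinearMap, TensorProduct.map_id]
    rfl
  case one => exact one_smul k (A.functionBraidedGroup R).one
  case comul =>
    rw [LinearEquiv.refl_toLinearMap, TensorProduct.map_id]
    rfl
  case counit => rfl
  case antipode => rfl

theorem isBraidedHopfHom_Q (hR : A.IsRMatrix R) (hα : A.ε A.α = 1) (hβ : A.ε A.β = 1) :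
    IsBraidedHopfHom (A.functionBraidedGroup R) (A.envelopingBraidedGroup R) (A.Q R) := by
  have h := isHom_mapQ (hR := hR) hα hβ
  constructor
  case map_act =>
    exact fun a => LinearMap.ext fun χ =>
      congrArg ULift.down (LinearMap.congr_fun ((mapQ hR).comm a) χ)
  case map_mul =>
    exact TensorProduct.ext' fun χ ψ =>
      congrArg ULift.down (LinearMap.congr_fun (congrArg Hom.lin h.map_mul) (χ ⊗ₜ[k] ψ))
  case map_one =>
    have h1 := congrArg ULift.down (LinearMap.congr_fun (congrArg Hom.lin h.map_one) (ULift.up 1))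
    change A.Q R ((1 : k) • (A.functionBraidedGroup R).one) = (1 : k) • A.β at h1
    rw [one_smul, one_smul] at h1
    exact h1
  case map_comul =>
    refine LinearMap.ext fun χ => ?_
    have h1 : TensorProduct.map (down k H).symm.toLinearMap (down k H).symm.toLinearMap
        ((A.envelopingBraidedGroup R).comul (A.Q R χ)) =
        TensorProduct.map ((down k H).symm.toLinearMap ∘ₗ A.Q R)
          ((down k H).symm.toLinearMap ∘ₗ A.Q R) ((A.functionBraidedGroup R).comul χ) :=
      LinearMap.congr_fun (congrArg Hom.lin h.map_comul) χ
    rw [TensorProduct.map_comp] at h1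
    exact (TensorProduct.congr (down k H).symm (down k H).symm).injective h1
  case map_counit =>
    exact LinearMap.ext fun χ =>
      congrArg ULift.down (LinearMap.congr_fun (congrArg Hom.lin h.map_counit) χ)
  case map_antipode =>
    exact LinearMap.ext fun χ =>
      congrArg ULift.down (LinearMap.congr_fun (congrArg Hom.lin h.map_antipode) χ)

end Rep

end QuasiHopfAlgebra

theorem mainTheorem5 {k H : Type*} [Field k] [Ring H] [Algebra k H] [FiniteDimensional k H]
    (A : QuasiHopfAlgebra k H) (hα : A.ε A.α = 1) (hβ : A.ε A.β = 1)
    (R : H ⊗[k] H) (hR : A.IsRMatrix R) :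
    QuasiHopfAlgebra.IsBraidedHopfAlgebra A R (A.functionBraidedGroup R) ∧
    QuasiHopfAlgebra.IsBraidedHopfAlgebra A R (A.envelopingBraidedGroup R) ∧
    QuasiHopfAlgebra.IsBraidedHopfHom (A.functionBraidedGroup R) (A.envelopingBraidedGroup R)
      (A.Q R) :=
  ⟨QuasiHopfAlgebra.Rep.isBraidedHopfAlgebra_functionBraidedGroup hR hα,
    QuasiHopfAlgebra.Rep.isBraidedHopfAlgebra_envelopingBraidedGroup hR hβ,
    QuasiHopfAlgebra.Rep.isBraidedHopfHom_Q hR hα hβ⟩
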